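/- Let $M$ be a smooth finite-dimensional manifold and let $L:A\to\mathbb R$ be a (conic) pseudo-Finsler metric on $M$: $A\subset TM\setminus\mathbf 0$ is open, projects onto $M$ and satisfies $\lambda v\in A$ for $v\in A$, $\lambda>0$; $L$ is smooth with $L(\lambda v)=\lambda^2L(v)$ for $v\in A$, $\lambda>0$; and for every $v\in A$ the fundamental tensor $g_v(u,w)=\frac12\frac{\partial^2}{\partial t\,\partial s}L(v+tu+sw)|_{t=s=0}$ is nondegenerate. Let $C_v(w_1,w_2,w_3)=\frac14\frac{\partial^3}{\partial s_3\partial s_2\partial s_1}L(v+\sum_i s_iw_i)|_{s_i=0}$ be the Cartan tensor. For a vector field $V$ with values in $A$, let $\nabla^V$ be the Chern connection, i.e. the torsion-free affine connection with $$X(g_V(Y,Z))=g_V(\nabla^V_XY,Z)+g_V(Y,\nabla^V_XZ)+2C_V(\nabla^V_XV,Y,Z).$$ Its Christoffel symbols at a point depend only on the value of $V$ there, so for a curve $c$ and a field $V$ along $c$ with values in $A$ there is an induced covariant derivative $D^V_c$ of vector fields along $c$. Let $P$ and $Q$ be (embedded) submanifolds of $M$ and $a<b$. Let $\gamma:[a,b]\to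 M$ be a geodesic of $(M,L)$, i.e. a smooth curve with $\dot\gamma(t)\in A$ for all $t$ and $D^{\dot\gamma}_\gamma\dot\gamma=0$, such that * $\gamma(a)\in P$ and $\gamma(b)\in Q$; * $g_{\dot\gamma(a)}(\dot\gamma(a),u)=0$ for all $u\in T_{\gamma(a)}P$, and $g_{\dot\gamma(b)}(\dot\gamma(b),w)=0$ for all $w\in T_{\gamma(b)}Q$; * the restrictions of $g_{\dot\gamma(a)}$ to $T_{\gamma(a)}P$ and of $g_{\dot\gamma(b)}$ to $T_{\gamma(b)}Q$ are nondegenerate. Let $\Lambda:[a,b]\times(-\varepsilon,\varepsilon)\to M$, $\varepsilon>0$, be a smooth $L$-admissible $(P,Q)$-variation of $\gamma$. That is, $\Lambda$ is smooth, $\Lambda(\cdot,0)=\gamma$, and the curves $\gamma_s=\Lambda(\cdot,s)$ satisfy $\dot\gamma_s(t)\in A$, $\gamma_s(a)\in P$ and $\gamma_s(b)\in Q$ for all $t\in[a,b]$ and $s\in(-\varepsilon,\varepsilon)$. Let $W(t)=\Lambda_s(t,0)$ be its variational vector field and $E(s)=\frac12\int_a^bL(\dot\gamma_s(t))\,dt$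 the energy of $\gamma_s$. Then $W(a)\in T_{\gamma(a)}P$, $W(b)\in T_{\gamma(b)}Q$, the function $E$ is differentiable on $(-\varepsilon,\varepsilon)$, $E'$ is differentiable at $0$, and $$E''(0)=\int_a^b\Big(-g_{\dot\gamma}\big(R^\gamma(\dot\gamma,W)W,\dot\gamma\big)+g_{\dot\gamma}(W',W')\Big)dt+g_{\dot\gamma(b)}\big(S^Q_{\dot\gamma(b)}(W(b),W(b)),\dot\gamma(b)\big)-g_{\dot\gamma(a)}\big(S^P_{\dot\gamma(a)}(W(a),W(a)),\dot\gamma(a)\big),$$ where all integrands are integrable and the notation is as follows. * $W'=D^{\dot\gamma}_\gamma W$. * For a smooth vector field $Z$ along $\gamma$, $R^\gamma(\dot\gamma,W)Z$ is the value at $s=0$ of $D_{\gamma_s}^{\tilde\Lambda_t}D_{\beta_t}^{\tilde\Lambda_t}\tilde Z-D_{\beta_t}^{\tilde\Lambda_t}D_{\gamma_s}^{\tilde\Lambda_t}\tilde Z$. Here $\tilde\Lambda$ is any smooth $L$-admissible variation of $\gamma$ with variational field $W$, $\gamma_s=\tilde\Lambda(\cdot,s)$, $\beta_t=\tilde\Lambda(t,\cdot)$,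 $\tilde\Lambda_t=\dot\gamma_s$, and $\tilde Z$ is any smooth vector field along $\tilde\Lambda$ extending $Z$; the value does not depend on these choices. * For $N\in T_pM\cap A$ that is $g_N$-orthogonal to $T_pP$ and such that $g_N|_{T_pP\times T_pP}$ is nondegenerate, the second fundamental form of $P$ in the direction of $N$ is $S^P_N(u,w)=\operatorname{nor}_N\nabla^N_U\mathcal W$ at $p$. Here $U,\mathcal W$ are local vector fields on $P$ extending $u,w\in T_pP$, and $\operatorname{nor}_N$ is the projection onto the second summand of $T_pM=T_pP\oplus(T_pP)^{\perp_{g_N}}$. The value does not depend on the extensions. $S^Q_N$ is defined in the same way. In particular, $E''(0)$ depends only on the variational field $W$: two smooth $L$-admissible $(P,Q)$-variations of $\gamma$ with the same variational field have the same $E''(0)$. -/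

import Mathlib

open Set Filter Topology Bundle Manifold
open scoped Manifold ContDiff

noncomputable section

namespace PseudoFinsler

/-! ### The Chern connection in a coordinate domain

A Lagrangian in coordinates is a function `F (x, y)` on (an open subset of) `E × E`, where `x` is
the base point and `y` the velocity. All tensors below are meaningful where `F` is smooth and its
vertical Hessian is nondegenerate. -/

section Coordinates

variable {E : Type*} [NormedAddCommGroup E] [NormedSpace ℝ E]

set_option synthInstance.maxHeartbeats 200000

/-- Fundamental tensor `g_(x,y)(u, w) = 1/2 ∂²/∂t∂s F (x, y + t u + s w)` at `t = s = 0`. -/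
def gLoc (F : E × E → ℝ) (x y : E) : E →L[ℝ] E →L[ℝ] ℝ :=
  (1 / 2 : ℝ) • fderiv ℝ (fderiv ℝ (fun y' : E => F (x, y'))) y

/-- Cartan tensor: `1/4` times the third vertical derivative of `F`. -/
def cartanLoc (F : E × E → ℝ) (x y : E) : E →L[ℝ] E →L[ℝ] E →L[ℝ] ℝ :=
  (1 / 4 : ℝ) • fderiv ℝ (fderiv ℝ (fderiv ℝ (fun y' : E => F (x, y')))) y

/-- Horizontal partial derivative of the fundamental tensor:
`dgLoc F x y X Y Z = ∂_X (g_(x,y)(Y, Z))`, with `y`, `Y`, `Z` held constant. -/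
def dgLoc (F : E × E → ℝ) (x y : E) : E →L[ℝ] E →L[ℝ] E →L[ℝ] ℝ :=
  fderiv ℝ (fun x' : E => gLoc F x' y) x

/-- The vector `u` with `g_(x,y)(u, ·) = ω`. -/
def sharpLoc (F : E × E → ℝ) (x y : E) : (E →L[ℝ] ℝ) →L[ℝ] E :=
  ContinuousLinearMap.inverse (gLoc F x y)

/-- Formal Christoffel symbols of the first kind, as the one-form
`Z ↦ 1/2 (∂_X g(Y, Z) + ∂_Y g(X, Z) - ∂_Z g(X, Y))`. -/
def formalChristoffel (F : E × E → ℝ) (x y X Y : E) : E →L[ℝ] ℝ :=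
  (1 / 2 : ℝ) • (dgLoc F x y X Y + dgLoc F x y Y X - ((dgLoc F x y).flip X).flip Y)

/-- Spray coefficients `Γ(y, y)`, i.e. `g(Γ(y, y), Z) = γ(y, y, Z)`, where `γ` are the formal
Christoffel symbols. -/
def sprayLoc (F : E × E → ℝ) (x y : E) : E :=
  sharpLoc F x y (formalChristoffel F x y y y)

/-- Nonlinear connection `X ↦ Γ(X, y)`, i.e.
`g(Γ(X, y), Z) = γ(X, y, Z) - C(Γ(y, y), X, Z)`. -/
def nonlinearLoc (F : E × E → ℝ) (x y : E) : E →L[ℝ] E :=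
  sharpLoc F x y ∘L
    ((1 / 2 : ℝ) • ((dgLoc F x y).flip y + dgLoc F x y y - ((dgLoc F x y).flip y).flip)
      - cartanLoc F x y (sprayLoc F x y))

/-- Christoffel symbols `Γ_(x,y)(X, Y) = Γᵏᵢⱼ(x, y) Xⁱ Yʲ ∂ₖ` of the Chern connection, given by its
Koszul formula
`g(Γ(X, Y), Z) = γ(X, Y, Z) - C(Γ(X, y), Y, Z) - C(Γ(Y, y), X, Z) + C(Γ(Z, y), X, Y)`.
These are the only symbols that are symmetric in `X, Y` (torsion-freeness) and satisfy
`∂_X g(Y, Z) = g(Γ(X, Y), Z) + g(Y, Γ(X, Z)) + 2 C(Γ(X, y), Y, Z)` (almost `g`-compatibility). -/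
def chernLoc (F : E × E → ℝ) (x y X Y : E) : E :=
  sharpLoc F x y (formalChristoffel F x y X Y
    - cartanLoc F x y (nonlinearLoc F x y X) Y
    - cartanLoc F x y (nonlinearLoc F x y Y) X
    + (cartanLoc F x y X Y) ∘L (nonlinearLoc F x y))

end Coordinates

/-! ### Pseudo-Finsler manifolds

Tangent vectors are points `v` of the tangent bundle, and vector fields along a map `f` are maps
`X` into the tangent bundle with `π ∘ X = f`. The fibre over `p` is `E`, identified with `T_pM`
through the preferred chart at `p`; two vectors given in `E` together with a base point are
vectors at that point. -/

section Manifolds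

variable {E : Type*} [NormedAddCommGroup E] [NormedSpace ℝ E]
  {M : Type*} [TopologicalSpace M] [ChartedSpace E M]

/-- The vector part of a point of the tangent bundle. -/
def vec (v : TangentBundle 𝓘(ℝ, E) M) : E := v.2

/-- The tangent vector `y` at `p`. -/
def tvec (p : M) (y : E) : TangentBundle 𝓘(ℝ, E) M := ⟨p, y⟩

/-- The fundamental tensor `g_v` of a function `L` on the tangent bundle: half the Hessian at `v`
of the restriction of `L` to the tangent space containing `v`. -/
def fundTensor (L : TangentBundle 𝓘(ℝ, E) M → ℝ) (v : TangentBundle 𝓘(ℝ, E) M) :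
    E →L[ℝ] E →L[ℝ] ℝ :=
  (1 / 2 : ℝ) • fderiv ℝ (fderiv ℝ (fun y : E => L (tvec v.proj y))) (vec v)

variable (E M) in
/-- A (conic, two-homogeneous) pseudo-Finsler metric on `M`. Only the values of `L` on the domain
`A` are relevant. -/
structure PseudoFinslerMetric [IsManifold 𝓘(ℝ, E) ∞ M] where
  /-- the conic open domain -/
  A : Set (TangentBundle 𝓘(ℝ, E) M)
  /-- the metric -/
  L : TangentBundle 𝓘(ℝ, E) M → ℝ
  isOpen_A : IsOpen A
  ne_zero : ∀ v ∈ A, vec v ≠ 0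
  exists_mem : ∀ p : M, ∃ v ∈ A, v.proj = p
  smul_mem : ∀ v ∈ A, ∀ c : ℝ, 0 < c → tvec v.proj (c • vec v) ∈ A
  smooth : ContMDiffOn 𝓘(ℝ, E).tangent 𝓘(ℝ, ℝ) ∞ L A
  homogeneous : ∀ v ∈ A, ∀ c : ℝ, 0 < c → L (tvec v.proj (c • vec v)) = c ^ 2 * L v
  nondegenerate : ∀ v ∈ A, ∀ u : E, (∀ w : E, fundTensor L v u w = 0) → u = 0

variable [IsManifold 𝓘(ℝ, E) ∞ M] (Φ : PseudoFinslerMetric E M)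

namespace PseudoFinslerMetric

/-- The fundamental tensor `g_v` of the metric. -/
def g (v : TangentBundle 𝓘(ℝ, E) M) : E →L[ℝ] E →L[ℝ] ℝ := fundTensor Φ.L v

/-- The Christoffel symbols of the Chern connection at `v`, in the chart of the tangent bundle
induced by the preferred chart at the base point of `v`. -/
def chern (v : TangentBundle 𝓘(ℝ, E) M) (X Y : E) : E :=
  chernLoc (fun z : E × E => Φ.L ((extChartAt 𝓘(ℝ, E).tangent v).symm z))
    (extChartAt 𝓘(ℝ, E).tangent v v).1 (extChartAt 𝓘(ℝ, E).tangent v v).2 X Y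

/-- Covariant derivative at `k ∈ S`, in the direction `u` and with reference vector `V`, of a vector
field `X` along a map `f = π ∘ X : S → M`. In the chart at `f k` it is
`dX(u) + Γ_V(df(u), X)`. Here `V` is a vector of the domain with the same base point as `X k`. -/
def covDeriv {B : Type*} [NormedAddCommGroup B] [NormedSpace ℝ B]
    {K : Type*} [TopologicalSpace K] [ChartedSpace B K]
    (V : TangentBundle 𝓘(ℝ, E) M) (X : K → TangentBundle 𝓘(ℝ, E) M) (S : Set K) (k : K)
    (u : TangentSpace 𝓘(ℝ, B) k) : E :=
  let h : E × E := mfderivWithin 𝓘(ℝ, B) 𝓘(ℝ, E × E)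
    (fun k' => extChartAt 𝓘(ℝ, E).tangent (X k) (X k')) S k u
  h.2 + Φ.chern V h.1 (vec (X k))

/-- The covariant derivative `D^V_c X` of a vector field `X` along the curve `c = π ∘ X : S → M`
with reference field `V` along `c`; it is again a vector field along `c`. -/
def D (S : Set ℝ) (V X : ℝ → TangentBundle 𝓘(ℝ, E) M) (t : ℝ) : TangentBundle 𝓘(ℝ, E) M :=
  tvec (X t).proj (Φ.covDeriv (V t) X S t (1 : ℝ))

end PseudoFinslerMetric

/-- The velocity `ċ` of a curve `c : S → M`. -/
def velocity (S : Set ℝ) (c : ℝ → M) (t : ℝ) : TangentBundle 𝓘(ℝ, E) M :=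
  tvec (c t) (mfderivWithin 𝓘(ℝ, ℝ) 𝓘(ℝ, E) c S t (1 : ℝ))

namespace PseudoFinslerMetric

/-- The energy `1/2 ∫ₐᵇ L(ċ) dt` of a curve on `[a, b]`. -/
def energy (a b : ℝ) (c : ℝ → M) : ℝ :=
  (1 / 2 : ℝ) * ∫ t in a..b, Φ.L (velocity (Icc a b) c t)

/-- Geodesics: smooth `L`-admissible curves on `[a, b]` with parallel velocity. -/
structure IsGeodesic (a b : ℝ) (γ : ℝ → M) : Prop where
  smooth : ContMDiffOn 𝓘(ℝ, ℝ) 𝓘(ℝ, E) ∞ γ (Icc a b)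
  admissible : ∀ t ∈ Icc a b, velocity (Icc a b) γ t ∈ Φ.A
  parallel : ∀ t ∈ Icc a b,
    vec (Φ.D (Icc a b) (velocity (Icc a b) γ) (velocity (Icc a b) γ) t) = 0

end PseudoFinslerMetric

/-! ### Variations and the Jacobi operator -/

/-- `Λ_t(t, s)`: velocity of the longitudinal curve `Λ(·, s)` at `t`. -/
def dt (a b : ℝ) (Λ : ℝ → ℝ → M) (t s : ℝ) : TangentBundle 𝓘(ℝ, E) M :=
  velocity (Icc a b) (fun t' => Λ t' s) t

/-- `Λ_s(t, s)`: velocity of the transverse curve `Λ(t, ·)` at `s`. -/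
def ds (ε : ℝ) (Λ : ℝ → ℝ → M) (t s : ℝ) : TangentBundle 𝓘(ℝ, E) M :=
  velocity (Ioo (-ε) ε) (fun s' => Λ t s') s

namespace PseudoFinslerMetric

/-- `Λ : [a, b] × (-ε, ε) → M` is a smooth `L`-admissible variation of `γ`. -/
structure IsVariation (a b : ℝ) (γ : ℝ → M) (ε : ℝ) (Λ : ℝ → ℝ → M) : Prop where
  pos : 0 < ε
  smooth : ContMDiffOn 𝓘(ℝ, ℝ × ℝ) 𝓘(ℝ, E) ∞ (Function.uncurry Λ) (Icc a b ×ˢ Ioo (-ε) ε)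
  base : ∀ t ∈ Icc a b, Λ t 0 = γ t
  admissible : ∀ t ∈ Icc a b, ∀ s ∈ Ioo (-ε) ε, dt a b Λ t s ∈ Φ.A

/-- `R^Λ(Z) = D_t D_s Z - D_s D_t Z` for a vector field `Z` along `Λ`, where both covariant
derivatives have reference field `Λ_t`. -/
def curvatureAlong (a b ε : ℝ) (Λ : ℝ → ℝ → M) (Z : ℝ → ℝ → TangentBundle 𝓘(ℝ, E) M) (t s : ℝ) :
    E :=
  vec (Φ.D (Icc a b) (fun t' => dt a b Λ t' s)
      (fun t' => Φ.D (Ioo (-ε) ε) (fun s' => dt a b Λ t' s') (fun s' => Z t' s') s) t)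
    - vec (Φ.D (Ioo (-ε) ε) (fun s' => dt a b Λ t s')
      (fun s' => Φ.D (Icc a b) (fun t' => dt a b Λ t' s') (fun t' => Z t' s') t) s)

/-- `Λ` is a smooth `L`-admissible variation of `γ` with variational field `W`, and `Zt` is a smooth
vector field along `Λ` that extends the vector field `Z` along `γ`. -/
structure IsJacobiExtension (a b : ℝ) (γ : ℝ → M) (W Z : ℝ → TangentBundle 𝓘(ℝ, E) M)
    (ε : ℝ) (Λ : ℝ → ℝ → M) (Zt : ℝ → ℝ → TangentBundle 𝓘(ℝ, E) M) : Prop where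
  variation : Φ.IsVariation a b γ ε Λ
  field : ∀ t ∈ Icc a b, ds ε Λ t 0 = W t
  smooth : ContMDiffOn 𝓘(ℝ, ℝ × ℝ) 𝓘(ℝ, E).tangent ∞ (Function.uncurry Zt)
    (Icc a b ×ˢ Ioo (-ε) ε)
  along : ∀ t ∈ Icc a b, ∀ s ∈ Ioo (-ε) ε, (Zt t s).proj = Λ t s
  extends_field : ∀ t ∈ Icc a b, Zt t 0 = Z t

open Classical in
/-- The Jacobi operator `R^γ(γ̇, W)Z := R^Λ(Zt)` at `s = 0`, where `Λ` is any smooth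
`L`-admissible variation of `γ` with variational field `W` and `Zt` any smooth extension of `Z` to
`Λ` (the result does not depend on these choices). -/
def jacobiOp (a b : ℝ) (γ : ℝ → M) (W Z : ℝ → TangentBundle 𝓘(ℝ, E) M) (t : ℝ) : E :=
  if h : ∃ q : ℝ × (ℝ → ℝ → M) × (ℝ → ℝ → TangentBundle 𝓘(ℝ, E) M),
      Φ.IsJacobiExtension a b γ W Z q.1 q.2.1 q.2.2 then
    Φ.curvatureAlong a b h.choose.1 h.choose.2.1 h.choose.2.2 t 0
  else 0

end PseudoFinslerMetric

/-! ### Submanifolds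

A submanifold of `M` is a subset `P` whose subspace topology carries a smooth atlas for which the
inclusion is a smooth embedding. -/

section Submanifolds

variable {EP : Type*} [NormedAddCommGroup EP] [NormedSpace ℝ EP] {P : Set M} [ChartedSpace EP P]

/-- Differential `T_pP → T_pM` of the inclusion of `P` into `M`. -/
def inclDeriv (EP : Type*) [NormedAddCommGroup EP] [NormedSpace ℝ EP] {P : Set M}
    [ChartedSpace EP P] (p : P) : TangentSpace 𝓘(ℝ, EP) p →L[ℝ] E :=
  mfderiv 𝓘(ℝ, EP) 𝓘(ℝ, E) (Subtype.val : P → M) p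

/-- `T_pP` as a subspace of `T_pM`. -/
def tangentSub (EP : Type*) [NormedAddCommGroup EP] [NormedSpace ℝ EP] {P : Set M}
    [ChartedSpace EP P] (p : P) : Submodule ℝ E :=
  LinearMap.range (inclDeriv (E := E) EP p).toLinearMap

open Classical in
/-- The component `ν` of `v` in the decomposition of the ambient space into `T` and its
`B`-orthogonal subspace (which is a direct sum decomposition when `B` is symmetric and its
restriction to `T` is nondegenerate). -/
def normalPart (B : E →L[ℝ] E →L[ℝ] ℝ) (T : Submodule ℝ E) (v : E) : E :=
  if h : ∃ ν : E, (∀ w ∈ T, B ν w = 0) ∧ v - ν ∈ T then h.choose else 0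

namespace PseudoFinslerMetric

/-- The second fundamental form `S^P_N(U, W) = nor_N ∇^N_U W` at `p ∈ P`, for vector fields `U`, `W`
on `P` and a vector `N` at `p` that is `g_N`-orthogonal to `P`. -/
def secondFund (N : TangentBundle 𝓘(ℝ, E) M) (p : P) (U W : ∀ q : P, TangentSpace 𝓘(ℝ, EP) q) : E :=
  normalPart (Φ.g N) (tangentSub EP p)
    (Φ.covDeriv N (fun q : P => tvec q.1 (inclDeriv EP q (W q))) univ p (U p))

/-- The second fundamental form as a map `T_pP × T_pP → (T_pP)^⊥`, where `T_pP` is regarded as a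
subspace of `T_pM`: the vectors `u`, `w` of `T_pP` are extended to smooth vector fields on a
neighbourhood of `p` in `P` (the result does not depend on the extension). -/
def secondFundAt (EP : Type*) [NormedAddCommGroup EP] [NormedSpace ℝ EP] {P : Set M}
    [ChartedSpace EP P] [IsManifold 𝓘(ℝ, EP) ∞ P]
    (N : TangentBundle 𝓘(ℝ, E) M) (p : P) (u w : E) : E :=
  Φ.secondFund N p
    (FiberBundle.extend EP (Function.invFun (inclDeriv EP p) u))
    (FiberBundle.extend EP (Function.invFun (inclDeriv EP p) w))

/-- `N` is `g_N`-orthogonal to `P` at `p`. -/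
def IsOrthogonalTo (EP : Type*) [NormedAddCommGroup EP] [NormedSpace ℝ EP] {P : Set M}
    [ChartedSpace EP P] (N : TangentBundle 𝓘(ℝ, E) M) (p : P) : Prop :=
  ∀ w ∈ tangentSub (E := E) EP p, Φ.g N (vec N) w = 0

/-- The restriction of `g_N` to `T_pP` is nondegenerate. -/
def NondegenerateOn (EP : Type*) [NormedAddCommGroup EP] [NormedSpace ℝ EP] {P : Set M}
    [ChartedSpace EP P] (N : TangentBundle 𝓘(ℝ, E) M) (p : P) : Prop :=
  ∀ u ∈ tangentSub (E := E) EP p, (∀ w ∈ tangentSub (E := E) EP p, Φ.g N u w = 0) → u = 0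

end PseudoFinslerMetric

end Submanifolds

/-! ### The endmanifold problem -/

namespace PseudoFinslerMetric

/-- `Λ` is a smooth `L`-admissible variation of `γ` by curves from `P` to `Q`. -/
structure IsPQVariation (P Q : Set M) (a b : ℝ) (γ : ℝ → M) (ε : ℝ) (Λ : ℝ → ℝ → M) : Prop
    extends Φ.IsVariation a b γ ε Λ where
  left_mem : ∀ s ∈ Ioo (-ε) ε, Λ a s ∈ P
  right_mem : ∀ s ∈ Ioo (-ε) ε, Λ b s ∈ Q

/-- The integrand `-g_γ̇(R^γ(γ̇, W)W, γ̇) + g_γ̇(W', W')`, where `W' = D^γ̇_γ W`. -/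
def secondVariationIntegrand (a b : ℝ) (γ : ℝ → M) (W : ℝ → TangentBundle 𝓘(ℝ, E) M) (t : ℝ) : ℝ :=
  Φ.g (velocity (Icc a b) γ t) (vec (Φ.D (Icc a b) (velocity (Icc a b) γ) W t))
      (vec (Φ.D (Icc a b) (velocity (Icc a b) γ) W t))
    - Φ.g (velocity (Icc a b) γ t) (Φ.jacobiOp a b γ W W t)
      (vec (velocity (E := E) (Icc a b) γ t))

end PseudoFinslerMetric

end Manifolds

end PseudoFinsler

end

/-! The proof is a pointwise identity for the Lagrangian in a fixed chart, integrated over $[a,b]$.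
Write $x(t,s)$ for a variation in coordinates, use $x_t$ as reference vector, and let $D_t$, $D_s$
be the resulting covariant derivatives.

By homogeneity $L(x_t)=g(x_t,x_t)$, and the Cartan tensor vanishes as soon as one entry is the
reference vector (`IsLocalMetric.gLoc_self`, `IsLocalMetric.cartanLoc_self_left`). The Cartan
correction in the product rule therefore disappears whenever $x_t$ is paired with something.
Together with torsion-freeness, $D_sx_t=D_tx_s$, this gives $\frac12\partial_sL=g(D_tx_s,x_t)$.
Differentiating once more and exchanging $D_sD_t=D_tD_s-R$,
$\frac12\partial_s^2L=g(D_tx_s,D_tx_s)-g(R\,x_s,x_t)+g(D_tD_sx_s,x_t)$. On the geodesic $D_tx_t=0$,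
so the last term is the exact derivative $\partial_t\,g(D_sx_s,x_t)$. This is
`IsLocalMetric.second_variation_lagrangian`. Differentiation under the integral sign and the
fundamental theorem of calculus leave the boundary values of $g(D_sx_s,\dot\gamma)$, called
`transverse`.

At an endpoint the transverse curve lies in the submanifold, so $D_sx_s$ equals $\nabla_WW$ up to a
vector tangent to it (`exists_vec_D_velocity_eq`). Since $\dot\gamma$ is orthogonal to the
submanifold, neither this tangent vector nor the normal projection affects the pairing with
$\dot\gamma$, and the boundary value is the second fundamental form term (`IsVariation.endpoint`).

What remains is independence of charts. The covariant derivative uses the preferred chart at the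
moving base point, while the computation needs one chart near a given parameter. The Chern symbols
are the unique symmetric, almost compatible ones (`IsLocalMetric.chernCLM_unique`); pulling them
back through a coordinate change and invoking uniqueness yields their transformation law
(`IsLocalMetric.chernCLM_transform`), hence `tchart_D`. The curvature in a chart involves only
$\dot\gamma$, $W$, $Z$ along $\gamma$ and first derivatives of $\dot\gamma$ and $W$
(`IsJacobiExtension.curvatureAlong_eq`), so the Jacobi operator does not depend on the chosen
extension. -/

noncomputable section

namespace PseudoFinsler

/-! ### Coordinate metrics: homogeneity, symmetry and nondegeneracy. -/

section LocalMetric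

set_option synthInstance.maxHeartbeats 200000

variable {E : Type*} [NormedAddCommGroup E] [NormedSpace ℝ E]
  {V : Type*} [NormedAddCommGroup V] [NormedSpace ℝ V]

/-! Shortcut instances: instance search for iterated spaces of linear maps is slow. -/

instance normedAddCommGroupCLM₁ : NormedAddCommGroup (E →L[ℝ] V) :=
  ContinuousLinearMap.toNormedAddCommGroup
instance normedSpaceCLM₁ : NormedSpace ℝ (E →L[ℝ] V) := ContinuousLinearMap.toNormedSpace
instance normedAddCommGroupCLM₂ : NormedAddCommGroup (E →L[ℝ] E →L[ℝ] V) :=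
  ContinuousLinearMap.toNormedAddCommGroup
instance normedSpaceCLM₂ : NormedSpace ℝ (E →L[ℝ] E →L[ℝ] V) := ContinuousLinearMap.toNormedSpace
instance normedAddCommGroupCLM₃ : NormedAddCommGroup (E →L[ℝ] E →L[ℝ] E →L[ℝ] V) :=
  ContinuousLinearMap.toNormedAddCommGroup
instance normedSpaceCLM₃ : NormedSpace ℝ (E →L[ℝ] E →L[ℝ] E →L[ℝ] V) :=
  ContinuousLinearMap.toNormedSpace

instance isTopologicalAddGroupCLM₁ : IsTopologicalAddGroup (E →L[ℝ] V) :=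
  ContinuousLinearMap.topologicalAddGroup
instance continuousAddCLM₁ : ContinuousAdd (E →L[ℝ] V) := IsTopologicalAddGroup.toContinuousAdd
instance continuousSMulCLM₁ : ContinuousSMul ℝ (E →L[ℝ] V) := IsBoundedSMul.continuousSMul
instance continuousConstSMulCLM₁ : ContinuousConstSMul ℝ (E →L[ℝ] V) :=
  ContinuousSMul.continuousConstSMul
instance addCommMonoidCLM₁ : AddCommMonoid (E →L[ℝ] V) := ContinuousLinearMap.addCommMonoid
instance addMonoidCLM₁ : AddMonoid (E →L[ℝ] V) := AddCommMonoid.toAddMonoid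
instance addZeroClassCLM₁ : AddZeroClass (E →L[ℝ] V) := AddMonoid.toAddZeroClass
instance moduleCLM₁ : Module ℝ (E →L[ℝ] V) := ContinuousLinearMap.module
instance mulActionCLM₁ : MulAction ℝ (E →L[ℝ] V) := DistribMulAction.toMulAction
instance topologicalSpaceCLM₁ : TopologicalSpace (E →L[ℝ] V) := ContinuousLinearMap.topologicalSpace
instance addCommGroupCLM₁ : AddCommGroup (E →L[ℝ] V) := ContinuousLinearMap.addCommGroup
instance isTopologicalAddGroupCLM₂ : IsTopologicalAddGroup (E →L[ℝ] E →L[ℝ] V) :=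
  ContinuousLinearMap.topologicalAddGroup
instance continuousAddCLM₂ : ContinuousAdd (E →L[ℝ] E →L[ℝ] V) :=
  IsTopologicalAddGroup.toContinuousAdd
instance continuousSMulCLM₂ : ContinuousSMul ℝ (E →L[ℝ] E →L[ℝ] V) := IsBoundedSMul.continuousSMul
instance continuousConstSMulCLM₂ : ContinuousConstSMul ℝ (E →L[ℝ] E →L[ℝ] V) :=
  ContinuousSMul.continuousConstSMul
instance addCommMonoidCLM₂ : AddCommMonoid (E →L[ℝ] E →L[ℝ] V) := ContinuousLinearMap.addCommMonoid
instance addMonoidCLM₂ : AddMonoid (E →L[ℝ] E →L[ℝ] V) := AddCommMonoid.toAddMonoid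
instance addZeroClassCLM₂ : AddZeroClass (E →L[ℝ] E →L[ℝ] V) := AddMonoid.toAddZeroClass
instance moduleCLM₂ : Module ℝ (E →L[ℝ] E →L[ℝ] V) := ContinuousLinearMap.module
instance topologicalSpaceCLM₂ : TopologicalSpace (E →L[ℝ] E →L[ℝ] V) :=
  ContinuousLinearMap.topologicalSpace
instance addCommGroupCLM₂ : AddCommGroup (E →L[ℝ] E →L[ℝ] V) := ContinuousLinearMap.addCommGroup
instance continuousSMulCLM₃ : ContinuousSMul ℝ (E →L[ℝ] E →L[ℝ] E →L[ℝ] V) :=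
  IsBoundedSMul.continuousSMul
instance continuousConstSMulCLM₃ : ContinuousConstSMul ℝ (E →L[ℝ] E →L[ℝ] E →L[ℝ] V) :=
  ContinuousSMul.continuousConstSMul
instance addCommMonoidCLM₃ : AddCommMonoid (E →L[ℝ] E →L[ℝ] E →L[ℝ] V) :=
  ContinuousLinearMap.addCommMonoid
instance addMonoidCLM₃ : AddMonoid (E →L[ℝ] E →L[ℝ] E →L[ℝ] V) := AddCommMonoid.toAddMonoid
instance mulActionCLM₃ : MulAction ℝ (E →L[ℝ] E →L[ℝ] E →L[ℝ] V) := DistribMulAction.toMulAction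

theorem minSmoothness_two_le_infty : minSmoothness ℝ 2 ≤ (∞ : ℕ∞ω) := by
  rw [minSmoothness_of_isRCLikeNormedField]
  exact WithTop.coe_le_coe.2 le_top

/-- Derivative in the vertical (second) variable. -/
def vfderiv (G : E × E → V) (z : E × E) : E →L[ℝ] V := fderiv ℝ (fun y => G (z.1, y)) z.2

/-- Derivative in the horizontal (first) variable. -/
def hfderiv (G : E × E → V) (z : E × E) : E →L[ℝ] V := fderiv ℝ (fun x => G (x, z.2)) z.1

theorem hasFDerivAt_vertical {G : E × E → V} {z : E × E} (h : DifferentiableAt ℝ G z) :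
    HasFDerivAt (fun y => G (z.1, y)) (fderiv ℝ G z ∘L ContinuousLinearMap.inr ℝ E E) z.2 :=
  HasFDerivAt.comp (g := G) z.2 h.hasFDerivAt (hasFDerivAt_prodMk_right z.1 z.2)

theorem hasFDerivAt_horizontal {G : E × E → V} {z : E × E} (h : DifferentiableAt ℝ G z) :
    HasFDerivAt (fun x => G (x, z.2)) (fderiv ℝ G z ∘L ContinuousLinearMap.inl ℝ E E) z.1 :=
  HasFDerivAt.comp (g := G) z.1 h.hasFDerivAt (hasFDerivAt_prodMk_left z.1 z.2)

theorem vfderiv_eq {G : E × E → V} {z : E × E} (h : DifferentiableAt ℝ G z) :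
    vfderiv G z = fderiv ℝ G z ∘L ContinuousLinearMap.inr ℝ E E :=
  (hasFDerivAt_vertical h).fderiv

theorem vfderiv_const_smul {G : E × E → V} {z : E × E} (h : DifferentiableAt ℝ G z) (c : ℝ) :
    vfderiv (fun z => c • G z) z = c • vfderiv G z := by
  have := (hasFDerivAt_vertical h).const_smul c
  rw [vfderiv_eq h]
  exact this.fderiv

theorem hfderiv_eq {G : E × E → V} {z : E × E} (h : DifferentiableAt ℝ G z) :
    hfderiv G z = fderiv ℝ G z ∘L ContinuousLinearMap.inl ℝ E E :=
  (hasFDerivAt_horizontal h).fderiv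

theorem fderiv_eq_hfderiv_add_vfderiv {G : E × E → V} {z : E × E} (h : DifferentiableAt ℝ G z)
    (v : E × E) : fderiv ℝ G z v = hfderiv G z v.1 + vfderiv G z v.2 := by
  rw [hfderiv_eq h, vfderiv_eq h]
  simp [← map_add]

theorem contDiffOn_vfderiv {G : E × E → V} {U : Set (E × E)} (hG : ContDiffOn ℝ ∞ G U)
    (hU : IsOpen U) : ContDiffOn ℝ ∞ (vfderiv G) U := by
  have h1 : ContDiffOn ℝ ∞ (fun z => fderiv ℝ G z ∘L ContinuousLinearMap.inr ℝ E E) U :=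
    (hG.fderiv_of_isOpen hU (m := ∞) (by simp)).clm_comp contDiffOn_const
  exact h1.congr fun z hz =>
    vfderiv_eq ((hG.contDiffAt (hU.mem_nhds hz)).differentiableAt (by simp))

theorem contDiffOn_hfderiv {G : E × E → V} {U : Set (E × E)} (hG : ContDiffOn ℝ ∞ G U)
    (hU : IsOpen U) : ContDiffOn ℝ ∞ (hfderiv G) U := by
  have h1 : ContDiffOn ℝ ∞ (fun z => fderiv ℝ G z ∘L ContinuousLinearMap.inl ℝ E E) U :=
    (hG.fderiv_of_isOpen hU (m := ∞) (by simp)).clm_comp contDiffOn_const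
  exact h1.congr fun z hz =>
    hfderiv_eq ((hG.contDiffAt (hU.mem_nhds hz)).differentiableAt (by simp))

/-- Positive homogeneity of degree `k` in the vertical variable. -/
def IsVHomogeneous (G : E × E → V) (U : Set (E × E)) (k : ℕ) : Prop :=
  ∀ z ∈ U, ∀ c : ℝ, 0 < c → G (z.1, c • z.2) = c ^ k • G z

/-- Euler's relation: differentiate $G(x,cy)=c^kG(x,y)$ in $c$ at $c=1$. -/
theorem IsVHomogeneous.vfderiv_apply_self {G : E × E → V} {U : Set (E × E)} {k : ℕ}
    (hG : IsVHomogeneous G U k) {z : E × E} (hz : z ∈ U) (hd : DifferentiableAt ℝ G z) :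
    vfderiv G z z.2 = (k : ℝ) • G z := by
  have h1 : HasDerivAt (fun c : ℝ => G (z.1, c • z.2)) (vfderiv G z z.2) 1 := by
    have h2 : HasDerivAt (fun c : ℝ => c • z.2) ((1 : ℝ) • z.2) 1 :=
      (hasDerivAt_id (1 : ℝ)).smul_const z.2
    have h3 := hasFDerivAt_vertical hd
    rw [← vfderiv_eq hd] at h3
    have h4 : HasFDerivAt (fun y => G (z.1, y)) (vfderiv G z) ((1 : ℝ) • z.2) := by simpa using h3
    simpa [Function.comp_def] using h4.comp_hasDerivAt (1 : ℝ) h2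
  have h2 : HasDerivAt (fun c : ℝ => c ^ k • G z) ((k : ℝ) • G z) 1 := by
    simpa using (hasDerivAt_pow k (1 : ℝ)).smul_const (G z)
  refine h1.unique (h2.congr_of_eventuallyEq ?_)
  filter_upwards [lt_mem_nhds (zero_lt_one (α := ℝ))] with c hc
  exact hG z hz c hc

/-- Differentiating $G(x,cy)=c^{k+1}G(x,y)$ in $y$ produces a factor $c$ on the left from the chain
rule; cancelling it lowers the degree by one. -/
theorem IsVHomogeneous.vertical {G : E × E → V} {U : Set (E × E)} {k : ℕ}
    (hG : IsVHomogeneous G U (k + 1)) (hU : IsOpen U)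
    (hcone : ∀ z ∈ U, ∀ c : ℝ, 0 < c → (z.1, c • z.2) ∈ U) (hd : DifferentiableOn ℝ G U) :
    IsVHomogeneous (vfderiv G) U k := by
  intro z hz c hc
  have hd' : ∀ z ∈ U, HasFDerivAt (fun y => G (z.1, y)) (vfderiv G z) z.2 := fun z hz => by
    have := hd.differentiableAt (hU.mem_nhds hz)
    rw [vfderiv_eq this]
    exact hasFDerivAt_vertical this
  have h1 : HasFDerivAt (fun y : E => G (z.1, c • y)) (c • vfderiv G (z.1, c • z.2))
      z.2 := by
    have h3 : HasFDerivAt (fun y : E => c • y) (c • ContinuousLinearMap.id ℝ E) z.2 :=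
      (hasFDerivAt_id z.2).const_smul c
    have h4 := HasFDerivAt.comp (g := fun y => G (z.1, y)) z.2 (hd' _ (hcone z hz c hc)) h3
    convert! h4 using 1
    ext u
    simp
  have h2 : HasFDerivAt (fun y : E => c ^ (k + 1) • G (z.1, y))
      (c ^ (k + 1) • vfderiv G z) z.2 := (hd' z hz).const_smul _
  have h5 : (fun y : E => G (z.1, c • y)) =ᶠ[𝓝 z.2] fun y : E => c ^ (k + 1) • G (z.1, y) := by
    have : ∀ᶠ y in 𝓝 z.2, (z.1, y) ∈ U :=
      (Continuous.prodMk_right z.1).continuousAt.eventually (hU.mem_nhds hz)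
    filter_upwards [this] with y hy
    exact hG _ hy c hc
  have h6 := h1.unique (h2.congr_of_eventuallyEq h5)
  rw [pow_succ', mul_smul] at h6
  exact smul_right_injective _ hc.ne' h6

theorem fderiv_apply_symm {H : Type*} [NormedAddCommGroup H] [NormedSpace ℝ H]
    {B : H → E →L[ℝ] E →L[ℝ] V} {h : H} (hB : DifferentiableAt ℝ B h)
    (hs : ∀ᶠ h' in 𝓝 h, ∀ u w, B h' u w = B h' w u) (v : H) (u w : E) :
    fderiv ℝ B h v u w = fderiv ℝ B h v w u := by
  have h1 : ∀ u w : E, HasFDerivAt (fun h' => B h' u w) _ h := fun u w =>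
    (hB.hasFDerivAt.clm_apply (hasFDerivAt_const u h)).clm_apply (hasFDerivAt_const w h)
  have h2 := (h1 u w).unique ((h1 w u).congr_of_eventuallyEq (hs.mono fun h' h => h u w))
  simpa using DFunLike.congr_fun h2 v

/-- `F` is the coordinate expression of a conic pseudo-Finsler metric with domain `U`. -/
structure IsLocalMetric (F : E × E → ℝ) (U : Set (E × E)) : Prop where
  isOpen : IsOpen U
  smooth : ContDiffOn ℝ ∞ F U
  smul_mem : ∀ z ∈ U, ∀ c : ℝ, 0 < c → (z.1, c • z.2) ∈ U
  homogeneous : ∀ z ∈ U, ∀ c : ℝ, 0 < c → F (z.1, c • z.2) = c ^ 2 * F z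
  nondegenerate : ∀ z ∈ U, ∀ u, (∀ w, gLoc F z.1 z.2 u w = 0) → u = 0

theorem gLoc_eq (F : E × E → ℝ) (z : E × E) :
    gLoc F z.1 z.2 = (1 / 2 : ℝ) • vfderiv (vfderiv F) z := rfl

theorem cartanLoc_eq (F : E × E → ℝ) (z : E × E) :
    cartanLoc F z.1 z.2 = (1 / 4 : ℝ) • vfderiv (vfderiv (vfderiv F)) z := rfl

theorem dgLoc_eq (F : E × E → ℝ) (z : E × E) :
    dgLoc F z.1 z.2 = hfderiv (fun z => gLoc F z.1 z.2) z := rfl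

namespace IsLocalMetric

variable {F : E × E → ℝ} {U : Set (E × E)} (hF : IsLocalMetric F U)
include hF

theorem contDiffOn_gLoc : ContDiffOn ℝ ∞ (fun z => gLoc F z.1 z.2) U :=
  have h := contDiffOn_vfderiv (contDiffOn_vfderiv hF.smooth hF.isOpen) hF.isOpen
  ContDiffOn.congr (f := fun z => (1 / 2 : ℝ) • vfderiv (vfderiv F) z)
    ((contDiff_const_smul _).comp_contDiffOn h) fun z _ => gLoc_eq F z

theorem contDiffOn_cartanLoc : ContDiffOn ℝ ∞ (fun z => cartanLoc F z.1 z.2) U :=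
  have h := contDiffOn_vfderiv (contDiffOn_vfderiv (contDiffOn_vfderiv hF.smooth hF.isOpen)
    hF.isOpen) hF.isOpen
  ContDiffOn.congr (f := fun z => (1 / 4 : ℝ) • vfderiv (vfderiv (vfderiv F)) z)
    ((contDiff_const_smul _).comp_contDiffOn h) fun z _ => cartanLoc_eq F z

theorem contDiffOn_dgLoc : ContDiffOn ℝ ∞ (fun z => dgLoc F z.1 z.2) U :=
  contDiffOn_hfderiv hF.contDiffOn_gLoc hF.isOpen

theorem differentiableAt {z : E × E} (hz : z ∈ U) {G : E × E → V} (hG : ContDiffOn ℝ ∞ G U) :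
    DifferentiableAt ℝ G z :=
  (hG.contDiffAt (hF.isOpen.mem_nhds hz)).differentiableAt (by simp)

theorem differentiableAt_gLoc {z : E × E} (hz : z ∈ U) :
    DifferentiableAt ℝ (fun z => gLoc F z.1 z.2) z :=
  (hF.contDiffOn_gLoc.contDiffAt (hF.isOpen.mem_nhds hz)).differentiableAt (by simp)

theorem vfderiv_gLoc {z : E × E} (hz : z ∈ U) :
    vfderiv (fun z => gLoc F z.1 z.2) z = (2 : ℝ) • cartanLoc F z.1 z.2 := by
  have h := contDiffOn_vfderiv (contDiffOn_vfderiv hF.smooth hF.isOpen) hF.isOpen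
  have h1 : (fun z => gLoc F z.1 z.2) = fun z => (1 / 2 : ℝ) • vfderiv (vfderiv F) z := rfl
  -- The normalisations $\frac12$ of $g$ and $\frac14$ of $C$ account for the factor $2$ in the
  -- product rule.
  rw [h1, vfderiv_const_smul (hF.differentiableAt hz h), cartanLoc_eq, smul_smul,
    show (2 : ℝ) * (1 / 4) = 1 / 2 by norm_num]

theorem fderiv_gLoc {z : E × E} (hz : z ∈ U) (v : E × E) :
    fderiv ℝ (fun z => gLoc F z.1 z.2) z v
      = dgLoc F z.1 z.2 v.1 + (2 : ℝ) • cartanLoc F z.1 z.2 v.2 := by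
  rw [fderiv_eq_hfderiv_add_vfderiv (hF.differentiableAt_gLoc hz), hF.vfderiv_gLoc hz, dgLoc_eq]
  rfl

theorem contDiffAt_vertical {z : E × E} (hz : z ∈ U) {G : E × E → V} (hG : ContDiffOn ℝ ∞ G U) :
    ContDiffAt ℝ ∞ (fun y => G (z.1, y)) z.2 :=
  ContDiffAt.comp z.2 (g := G) (hG.contDiffAt (hF.isOpen.mem_nhds hz)) (by fun_prop)

theorem gLoc_symm {z : E × E} (hz : z ∈ U) (u w : E) :
    gLoc F z.1 z.2 u w = gLoc F z.1 z.2 w u := by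
  have h : IsSymmSndFDerivAt ℝ (fun y => F (z.1, y)) z.2 :=
    (hF.contDiffAt_vertical hz hF.smooth).isSymmSndFDerivAt minSmoothness_two_le_infty
  have := h u w
  simp [gLoc, this]

theorem cartanLoc_symm_left {z : E × E} (hz : z ∈ U) (u v w : E) :
    cartanLoc F z.1 z.2 u v w = cartanLoc F z.1 z.2 v u w := by
  have h : IsSymmSndFDerivAt ℝ (fun y => vfderiv F (z.1, y)) z.2 :=
    (hF.contDiffAt_vertical hz (contDiffOn_vfderiv hF.smooth hF.isOpen)).isSymmSndFDerivAt
      minSmoothness_two_le_infty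
  have := DFunLike.congr_fun (h u v) w
  simp only [cartanLoc_eq, _root_.smul_apply]
  exact congrArg _ this

theorem fderiv_gLoc_symm {z : E × E} (hz : z ∈ U) (v : E × E) (u w : E) :
    fderiv ℝ (fun z => gLoc F z.1 z.2) z v u w = fderiv ℝ (fun z => gLoc F z.1 z.2) z v w u :=
  fderiv_apply_symm (hF.differentiableAt_gLoc hz)
    ((hF.isOpen.eventually_mem hz).mono fun _ h => hF.gLoc_symm h) v u w

/-- Obtained by differentiating the symmetry of $g$ in a vertical direction. With the exchange of
the first two entries (symmetry of second derivatives) it generates full symmetry of $C$. -/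
theorem cartanLoc_symm_right {z : E × E} (hz : z ∈ U) (u v w : E) :
    cartanLoc F z.1 z.2 u v w = cartanLoc F z.1 z.2 u w v := by
  have := hF.fderiv_gLoc_symm hz (0, u) v w
  simpa [hF.fderiv_gLoc hz] using this

theorem dgLoc_symm {z : E × E} (hz : z ∈ U) (X u w : E) :
    dgLoc F z.1 z.2 X u w = dgLoc F z.1 z.2 X w u := by
  have := hF.fderiv_gLoc_symm hz (X, 0) u w
  simpa [hF.fderiv_gLoc hz] using this

theorem isVHomogeneous : IsVHomogeneous F U 2 := fun z hz c hc => hF.homogeneous z hz c hc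

theorem isVHomogeneous_vfderiv : IsVHomogeneous (vfderiv F) U 1 :=
  hF.isVHomogeneous.vertical hF.isOpen hF.smul_mem (hF.smooth.differentiableOn (by simp))

/-- Euler's relation for $F$ (degree 2) and for its vertical derivative (degree 1); the factors
$\frac12\cdot1\cdot2$ cancel. -/
theorem gLoc_self {z : E × E} (hz : z ∈ U) : gLoc F z.1 z.2 z.2 z.2 = F z := by
  have h1 := hF.isVHomogeneous.vfderiv_apply_self hz (hF.differentiableAt hz hF.smooth)
  have h2 :=
    hF.isVHomogeneous_vfderiv.vfderiv_apply_self hz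
      (hF.differentiableAt hz (contDiffOn_vfderiv hF.smooth hF.isOpen))
  rw [gLoc_eq, _root_.smul_apply, h2, _root_.smul_apply,
    _root_.smul_apply, h1]
  simp

/-- The vertical Hessian is homogeneous of degree 0, so Euler's relation gives zero. Every later
disappearance of a Cartan term containing the reference vector rests on this. -/
theorem cartanLoc_self_left {z : E × E} (hz : z ∈ U) : cartanLoc F z.1 z.2 z.2 = 0 := by
  have h0 := contDiffOn_vfderiv hF.smooth hF.isOpen
  have h1 : IsVHomogeneous (vfderiv (vfderiv F)) U 0 :=
    hF.isVHomogeneous_vfderiv.vertical hF.isOpen hF.smul_mem (h0.differentiableOn (by simp))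
  have h2 := h1.vfderiv_apply_self hz
    (((contDiffOn_vfderiv h0 hF.isOpen).contDiffAt (hF.isOpen.mem_nhds hz)).differentiableAt
      (by simp))
  rw [cartanLoc_eq, _root_.smul_apply, h2]
  simp

theorem cartanLoc_self_middle {z : E × E} (hz : z ∈ U) (u w : E) :
    cartanLoc F z.1 z.2 u z.2 w = 0 := by
  rw [hF.cartanLoc_symm_left hz, hF.cartanLoc_self_left hz]
  simp

theorem cartanLoc_self_right {z : E × E} (hz : z ∈ U) (u w : E) :
    cartanLoc F z.1 z.2 u w z.2 = 0 := by
  rw [hF.cartanLoc_symm_right hz, hF.cartanLoc_self_middle hz]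

variable [FiniteDimensional ℝ E]

/-- Finite dimension enters here: nondegeneracy is only injectivity of $E\to E^*$, and equality of
dimensions makes it an isomorphism, so that `ContinuousLinearMap.inverse` in `sharpLoc` is not its
default value $0$. -/
theorem exists_equiv {z : E × E} (hz : z ∈ U) :
    ∃ e : E ≃L[ℝ] (E →L[ℝ] ℝ), (e : E →L[ℝ] E →L[ℝ] ℝ) = gLoc F z.1 z.2 := by
  have hinj : Function.Injective (gLoc F z.1 z.2) := by
    rw [injective_iff_map_eq_zero]
    intro u hu
    exact hF.nondegenerate z hz u fun w => by rw [hu]; rfl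
  have hdim : Module.finrank ℝ E = Module.finrank ℝ (E →L[ℝ] ℝ) := by
    rw [← LinearEquiv.finrank_eq (LinearMap.toContinuousLinearMap (𝕜 := ℝ) (E := E) (F' := ℝ))]
    exact (Subspace.dual_finrank_eq).symm
  refine ⟨(LinearEquiv.ofInjectiveOfFinrankEq (gLoc F z.1 z.2).toLinearMap hinj
    hdim).toContinuousLinearEquiv, ?_⟩
  ext u w
  rfl

theorem gLoc_sharpLoc {z : E × E} (hz : z ∈ U) (η : E →L[ℝ] ℝ) :
    gLoc F z.1 z.2 (sharpLoc F z.1 z.2 η) = η := by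
  obtain ⟨e, he⟩ := hF.exists_equiv hz
  rw [sharpLoc, ← he, ContinuousLinearMap.inverse_equiv]
  simp

theorem contDiffOn_sharpLoc : ContDiffOn ℝ ∞ (fun z => sharpLoc F z.1 z.2) U := by
  intro z hz
  obtain ⟨e, he⟩ := hF.exists_equiv hz
  have h := contDiffAt_map_inverse (n := ∞) e
  rw [he] at h
  exact (ContDiffAt.comp z (g := ContinuousLinearMap.inverse) h
    (hF.contDiffOn_gLoc.contDiffAt (hF.isOpen.mem_nhds hz))).contDiffWithinAt

omit [FiniteDimensional ℝ E] in
theorem eq_of_gLoc_eq {z : E × E} (hz : z ∈ U) {u v : E}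
    (h : ∀ w, gLoc F z.1 z.2 u w = gLoc F z.1 z.2 v w) : u = v := by
  rw [← sub_eq_zero]
  exact hF.nondegenerate z hz _ fun w => by simp [h]

end IsLocalMetric
end LocalMetric

/-! ### Chern symbols: Koszul formula, characterisation and smoothness. -/

section ChernSymbols

set_option synthInstance.maxHeartbeats 200000

variable {E : Type*} [NormedAddCommGroup E] [NormedSpace ℝ E]

/-- The Christoffel symbols as a bilinear map. -/
def chernCLM (F : E × E → ℝ) (z : E × E) : E →L[ℝ] E →L[ℝ] E :=
  (ContinuousLinearMap.compL ℝ E (E →L[ℝ] ℝ) E (sharpLoc F z.1 z.2)) ∘L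
    ((1 / 2 : ℝ) • (dgLoc F z.1 z.2 + (dgLoc F z.1 z.2).flip
        - (ContinuousLinearMap.flipₗᵢ ℝ E E ℝ).toContinuousLinearEquiv.toContinuousLinearMap ∘L
            (dgLoc F z.1 z.2).flip)
      - cartanLoc F z.1 z.2 ∘L nonlinearLoc F z.1 z.2
      - (cartanLoc F z.1 z.2 ∘L nonlinearLoc F z.1 z.2).flip
      + (ContinuousLinearMap.compL ℝ E (E →L[ℝ] ℝ) (E →L[ℝ] ℝ)
          ((ContinuousLinearMap.compL ℝ E E ℝ).flip (nonlinearLoc F z.1 z.2))) ∘L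
        cartanLoc F z.1 z.2)

theorem chernCLM_apply (F : E × E → ℝ) (z : E × E) (X Y : E) :
    chernCLM F z X Y = chernLoc F z.1 z.2 X Y := rfl

theorem formalChristoffel_apply (F : E × E → ℝ) (z : E × E) (X Y Z : E) :
    formalChristoffel F z.1 z.2 X Y Z = (1 / 2 : ℝ) * (dgLoc F z.1 z.2 X Y Z
      + dgLoc F z.1 z.2 Y X Z - dgLoc F z.1 z.2 Z X Y) := rfl

namespace IsLocalMetric

variable {F : E × E → ℝ} {U : Set (E × E)} (hF : IsLocalMetric F U) [FiniteDimensional ℝ E]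
include hF

theorem gLoc_sprayLoc {z : E × E} (hz : z ∈ U) (Z : E) :
    gLoc F z.1 z.2 (sprayLoc F z.1 z.2) Z = formalChristoffel F z.1 z.2 z.2 z.2 Z := by
  rw [sprayLoc, hF.gLoc_sharpLoc hz]

theorem gLoc_nonlinearLoc {z : E × E} (hz : z ∈ U) (X Z : E) :
    gLoc F z.1 z.2 (nonlinearLoc F z.1 z.2 X) Z = formalChristoffel F z.1 z.2 X z.2 Z
      - cartanLoc F z.1 z.2 (sprayLoc F z.1 z.2) X Z := by
  have h : nonlinearLoc F z.1 z.2 X = sharpLoc F z.1 z.2 (formalChristoffel F z.1 z.2 X z.2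
      - cartanLoc F z.1 z.2 (sprayLoc F z.1 z.2) X) := by
    rw [nonlinearLoc, ContinuousLinearMap.comp_apply]
    congr 1
    ext W
    -- The flips in `nonlinearLoc` put $y$ and $X$ of the last term in the opposite order to
    -- `formalChristoffel`; symmetry of $\partial g$ reconciles them.
    show (1 / 2 : ℝ) * (dgLoc F z.1 z.2 X z.2 W + dgLoc F z.1 z.2 z.2 X W
      - dgLoc F z.1 z.2 W z.2 X) - _ = (1 / 2 : ℝ) * (dgLoc F z.1 z.2 X z.2 W
      + dgLoc F z.1 z.2 z.2 X W - dgLoc F z.1 z.2 W X z.2) - _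
    rw [hF.dgLoc_symm hz W]
    rfl
  rw [h, hF.gLoc_sharpLoc hz]
  rfl

theorem gLoc_chernCLM {z : E × E} (hz : z ∈ U) (X Y Z : E) :
    gLoc F z.1 z.2 (chernCLM F z X Y) Z = formalChristoffel F z.1 z.2 X Y Z
      - cartanLoc F z.1 z.2 (nonlinearLoc F z.1 z.2 X) Y Z
      - cartanLoc F z.1 z.2 (nonlinearLoc F z.1 z.2 Y) X Z
      + cartanLoc F z.1 z.2 X Y (nonlinearLoc F z.1 z.2 Z) := by
  rw [chernCLM_apply, chernLoc, hF.gLoc_sharpLoc hz]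
  rfl

theorem nonlinearLoc_self {z : E × E} (hz : z ∈ U) :
    nonlinearLoc F z.1 z.2 z.2 = sprayLoc F z.1 z.2 :=
  hF.eq_of_gLoc_eq hz fun Z => by
    rw [hF.gLoc_nonlinearLoc hz, hF.gLoc_sprayLoc hz, hF.cartanLoc_self_middle hz, sub_zero]

/-- Putting $Y=y$ in the Koszul formula kills two of its Cartan terms and leaves the formula for the
nonlinear connection. The coefficients built in stages are thus consistent with the final symbols.
-/
theorem chernCLM_self {z : E × E} (hz : z ∈ U) (X : E) :
    chernCLM F z X z.2 = nonlinearLoc F z.1 z.2 X :=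
  hF.eq_of_gLoc_eq hz fun Z => by
    rw [hF.gLoc_chernCLM hz, hF.gLoc_nonlinearLoc hz, hF.cartanLoc_self_middle hz,
      hF.cartanLoc_self_middle hz, hF.nonlinearLoc_self hz]
    ring

theorem chernCLM_symm {z : E × E} (hz : z ∈ U) (X Y : E) :
    chernCLM F z X Y = chernCLM F z Y X :=
  hF.eq_of_gLoc_eq hz fun Z => by
    rw [hF.gLoc_chernCLM hz, hF.gLoc_chernCLM hz, formalChristoffel_apply,
      formalChristoffel_apply, hF.dgLoc_symm hz Z X Y, hF.cartanLoc_symm_left hz X Y]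
    ring

/-- Almost compatibility of the Chern connection with the fundamental tensor. -/
theorem dgLoc_eq_chernCLM {z : E × E} (hz : z ∈ U) (X Y Z : E) :
    dgLoc F z.1 z.2 X Y Z = gLoc F z.1 z.2 (chernCLM F z X Y) Z
      + gLoc F z.1 z.2 Y (chernCLM F z X Z)
      + 2 * cartanLoc F z.1 z.2 (chernCLM F z X z.2) Y Z := by
  rw [hF.chernCLM_self hz, hF.gLoc_symm hz Y, hF.gLoc_chernCLM hz, hF.gLoc_chernCLM hz,
    formalChristoffel_apply, formalChristoffel_apply, hF.dgLoc_symm hz X Z Y,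
    hF.cartanLoc_symm_right hz _ Z Y]
  -- In the sum of the Koszul formulas for $(X,Y,Z)$ and $(X,Z,Y)$, full symmetry of $C$ cancels the
  -- terms containing $\Gamma(Y,y)$ and $\Gamma(Z,y)$; only $-2C(\Gamma(X,y),Y,Z)$ survives.
  have h1 : ∀ A B C, cartanLoc F z.1 z.2 A B C = cartanLoc F z.1 z.2 C A B := fun A B C => by
    rw [hF.cartanLoc_symm_right hz A B C, hF.cartanLoc_symm_left hz A C B]
  rw [h1 X Y, h1 X Z, hF.dgLoc_symm hz Z X Y, hF.dgLoc_symm hz Y X Z]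
  ring

/-- The Christoffel symbols are determined by symmetry and almost compatibility. -/
theorem chernCLM_unique {z : E × E} (hz : z ∈ U) {Γ : E → E → E}
    (hs : ∀ X Y, Γ X Y = Γ Y X)
    (hc : ∀ X Y Z, dgLoc F z.1 z.2 X Y Z = gLoc F z.1 z.2 (Γ X Y) Z + gLoc F z.1 z.2 Y (Γ X Z)
      + 2 * cartanLoc F z.1 z.2 (Γ X z.2) Y Z) (X Y : E) :
    chernCLM F z X Y = Γ X Y := by
  have hC : ∀ A B C, cartanLoc F z.1 z.2 A B C = cartanLoc F z.1 z.2 C A B := fun A B C => by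
    rw [hF.cartanLoc_symm_right hz A B C, hF.cartanLoc_symm_left hz A C B]
  -- The usual alternating sum of three permuted compatibility equations. It is still implicit,
  -- since $\Gamma(\cdot,y)$ occurs inside $C$; it is solved in three stages, for $\Gamma(y,y)$,
  -- then $\Gamma(X,y)$, then $\Gamma(X,Y)$, because setting an argument to $y$ removes the Cartan
  -- terms not yet known.
  have koszul : ∀ X Y Z, formalChristoffel F z.1 z.2 X Y Z = gLoc F z.1 z.2 (Γ X Y) Z
      + cartanLoc F z.1 z.2 (Γ X z.2) Y Z + cartanLoc F z.1 z.2 (Γ Y z.2) X Z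
      - cartanLoc F z.1 z.2 (Γ Z z.2) X Y := fun X Y Z => by
    rw [formalChristoffel_apply, hc X Y Z, hc Y X Z, hc Z X Y, hs Y X, hs Z X, hs Z Y,
      hF.gLoc_symm hz Y (Γ X Z), hF.gLoc_symm hz X (Γ Y Z)]
    ring
  have h1 : sprayLoc F z.1 z.2 = Γ z.2 z.2 := hF.eq_of_gLoc_eq hz fun Z => by
    rw [hF.gLoc_sprayLoc hz, koszul, hF.cartanLoc_self_middle hz, hF.cartanLoc_self_middle hz]
    ring
  have h2 : ∀ X, nonlinearLoc F z.1 z.2 X = Γ X z.2 := fun X => hF.eq_of_gLoc_eq hz fun Z => by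
    rw [hF.gLoc_nonlinearLoc hz, koszul, h1, hF.cartanLoc_self_middle hz,
      hF.cartanLoc_self_right hz]
    ring
  refine hF.eq_of_gLoc_eq hz fun Z => ?_
  rw [hF.gLoc_chernCLM hz, koszul, h2, h2, h2, hC X Y]
  ring

theorem contDiffOn_formalChristoffel (X Y : E) :
    ContDiffOn ℝ ∞ (fun z => formalChristoffel F z.1 z.2 X Y) U := by
  rw [contDiffOn_clm_apply]
  intro Z
  simp only [formalChristoffel_apply]
  have h := hF.contDiffOn_dgLoc
  have h' : ∀ A B C : E, ContDiffOn ℝ ∞ (fun z => dgLoc F z.1 z.2 A B C) U := fun A B C =>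
    ((h.clm_apply contDiffOn_const).clm_apply contDiffOn_const).clm_apply contDiffOn_const
  exact contDiffOn_const.mul (((h' X Y Z).add (h' Y X Z)).sub (h' Z X Y))

theorem contDiffOn_sprayLoc : ContDiffOn ℝ ∞ (fun z => sprayLoc F z.1 z.2) U := by
  have h1 : ContDiffOn ℝ ∞ (fun z : E × E => formalChristoffel F z.1 z.2 z.2 z.2) U := by
    rw [contDiffOn_clm_apply]
    intro Z
    simp only [formalChristoffel_apply]
    have h := hF.contDiffOn_dgLoc
    have h' : ∀ {A B C : E × E → E}, ContDiffOn ℝ ∞ A U → ContDiffOn ℝ ∞ B U →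
        ContDiffOn ℝ ∞ C U → ContDiffOn ℝ ∞ (fun z => dgLoc F z.1 z.2 (A z) (B z) (C z)) U :=
      fun hA hB hC => ((h.clm_apply hA).clm_apply hB).clm_apply hC
    have h2 : ContDiffOn ℝ ∞ (fun z : E × E => z.2) U := contDiff_snd.contDiffOn
    have h3 : ContDiffOn ℝ ∞ (fun _ : E × E => Z) U := contDiffOn_const
    exact contDiffOn_const.mul (((h' h2 h2 h3).add (h' h2 h2 h3)).sub (h' h3 h2 h2))
  exact hF.contDiffOn_sharpLoc.clm_apply h1

theorem contDiffOn_nonlinearLoc : ContDiffOn ℝ ∞ (fun z => nonlinearLoc F z.1 z.2) U := by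
  refine hF.contDiffOn_sharpLoc.clm_comp ?_
  have h := hF.contDiffOn_dgLoc
  have h2 : ContDiffOn ℝ ∞ (fun z : E × E => z.2) U := contDiff_snd.contDiffOn
  have h' : ∀ {A B C : E × E → E}, ContDiffOn ℝ ∞ A U → ContDiffOn ℝ ∞ B U →
      ContDiffOn ℝ ∞ C U → ContDiffOn ℝ ∞ (fun z => dgLoc F z.1 z.2 (A z) (B z) (C z)) U :=
    fun hA hB hC => ((h.clm_apply hA).clm_apply hB).clm_apply hC
  rw [contDiffOn_clm_apply]
  intro X
  rw [contDiffOn_clm_apply]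
  intro Z
  have hX : ContDiffOn ℝ ∞ (fun _ : E × E => X) U := contDiffOn_const
  have hZ : ContDiffOn ℝ ∞ (fun _ : E × E => Z) U := contDiffOn_const
  exact (contDiffOn_const.mul (((h' hX h2 hZ).add (h' h2 hX hZ)).sub (h' hZ h2 hX))).sub
    (((hF.contDiffOn_cartanLoc.clm_apply hF.contDiffOn_sprayLoc).clm_apply hX).clm_apply hZ)

theorem contDiffOn_chernCLM : ContDiffOn ℝ ∞ (chernCLM F) U := by
  rw [contDiffOn_clm_apply]
  intro X
  rw [contDiffOn_clm_apply]
  intro Y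
  refine hF.contDiffOn_sharpLoc.clm_apply ?_
  rw [contDiffOn_clm_apply]
  intro Z
  have hc : ∀ {A B C : E × E → E}, ContDiffOn ℝ ∞ A U → ContDiffOn ℝ ∞ B U →
      ContDiffOn ℝ ∞ C U → ContDiffOn ℝ ∞ (fun z => cartanLoc F z.1 z.2 (A z) (B z) (C z)) U :=
    fun hA hB hC => ((hF.contDiffOn_cartanLoc.clm_apply hA).clm_apply hB).clm_apply hC
  have hn : ∀ A : E, ContDiffOn ℝ ∞ (fun z => nonlinearLoc F z.1 z.2 A) U := fun A =>
    hF.contDiffOn_nonlinearLoc.clm_apply contDiffOn_const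
  have hX : ∀ A : E, ContDiffOn ℝ ∞ (fun _ : E × E => A) U := fun A => contDiffOn_const
  exact ((((hF.contDiffOn_formalChristoffel X Y).clm_apply (hX Z)).sub
    (hc (hn X) (hX Y) (hX Z))).sub (hc (hn Y) (hX X) (hX Z))).add (hc (hX X) (hX Y) (hn Z))

end IsLocalMetric
end ChernSymbols

/-! ### Behaviour under a change of coordinates. -/

section CoordinateChange

set_option synthInstance.maxHeartbeats 200000

variable {E : Type*} [NormedAddCommGroup E] [NormedSpace ℝ E]

namespace IsLocalMetric

variable {F : E × E → ℝ} {U : Set (E × E)} (hF : IsLocalMetric F U)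
  {H : Type*} [NormedAddCommGroup H] [NormedSpace ℝ H]
include hF

/-- Stated for an arbitrary parameter space and within a set, so that it serves both for coordinate
changes and for variations over a stripe with boundary. -/
theorem exists_hasFDerivWithinAt_gLoc {T : Set H} {h : H} {x y Y Z : H → E}
    {x' y' Y' Z' : H →L[ℝ] E} (hx : HasFDerivWithinAt x x' T h) (hy : HasFDerivWithinAt y y' T h)
    (hY : HasFDerivWithinAt Y Y' T h) (hZ : HasFDerivWithinAt Z Z' T h) (hU : (x h, y h) ∈ U) :
    ∃ L : H →L[ℝ] ℝ, HasFDerivWithinAt (fun h => gLoc F (x h) (y h) (Y h) (Z h)) L T h ∧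
      ∀ v, L v = dgLoc F (x h) (y h) (x' v) (Y h) (Z h)
        + 2 * cartanLoc F (x h) (y h) (y' v) (Y h) (Z h)
        + gLoc F (x h) (y h) (Y' v) (Z h) + gLoc F (x h) (y h) (Y h) (Z' v) := by
  have h1 : HasFDerivWithinAt (fun h => gLoc F (x h) (y h)) _ T h :=
    HasFDerivAt.comp_hasFDerivWithinAt (g := fun z : E × E => gLoc F z.1 z.2) h
      (hF.differentiableAt_gLoc hU).hasFDerivAt (hx.prodMk hy)
  refine ⟨_, (h1.clm_apply hY).clm_apply hZ, fun v => ?_⟩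
  have h2 := DFunLike.congr_fun (DFunLike.congr_fun (hF.fderiv_gLoc hU (x' v, y' v)) (Y h)) (Z h)
  show gLoc F (x h) (y h) (Y h) (Z' v) + (gLoc F (x h) (y h) (Y' v) (Z h)
    + fderiv ℝ (fun z : E × E => gLoc F z.1 z.2) (x h, y h) (x' v, y' v) (Y h) (Z h)) = _
  rw [h2]
  show _ + (_ + (dgLoc F (x h) (y h) (x' v) (Y h) (Z h)
    + 2 * cartanLoc F (x h) (y h) (y' v) (Y h) (Z h))) = _
  ring

variable {F' : E × E → ℝ} {U' : Set (E × E)} (hF' : IsLocalMetric F' U')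
  {φ : E → E} {O : Set E} (hO : IsOpen O) (hφ : ContDiffOn ℝ ∞ φ O)
  (hU : ∀ z ∈ U, z.1 ∈ O → (φ z.1, fderiv ℝ φ z.1 z.2) ∈ U')
  (hFF' : ∀ z ∈ U, z.1 ∈ O → F z = F' (φ z.1, fderiv ℝ φ z.1 z.2))
include hF' hO hU

omit hF' hO in
theorem vfderiv_transform {G G' : E × E → ℝ}
    (hG : ∀ z ∈ U, z.1 ∈ O → G z = G' (φ z.1, fderiv ℝ φ z.1 z.2))
    (hG' : ∀ z ∈ U', DifferentiableAt ℝ G' z) {z : E × E} (hz : z ∈ U) (hzO : z.1 ∈ O) (u : E) :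
    vfderiv G z u = vfderiv G' (φ z.1, fderiv ℝ φ z.1 z.2) (fderiv ℝ φ z.1 u) := by
  have h1 := hG' _ (hU z hz hzO)
  have h2 : HasFDerivAt (fun y => G' (φ z.1, fderiv ℝ φ z.1 y))
      (vfderiv G' (φ z.1, fderiv ℝ φ z.1 z.2) ∘L fderiv ℝ φ z.1) z.2 := by
    rw [vfderiv_eq h1]
    exact HasFDerivAt.comp (g := fun y => G' (φ z.1, y)) z.2 (hasFDerivAt_vertical h1)
      (fderiv ℝ φ z.1).hasFDerivAt
  have h3 : (fun y => G (z.1, y)) =ᶠ[𝓝 z.2] fun y => G' (φ z.1, fderiv ℝ φ z.1 y) := by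
    have : ∀ᶠ y in 𝓝 z.2, (z.1, y) ∈ U :=
      (Continuous.prodMk_right z.1).continuousAt.eventually (hF.isOpen.mem_nhds hz)
    filter_upwards [this] with y hy
    exact hG (z.1, y) hy hzO
  rw [vfderiv, (h2.congr_of_eventuallyEq h3).fderiv]
  rfl

include hFF'

omit hO in
-- On a fixed fibre the change of coordinates is the linear map $d\varphi$, so two vertical
-- derivatives bring out $d\varphi$ twice and no second derivative of $\varphi$.
theorem gLoc_transform {z : E × E} (hz : z ∈ U) (hzO : z.1 ∈ O) (u w : E) :
    gLoc F z.1 z.2 u w = gLoc F' (φ z.1) (fderiv ℝ φ z.1 z.2) (fderiv ℝ φ z.1 u)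
      (fderiv ℝ φ z.1 w) := by
  have hd : ∀ {F : E × E → ℝ} {U : Set (E × E)}, IsLocalMetric F U → ∀ z ∈ U,
      DifferentiableAt ℝ (vfderiv F) z := fun h z hz =>
    h.differentiableAt hz (contDiffOn_vfderiv h.smooth h.isOpen)
  have hap : ∀ {F : E × E → ℝ} {U : Set (E × E)}, IsLocalMetric F U → ∀ z ∈ U, ∀ u w : E,
      vfderiv (fun z => vfderiv F z w) z u = vfderiv (vfderiv F) z u w := fun h z hz u w => by
    have h1 := hasFDerivAt_vertical (hd h z hz)
    rw [← vfderiv_eq (hd h z hz)] at h1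
    have h2 : HasFDerivAt (fun y => vfderiv _ (z.1, y) w) _ z.2 :=
      h1.clm_apply (hasFDerivAt_const w z.2)
    rw [vfderiv, h2.fderiv]
    simp
  have h1 := fun z hz hzO w => hF.vfderiv_transform hU hFF'
    (fun z hz => hF'.differentiableAt hz hF'.smooth) (z := z) hz hzO w
  rw [gLoc_eq, gLoc_eq F' (φ z.1, fderiv ℝ φ z.1 z.2)]
  show (1 / 2 : ℝ) * vfderiv (vfderiv F) z u w = (1 / 2 : ℝ) * vfderiv (vfderiv F') _ _ _
  rw [← hap hF z hz, ← hap hF' _ (hU z hz hzO)]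
  congr 1
  have h3 : ∀ y : E, (z.1, y) ∈ U → vfderiv F (z.1, y) w
      = vfderiv F' (φ z.1, fderiv ℝ φ z.1 y) (fderiv ℝ φ z.1 w) := fun y hy => h1 (z.1, y) hy hzO w
  have h4 : HasFDerivAt (fun y => vfderiv F' (φ z.1, fderiv ℝ φ z.1 y) (fderiv ℝ φ z.1 w))
      (vfderiv (fun z' => vfderiv F' z' (fderiv ℝ φ z.1 w)) (φ z.1, fderiv ℝ φ z.1 z.2) ∘L
        fderiv ℝ φ z.1) z.2 := by
    have h5 : DifferentiableAt ℝ (fun z' => vfderiv F' z' (fderiv ℝ φ z.1 w))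
        (φ z.1, fderiv ℝ φ z.1 z.2) :=
      (hd hF' _ (hU z hz hzO)).clm_apply (differentiableAt_const _)
    rw [vfderiv_eq h5]
    exact HasFDerivAt.comp (g := fun y => vfderiv F' (φ z.1, y) (fderiv ℝ φ z.1 w)) z.2
      (hasFDerivAt_vertical h5) (fderiv ℝ φ z.1).hasFDerivAt
  have h6 : ∀ᶠ y in 𝓝 z.2, (z.1, y) ∈ U :=
    (Continuous.prodMk_right z.1).continuousAt.eventually (hF.isOpen.mem_nhds hz)
  rw [vfderiv, (h4.congr_of_eventuallyEq (h6.mono h3)).fderiv]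
  rfl

include hφ

/-- The derivative of `gLoc_transform` in the direction $v$. Horizontal motion also moves
$d\varphi$, which contributes the terms with $D^2\varphi$. -/
theorem gLoc_derivative_transform {z : E × E} (hz : z ∈ U) (hzO : z.1 ∈ O) (v : E × E) (u w : E) :
    dgLoc F z.1 z.2 v.1 u w + 2 * cartanLoc F z.1 z.2 v.2 u w
      = dgLoc F' (φ z.1) (fderiv ℝ φ z.1 z.2) (fderiv ℝ φ z.1 v.1) (fderiv ℝ φ z.1 u)
          (fderiv ℝ φ z.1 w)
        + 2 * cartanLoc F' (φ z.1) (fderiv ℝ φ z.1 z.2)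
          (fderiv ℝ φ z.1 v.2 + fderiv ℝ (fderiv ℝ φ) z.1 v.1 z.2) (fderiv ℝ φ z.1 u)
          (fderiv ℝ φ z.1 w)
        + gLoc F' (φ z.1) (fderiv ℝ φ z.1 z.2) (fderiv ℝ (fderiv ℝ φ) z.1 v.1 u) (fderiv ℝ φ z.1 w)
        + gLoc F' (φ z.1) (fderiv ℝ φ z.1 z.2) (fderiv ℝ φ z.1 u)
            (fderiv ℝ (fderiv ℝ φ) z.1 v.1 w) := by
  have hfst : HasFDerivWithinAt (fun z : E × E => z.1) (ContinuousLinearMap.fst ℝ E E) univ z :=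
    hasFDerivAt_fst.hasFDerivWithinAt
  have hsnd : HasFDerivWithinAt (fun z : E × E => z.2) (ContinuousLinearMap.snd ℝ E E) univ z :=
    hasFDerivAt_snd.hasFDerivWithinAt
  have hφz := hφ.contDiffAt (hO.mem_nhds hzO)
  have h1 : HasFDerivWithinAt (fun z : E × E => φ z.1) _ univ z :=
    (hφz.differentiableAt (by simp)).hasFDerivAt.comp_hasFDerivWithinAt z hfst
  have h2 : HasFDerivWithinAt (fun z : E × E => fderiv ℝ φ z.1) _ univ z :=
    ((hφz.fderiv_right (m := ∞) (by simp)).differentiableAt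
      (by simp)).hasFDerivAt.comp_hasFDerivWithinAt z hfst
  have h3 : ∀ u : E, HasFDerivWithinAt (fun z : E × E => fderiv ℝ φ z.1 u) _ univ z := fun u =>
    h2.clm_apply (hasFDerivWithinAt_const u _ _)
  obtain ⟨L, hL, hLv⟩ := hF'.exists_hasFDerivWithinAt_gLoc h1 (h2.clm_apply hsnd) (h3 u) (h3 w)
    (hU z hz hzO)
  obtain ⟨K, hK, hKv⟩ := hF.exists_hasFDerivWithinAt_gLoc hfst hsnd
    (hasFDerivWithinAt_const u _ _) (hasFDerivWithinAt_const w _ _) hz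
  rw [hasFDerivWithinAt_univ] at hL hK
  have h4 : (fun z : E × E => gLoc F z.1 z.2 u w) =ᶠ[𝓝 z] fun z : E × E =>
      gLoc F' (φ z.1) (fderiv ℝ φ z.1 z.2) (fderiv ℝ φ z.1 u) (fderiv ℝ φ z.1 w) := by
    filter_upwards [hF.isOpen.mem_nhds hz, continuousAt_fst.eventually (hO.mem_nhds hzO)]
      with z hz hzO
    exact hF.gLoc_transform hF' hU hFF' hz hzO u w
  have h5 := DFunLike.congr_fun (hK.unique (hL.congr_of_eventuallyEq h4)) v
  rw [hLv, hKv] at h5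
  simpa using h5

variable [FiniteDimensional ℝ E]

/-- Transformation law of the Christoffel symbols of the Chern connection. -/
theorem chernCLM_transform {z : E × E} (hz : z ∈ U) (hzO : z.1 ∈ O) (e : E ≃L[ℝ] E)
    (he : (e : E →L[ℝ] E) = fderiv ℝ φ z.1) (X Y : E) :
    fderiv ℝ φ z.1 (chernCLM F z X Y)
      = chernCLM F' (φ z.1, fderiv ℝ φ z.1 z.2) (fderiv ℝ φ z.1 X) (fderiv ℝ φ z.1 Y)
        + fderiv ℝ (fderiv ℝ φ) z.1 X Y := by
  set A := fderiv ℝ φ z.1 with hA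
  set D := fderiv ℝ (fderiv ℝ φ) z.1 with hD
  have hz' : (φ z.1, A z.2) ∈ U' := hU z hz hzO
  have hDs : ∀ u w, D u w = D w u := fun u w =>
    (hφ.contDiffAt (hO.mem_nhds hzO)).isSymmSndFDerivAt minSmoothness_two_le_infty u w
  have hAe : ∀ u, A (e.symm u) = u := fun u => by
    rw [← he]
    simp
  have hd : ∀ v : E × E, ∀ u w, _ := fun v u w =>
    hF.gLoc_derivative_transform hF' hO hφ hU hFF' hz hzO v u w
  have hg : ∀ u w, _ := fun u w => hF.gLoc_transform hF' hU hFF' hz hzO u w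
  rw [← hA] at hd hg
  rw [← hD] at hd
  -- A purely vertical direction isolates the Cartan tensor, which is therefore tensorial.
  have hC : ∀ v u w, cartanLoc F z.1 z.2 v u w
      = cartanLoc F' (φ z.1) (A z.2) (A v) (A u) (A w) := fun v u w => by
    have := hd (0, v) u w
    simp only [map_zero, _root_.zero_apply, zero_add, add_zero] at this
    linarith
  -- The candidate is what the transformation law predicts. Its symmetry comes from that of
  -- $D^2\varphi$, and its compatibility from the horizontal case of `gLoc_derivative_transform`;
  -- uniqueness then identifies it with the Chern symbols of $F$.
  have h := hF.chernCLM_unique hz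
    (Γ := fun X Y => e.symm (chernCLM F' (φ z.1, A z.2) (A X) (A Y) + D X Y)) ?_ ?_ X Y
  · rw [h, hAe]
  · intro X Y
    rw [hF'.chernCLM_symm hz', hDs]
  · intro X Y Z
    have h1 := hd (X, 0) Y Z
    have h2 := hF'.dgLoc_eq_chernCLM hz' (A X) (A Y) (A Z)
    simp only [map_zero, _root_.zero_apply, mul_zero, zero_add, add_zero] at h1
    simp only at h2
    rw [h1, h2]
    simp only [hg, hC, hAe, map_add, _root_.add_apply]
    ring

end IsLocalMetric
end CoordinateChange

/-! ### Covariant calculus along a map of two variables, in coordinates. -/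

section LocalVariation

set_option synthInstance.maxHeartbeats 200000

variable {E : Type*} [NormedAddCommGroup E] [NormedSpace ℝ E]
  {V : Type*} [NormedAddCommGroup V] [NormedSpace ℝ V]

/-- Directional derivative of a function of two real variables within a set. -/
def pd (T : Set (ℝ × ℝ)) (v : ℝ × ℝ) (f : ℝ × ℝ → V) (z : ℝ × ℝ) : V := fderivWithin ℝ f T z v

theorem contDiffOn_pd {T : Set (ℝ × ℝ)} (hT : UniqueDiffOn ℝ T) {f : ℝ × ℝ → V}
    (hf : ContDiffOn ℝ ∞ f T) (v : ℝ × ℝ) : ContDiffOn ℝ ∞ (pd T v f) T :=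
  (hf.fderivWithin hT (m := ∞) (by simp)).clm_apply contDiffOn_const

theorem pd_congr {T : Set (ℝ × ℝ)} {f g : ℝ × ℝ → V} (h : EqOn f g T) {z : ℝ × ℝ} (hz : z ∈ T)
    (v : ℝ × ℝ) : pd T v f z = pd T v g z := by
  rw [pd, pd, fderivWithin_congr h (h hz)]

/-- The domains used contain boundary points $t=a,b$; there symmetry of second derivatives holds
because they are limits of interior points. -/
theorem pd_comm {T : Set (ℝ × ℝ)} (hT : UniqueDiffOn ℝ T) (hTc : T ⊆ closure (interior T))
    {f : ℝ × ℝ → V} (hf : ContDiffOn ℝ ∞ f T) (v w : ℝ × ℝ) {z : ℝ × ℝ} (hz : z ∈ T) :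
    pd T v (pd T w f) z = pd T w (pd T v f) z := by
  have h1 := (hf z hz).isSymmSndFDerivWithinAt minSmoothness_two_le_infty hT (hTc hz) hz v w
  have h2 : HasFDerivWithinAt (fderivWithin ℝ f T) _ T z :=
    ((hf.fderivWithin hT (m := ∞) (by simp)).differentiableOn (by simp) z hz).hasFDerivWithinAt
  have h3 : ∀ u, HasFDerivWithinAt (pd T u f) _ T z := fun u =>
    h2.clm_apply (hasFDerivWithinAt_const u _ _)
  rw [pd, pd, (h3 v).fderivWithin (hT z hz), (h3 w).fderivWithin (hT z hz)]
  simpa using h1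

/-- Covariant derivative, in coordinates, of a vector field along a map `x` of two variables, with
reference field the first partial derivative of `x`. -/
def covL (F : E × E → ℝ) (T : Set (ℝ × ℝ)) (x : ℝ × ℝ → E) (v : ℝ × ℝ) (Z : ℝ × ℝ → E)
    (z : ℝ × ℝ) : E :=
  pd T v Z z + chernCLM F (x z, pd T (1, 0) x z) (pd T v x z) (Z z)

/-- The curvature of the Chern connection along a map of two variables, in terms of the base point
`p`, the partial derivatives `a`, `b` of the map and `a'`, `b'` of the reference field. -/
def curvLoc (F : E × E → ℝ) (p : E × E) (a b a' b' Z : E) : E :=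
  fderiv ℝ (chernCLM F) p (a, a') b Z - fderiv ℝ (chernCLM F) p (b, b') a Z
    + chernCLM F p a (chernCLM F p b Z) - chernCLM F p b (chernCLM F p a Z)

namespace IsLocalMetric

variable {F : E × E → ℝ} {U : Set (E × E)} (hF : IsLocalMetric F U) [FiniteDimensional ℝ E]
  {T : Set (ℝ × ℝ)} (hT : UniqueDiffOn ℝ T) {x : ℝ × ℝ → E} (hx : ContDiffOn ℝ ∞ x T)
  (hU : ∀ z ∈ T, (x z, pd T (1, 0) x z) ∈ U)
include hF hT hx hU

theorem contDiffOn_chernCLM_comp :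
    ContDiffOn ℝ ∞ (fun z => chernCLM F (x z, pd T (1, 0) x z)) T :=
  hF.contDiffOn_chernCLM.comp (hx.prodMk (contDiffOn_pd hT hx (1, 0))) hU

theorem contDiffOn_covL {Z : ℝ × ℝ → E} (hZ : ContDiffOn ℝ ∞ Z T) (v : ℝ × ℝ) :
    ContDiffOn ℝ ∞ (covL F T x v Z) T :=
  (contDiffOn_pd hT hZ v).add
    (((hF.contDiffOn_chernCLM_comp hT hx hU).clm_apply (contDiffOn_pd hT hx v)).clm_apply hZ)

theorem covL_pd_comm (hTc : T ⊆ closure (interior T)) (v w : ℝ × ℝ) {z : ℝ × ℝ} (hz : z ∈ T) :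
    covL F T x v (pd T w x) z = covL F T x w (pd T v x) z := by
  rw [covL, covL, pd_comm hT hTc hx v w hz, hF.chernCLM_symm (hU z hz)]

/-- The derivative of the reference field and $\Gamma(x_v,x_t)$ combine inside the Cartan tensor
into the covariant derivative of the reference field. -/
theorem pd_gLoc {Y Z : ℝ × ℝ → E} (hY : ContDiffOn ℝ ∞ Y T) (hZ : ContDiffOn ℝ ∞ Z T)
    (v : ℝ × ℝ) {z : ℝ × ℝ} (hz : z ∈ T) :
    pd T v (fun z => gLoc F (x z) (pd T (1, 0) x z) (Y z) (Z z)) z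
      = gLoc F (x z) (pd T (1, 0) x z) (covL F T x v Y z) (Z z)
        + gLoc F (x z) (pd T (1, 0) x z) (Y z) (covL F T x v Z z)
        + 2 * cartanLoc F (x z) (pd T (1, 0) x z) (covL F T x v (pd T (1, 0) x) z) (Y z) (Z z) := by
  have hd : ∀ {f : ℝ × ℝ → E}, ContDiffOn ℝ ∞ f T →
      HasFDerivWithinAt f (fderivWithin ℝ f T z) T z := fun hf =>
    (hf.differentiableOn (by simp) z hz).hasFDerivWithinAt
  obtain ⟨L, hL, hLv⟩ := hF.exists_hasFDerivWithinAt_gLoc (hd hx)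
    (hd (contDiffOn_pd hT hx (1, 0))) (hd hY) (hd hZ) (hU z hz)
  rw [pd, hL.fderivWithin (hT z hz), hLv]
  have h := hF.dgLoc_eq_chernCLM (hU z hz) (fderivWithin ℝ x T z v) (Y z) (Z z)
  simp only at h
  rw [h]
  simp only [covL, pd, map_add, _root_.add_apply]
  ring

/-- All derivatives of $Z$ cancel in the commutator, so only its value enters. Derivatives of the
reference field survive, because the symbols depend on it. -/
theorem covL_covL_sub (hTc : T ⊆ closure (interior T)) {Z : ℝ × ℝ → E} (hZ : ContDiffOn ℝ ∞ Z T)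
    (v w : ℝ × ℝ) {z : ℝ × ℝ} (hz : z ∈ T) :
    covL F T x v (covL F T x w Z) z - covL F T x w (covL F T x v Z) z
      = curvLoc F (x z, pd T (1, 0) x z) (pd T v x z) (pd T w x z)
          (pd T v (pd T (1, 0) x) z) (pd T w (pd T (1, 0) x) z) (Z z) := by
  have hd : ∀ {f : ℝ × ℝ → E}, ContDiffOn ℝ ∞ f T →
      HasFDerivWithinAt f (fderivWithin ℝ f T z) T z := fun hf =>
    (hf.differentiableOn (by simp) z hz).hasFDerivWithinAt
  have hΓ : HasFDerivWithinAt (fun z => chernCLM F (x z, pd T (1, 0) x z)) _ T z :=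
    HasFDerivAt.comp_hasFDerivWithinAt (g := chernCLM F) z
      (hF.differentiableAt (hU z hz) hF.contDiffOn_chernCLM).hasFDerivAt
      ((hd hx).prodMk (hd (contDiffOn_pd hT hx (1, 0))))
  have key : ∀ v w : ℝ × ℝ, pd T v (covL F T x w Z) z = pd T v (pd T w Z) z
      + (fderiv ℝ (chernCLM F) (x z, pd T (1, 0) x z) (pd T v x z, pd T v (pd T (1, 0) x) z)
          (pd T w x z) (Z z)
        + chernCLM F (x z, pd T (1, 0) x z) (pd T v (pd T w x) z) (Z z)
        + chernCLM F (x z, pd T (1, 0) x z) (pd T w x z) (pd T v Z z)) := fun v w => by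
    have h := (hd (contDiffOn_pd hT hZ w)).add
      ((hΓ.clm_apply (hd (contDiffOn_pd hT hx w))).clm_apply (hd hZ))
    have h' : HasFDerivWithinAt (covL F T x w Z) _ T z := h
    rw [pd, h'.fderivWithin (hT z hz)]
    show pd T v (pd T w Z) z + (chernCLM F (x z, pd T (1, 0) x z) (pd T w x z) (pd T v Z z)
      + (chernCLM F (x z, pd T (1, 0) x z) (pd T v (pd T w x) z) (Z z)
      + fderiv ℝ (chernCLM F) (x z, pd T (1, 0) x z) (pd T v x z, pd T v (pd T (1, 0) x) z)
          (pd T w x z) (Z z))) = _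
    abel
  have h1 : ∀ v w, covL F T x v (covL F T x w Z) z = pd T v (covL F T x w Z) z
      + chernCLM F (x z, pd T (1, 0) x z) (pd T v x z) (pd T w Z z
        + chernCLM F (x z, pd T (1, 0) x z) (pd T w x z) (Z z)) := fun _ _ => rfl
  rw [h1, h1, key, key, pd_comm hT hTc hx v w hz, pd_comm hT hTc hZ v w hz, map_add, map_add,
    curvLoc]
  abel

theorem pd_lagrangian (v : ℝ × ℝ) {z : ℝ × ℝ} (hz : z ∈ T) :
    pd T v (fun z => F (x z, pd T (1, 0) x z)) z
      = 2 * gLoc F (x z) (pd T (1, 0) x z) (covL F T x v (pd T (1, 0) x) z) (pd T (1, 0) x z) := by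
  have hy := contDiffOn_pd hT hx (1, 0)
  have h1 : EqOn (fun z => F (x z, pd T (1, 0) x z))
      (fun z => gLoc F (x z) (pd T (1, 0) x z) (pd T (1, 0) x z) (pd T (1, 0) x z)) T :=
    fun z hz => (hF.gLoc_self (hU z hz)).symm
  have h2 := hF.cartanLoc_self_middle (hU z hz) (covL F T x v (pd T (1, 0) x) z) (pd T (1, 0) x z)
  have h3 := hF.gLoc_symm (hU z hz) (pd T (1, 0) x z) (covL F T x v (pd T (1, 0) x) z)
  simp only at h2 h3
  rw [pd_congr h1 hz, hF.pd_gLoc hT hx hU hy hy v hz, h2, h3]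
  ring

/-- Second variation of the Lagrangian, in coordinates, at a point where the reference field is
parallel in the first variable. -/
theorem second_variation_lagrangian (hTc : T ⊆ closure (interior T)) {z : ℝ × ℝ} (hz : z ∈ T)
    (hgeo : covL F T x (1, 0) (pd T (1, 0) x) z = 0) :
    (1 / 2 : ℝ) * pd T (0, 1) (pd T (0, 1) (fun z => F (x z, pd T (1, 0) x z))) z
      = (gLoc F (x z) (pd T (1, 0) x z) (covL F T x (1, 0) (pd T (0, 1) x) z)
            (covL F T x (1, 0) (pd T (0, 1) x) z)
          - gLoc F (x z) (pd T (1, 0) x z) (curvLoc F (x z, pd T (1, 0) x z) (pd T (1, 0) x z)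
              (pd T (0, 1) x z) (pd T (1, 0) (pd T (1, 0) x) z) (pd T (1, 0) (pd T (0, 1) x) z)
              (pd T (0, 1) x z)) (pd T (1, 0) x z))
        + pd T (1, 0) (fun z => gLoc F (x z) (pd T (1, 0) x z)
            (covL F T x (0, 1) (pd T (0, 1) x) z) (pd T (1, 0) x z)) z := by
  have hy := contDiffOn_pd hT hx (1, 0)
  have hxs := contDiffOn_pd hT hx (0, 1)
  have h1 : EqOn (pd T (0, 1) (fun z => F (x z, pd T (1, 0) x z))) (fun z => (2 : ℝ) • gLoc F (x z)
      (pd T (1, 0) x z) (covL F T x (1, 0) (pd T (0, 1) x) z) (pd T (1, 0) x z)) T := fun z hz => by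
    rw [hF.pd_lagrangian hT hx hU _ hz, hF.covL_pd_comm hT hx hU hTc _ _ hz]
    rfl
  have hc := hF.contDiffOn_covL hT hx hU hxs (1, 0)
  have hg : ContDiffOn ℝ ∞ (fun z => gLoc F (x z)
      (pd T (1, 0) x z) (covL F T x (1, 0) (pd T (0, 1) x) z) (pd T (1, 0) x z)) T :=
    ((hF.contDiffOn_gLoc.comp (hx.prodMk hy) hU).clm_apply hc).clm_apply hy
  have h2 : pd T (0, 1) (pd T (0, 1) (fun z => F (x z, pd T (1, 0) x z))) z
      = 2 * pd T (0, 1) (fun z => gLoc F (x z)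
      (pd T (1, 0) x z) (covL F T x (1, 0) (pd T (0, 1) x) z) (pd T (1, 0) x z)) z := by
    have h : HasFDerivWithinAt (fun z => (2 : ℝ) • gLoc F (x z) (pd T (1, 0) x z)
        (covL F T x (1, 0) (pd T (0, 1) x) z) (pd T (1, 0) x z)) _ T z :=
      (hg.differentiableOn (by simp) z hz).hasFDerivWithinAt.const_smul (2 : ℝ)
    rw [pd_congr h1 hz, pd, h.fderivWithin (hT z hz)]
    rfl
  -- $D_sD_tx_s=D_tD_sx_s-R\,x_s$. The Cartan term of the $s$-derivative vanishes because one entry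
  -- is $x_t$ (`h4`), that of the $t$-derivative because $D_tx_t=0$ (`hgeo`).
  have h3 := hF.covL_covL_sub hT hx hU hTc hxs (1, 0) (0, 1) hz
  rw [sub_eq_iff_eq_add'] at h3
  have h4 := hF.cartanLoc_self_right (hU z hz) (covL F T x (0, 1) (pd T (1, 0) x) z)
    (covL F T x (1, 0) (pd T (0, 1) x) z)
  simp only at h4
  rw [h2, hF.pd_gLoc hT hx hU hc hy _ hz,
    hF.pd_gLoc hT hx hU (hF.contDiffOn_covL hT hx hU hxs (0, 1)) hy _ hz, hgeo, h3, h4,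
    hF.covL_pd_comm hT hx hU hTc (0, 1) (1, 0) hz, pd_comm hT hTc hx (0, 1) (1, 0) hz]
  simp only [map_add, map_zero, _root_.add_apply, _root_.zero_apply]
  ring

end IsLocalMetric
end LocalVariation

/-! ### Charts of the tangent bundle and their transitions. -/

section TangentCharts

variable {E : Type*} [NormedAddCommGroup E] [NormedSpace ℝ E]
  {M : Type*} [TopologicalSpace M] [ChartedSpace E M] [IsManifold 𝓘(ℝ, E) ∞ M]

/-- The chart of the tangent bundle induced by the preferred chart at `p`. -/
def tchart (p : M) : PartialEquiv (TangentBundle 𝓘(ℝ, E) M) (E × E) :=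
  extChartAt 𝓘(ℝ, E).tangent (tvec p 0)

theorem extChartAt_tangent_eq (v : TangentBundle 𝓘(ℝ, E) M) :
    extChartAt 𝓘(ℝ, E).tangent v = tchart v.proj := rfl

theorem mem_tchart_source {p : M} {v : TangentBundle 𝓘(ℝ, E) M} :
    v ∈ (tchart p).source ↔ v.proj ∈ (chartAt E p).source := by
  rw [tchart, extChartAt_source]
  exact TangentBundle.mem_chart_source_iff v (tvec p 0)

theorem tchart_apply (p : M) (v : TangentBundle 𝓘(ℝ, E) M) :
    tchart p v = (extChartAt 𝓘(ℝ, E) p v.proj,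
      tangentCoordChange 𝓘(ℝ, E) v.proj p v.proj (vec v)) :=
  rfl

theorem mem_tchart_target {p : M} {z : E × E} :
    z ∈ (tchart p).target ↔ z.1 ∈ (extChartAt 𝓘(ℝ, E) p).target := by
  rw [tchart, extChartAt_target, extChartAt_target]
  simp only [mfld_simps, Prod.map_id, range_id]
  exact TangentBundle.mem_chart_target_iff z (tvec p 0)

theorem tchart_self (p : M) (y : E) : tchart p (tvec p y) = (extChartAt 𝓘(ℝ, E) p p, y) := by
  rw [tchart_apply]
  exact Prod.ext rfl (tangentCoordChange_self (mem_extChartAt_source p))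

theorem tchart_proj_self (v : TangentBundle 𝓘(ℝ, E) M) :
    tchart v.proj v = (extChartAt 𝓘(ℝ, E) v.proj v.proj, vec v) := tchart_self v.proj (vec v)

/-- Transition map between the preferred charts at `q` and `p`. -/
def transition (q p : M) : E → E := extChartAt 𝓘(ℝ, E) p ∘ (extChartAt 𝓘(ℝ, E) q).symm

/-- The domain of `transition q p`. -/
def transitionDomain (q p : M) : Set E :=
  (extChartAt 𝓘(ℝ, E) q).target ∩ (extChartAt 𝓘(ℝ, E) q).symm ⁻¹' (chartAt E p).source

omit [IsManifold 𝓘(ℝ, E) ∞ M] in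
theorem isOpen_transitionDomain (q p : M) : IsOpen (transitionDomain (E := E) q p) :=
  (continuousOn_extChartAt_symm q).isOpen_inter_preimage (isOpen_extChartAt_target q)
    (chartAt E p).open_source

theorem contDiffOn_transition (q p : M) :
    ContDiffOn ℝ ∞ (transition (E := E) q p) (transitionDomain q p) := by
  refine (contDiffOn_ext_coord_change (I := 𝓘(ℝ, E)) (n := ∞) p q).mono fun z hz => ?_
  rw [PartialEquiv.trans_source]
  exact ⟨hz.1, by simpa using hz.2⟩

omit [IsManifold 𝓘(ℝ, E) ∞ M] in
theorem mem_transitionDomain {q p m : M} (hq : m ∈ (chartAt E q).source)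
    (hp : m ∈ (chartAt E p).source) : extChartAt 𝓘(ℝ, E) q m ∈ transitionDomain q p := by
  have hq' : m ∈ (extChartAt 𝓘(ℝ, E) q).source := by rwa [extChartAt_source]
  refine ⟨(extChartAt 𝓘(ℝ, E) q).map_source hq', ?_⟩
  rw [mem_preimage, (extChartAt 𝓘(ℝ, E) q).left_inv hq']
  exact hp

omit [IsManifold 𝓘(ℝ, E) ∞ M] in
theorem transition_apply {q p m : M} (hq : m ∈ (chartAt E q).source) :
    transition q p (extChartAt 𝓘(ℝ, E) q m) = extChartAt 𝓘(ℝ, E) p m := by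
  have hq' : m ∈ (extChartAt 𝓘(ℝ, E) q).source := by rwa [extChartAt_source]
  rw [transition, Function.comp_apply, (extChartAt 𝓘(ℝ, E) q).left_inv hq']

theorem fderiv_transition (q p m : M) :
    fderiv ℝ (transition q p) (extChartAt 𝓘(ℝ, E) q m) = tangentCoordChange 𝓘(ℝ, E) q p m := by
  rw [tangentCoordChange_def, ModelWithCorners.range_eq_univ, fderivWithin_univ]
  rfl

theorem tchart_transition {q p : M} {v : TangentBundle 𝓘(ℝ, E) M}
    (hq : v.proj ∈ (chartAt E q).source) (hp : v.proj ∈ (chartAt E p).source) :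
    tchart p v = (transition q p (tchart q v).1,
      fderiv ℝ (transition q p) (tchart q v).1 (tchart q v).2) := by
  rw [tchart_apply, tchart_apply]
  simp only
  rw [fderiv_transition, transition_apply hq, tangentCoordChange_comp]
  simp only [extChartAt_source]
  exact ⟨⟨mem_chart_source E _, hq⟩, hp⟩

theorem exists_equiv_fderiv_transition {q p m : M} (hq : m ∈ (chartAt E q).source)
    (hp : m ∈ (chartAt E p).source) :
    ∃ e : E ≃L[ℝ] E, (e : E →L[ℝ] E) = fderiv ℝ (transition q p) (extChartAt 𝓘(ℝ, E) q m) := by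
  rw [fderiv_transition]
  have h : ∀ {q p : M}, m ∈ (chartAt E q).source → m ∈ (chartAt E p).source → ∀ v : E,
      tangentCoordChange 𝓘(ℝ, E) p q m (tangentCoordChange 𝓘(ℝ, E) q p m v) = v := by
    intro q p hq hp v
    rw [tangentCoordChange_comp, tangentCoordChange_self]
    · rwa [extChartAt_source]
    · simp only [extChartAt_source]
      exact ⟨⟨hq, hp⟩, hq⟩
  refine ⟨ContinuousLinearEquiv.equivOfInverse (tangentCoordChange 𝓘(ℝ, E) q p m)
    (tangentCoordChange 𝓘(ℝ, E) p q m) (h hq hp) (h hp hq), ?_⟩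
  ext v
  rfl

theorem contMDiffOn_tchart_symm (p : M) :
    ContMDiffOn 𝓘(ℝ, E × E) 𝓘(ℝ, E).tangent ∞ (tchart (E := E) p).symm (tchart p).target :=
  contMDiffOn_extChartAt_symm (I := 𝓘(ℝ, E).tangent) (tvec p 0)

theorem contMDiffOn_tchart (p : M) :
    ContMDiffOn 𝓘(ℝ, E).tangent 𝓘(ℝ, E × E) ∞ (tchart (E := E) p) (tchart p).source := by
  have := contMDiffOn_extChartAt (I := 𝓘(ℝ, E).tangent) (n := ∞)
    (x := (tvec p 0 : TangentBundle 𝓘(ℝ, E) M))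
  rwa [← extChartAt_source 𝓘(ℝ, E).tangent] at this

theorem isOpen_tchart_target (p : M) : IsOpen (tchart (E := E) p).target := by
  have : (tchart (E := E) p).target = Prod.fst ⁻¹' (extChartAt 𝓘(ℝ, E) p).target :=
    Set.ext fun z => mem_tchart_target
  rw [this]
  exact (isOpen_extChartAt_target p).preimage continuous_fst

/-- Identity for vectors at a point of the domain of the preferred chart at `p`. -/
theorem tchart_symm_of_proj {p : M} {v : TangentBundle 𝓘(ℝ, E) M}
    (hv : v.proj ∈ (chartAt E p).source) (y : E) :
    (tchart p).symm ((tchart p v).1, tangentCoordChange 𝓘(ℝ, E) v.proj p v.proj y)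
      = tvec v.proj y := by
  have h : tvec v.proj y ∈ (tchart p).source := mem_tchart_source.2 hv
  rw [← (tchart p).left_inv h]
  rfl

/-- The chart of the tangent bundle is homogeneous in the fibres. -/
theorem tchart_symm_smul {p : M} {z : E × E} (hz : z ∈ (tchart p).target) (c : ℝ) :
    (tchart p).symm (z.1, c • z.2)
      = tvec ((tchart p).symm z).proj (c • vec ((tchart p).symm z)) := by
  have hv := mem_tchart_source.1 ((tchart p).map_target hz)
  rw [← tchart_symm_of_proj hv, (tchart p).right_inv hz, map_smul]
  have h := congrArg Prod.snd ((tchart p).right_inv hz)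
  rw [tchart_apply] at h
  simp only at h
  rw [h]

end TangentCharts

/-! ### The metric and its Chern symbols in charts. -/

namespace PseudoFinslerMetric

variable {E : Type*} [NormedAddCommGroup E] [NormedSpace ℝ E]
  {M : Type*} [TopologicalSpace M] [ChartedSpace E M] [IsManifold 𝓘(ℝ, E) ∞ M]
  (Φ : PseudoFinslerMetric E M)

/-- Coordinate expression of the metric in the chart at `p`. -/
def loc (p : M) : E × E → ℝ := fun z => Φ.L ((tchart p).symm z)

/-- Coordinate domain of the metric in the chart at `p`. -/
def dom (p : M) : Set (E × E) := (tchart p).target ∩ (tchart p).symm ⁻¹' Φ.A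

theorem chern_eq (v : TangentBundle 𝓘(ℝ, E) M) (X Y : E) :
    Φ.chern v X Y = chernCLM (Φ.loc v.proj) (tchart v.proj v) X Y := rfl

theorem isOpen_dom (p : M) : IsOpen (Φ.dom p) :=
  (contMDiffOn_tchart_symm p).continuousOn.isOpen_inter_preimage (isOpen_tchart_target p) Φ.isOpen_A

theorem tchart_mem_dom {p : M} {v : TangentBundle 𝓘(ℝ, E) M} (hv : v ∈ Φ.A)
    (hp : v.proj ∈ (chartAt E p).source) : tchart p v ∈ Φ.dom p := by
  have h := mem_tchart_source.2 hp
  refine ⟨(tchart p).map_source h, ?_⟩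
  rwa [mem_preimage, (tchart p).left_inv h]

theorem contDiffOn_loc (p : M) : ContDiffOn ℝ ∞ (Φ.loc p) (Φ.dom p) := by
  rw [← contMDiffOn_iff_contDiffOn]
  exact Φ.smooth.comp ((contMDiffOn_tchart_symm p).mono inter_subset_left) fun z hz => hz.2

/-- The fundamental tensor in the chart at `p`. -/
theorem g_eq {p : M} {v : TangentBundle 𝓘(ℝ, E) M} (hv : v ∈ Φ.A)
    (hp : v.proj ∈ (chartAt E p).source) (u w : E) :
    Φ.g v u w = gLoc (Φ.loc p) (tchart p v).1 (tchart p v).2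
      (tangentCoordChange 𝓘(ℝ, E) v.proj p v.proj u)
      (tangentCoordChange 𝓘(ℝ, E) v.proj p v.proj w) := by
  set A := tangentCoordChange 𝓘(ℝ, E) v.proj p v.proj with hA
  obtain ⟨e, he⟩ := exists_equiv_fderiv_transition (mem_chart_source E v.proj) hp
  rw [fderiv_transition, ← hA] at he
  -- On a single fibre the preferred coordinates and those of the chart at $p$ differ by the linear
  -- isomorphism `e`, so the Hessian simply pulls back.
  have h1 : (fun y : E => Φ.L (tvec v.proj y)) = (fun y' => Φ.loc p ((tchart p v).1, y')) ∘ e := by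
    funext y
    have h2 : e y = A y := DFunLike.congr_fun he y
    rw [Function.comp_apply, h2, loc, tchart_symm_of_proj hp]
  have h3 : (tchart p v).2 = e (vec v) := (DFunLike.congr_fun he (vec v)).symm
  have h4 : fderiv ℝ ((fun y' => Φ.loc p ((tchart p v).1, y')) ∘ e)
      = (ContinuousLinearMap.compL ℝ E E ℝ).flip (e : E →L[ℝ] E) ∘
        (fderiv ℝ (fun y' => Φ.loc p ((tchart p v).1, y')) ∘ e) := by
    funext y
    rw [e.comp_right_fderiv]
    rfl
  have h5 : DifferentiableAt ℝ (fderiv ℝ (fun y' => Φ.loc p ((tchart p v).1, y')) ∘ e) (vec v) := by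
    rw [e.comp_right_differentiableAt_iff, ← h3]
    have h6 : ContDiffAt ℝ ∞ (fun y' => Φ.loc p ((tchart p v).1, y')) (tchart p v).2 :=
      ContDiffAt.comp (tchart p v).2 (g := Φ.loc p) ((Φ.contDiffOn_loc p).contDiffAt
        ((Φ.isOpen_dom p).mem_nhds (Φ.tchart_mem_dom hv hp))) (by fun_prop)
    exact (h6.fderiv_right (m := ∞) (by simp)).differentiableAt (by simp)
  have h7 : fderiv ℝ (fderiv ℝ ((fun y' => Φ.loc p ((tchart p v).1, y')) ∘ e)) (vec v) u w
      = fderiv ℝ (fderiv ℝ (fun y' => Φ.loc p ((tchart p v).1, y'))) (e (vec v)) (e u) (e w) := by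
    have h8 := ((ContinuousLinearMap.compL ℝ E E ℝ).flip
      (e : E →L[ℝ] E)).hasFDerivAt.comp (vec v) h5.hasFDerivAt
    rw [h4, h8.fderiv, e.comp_right_fderiv]
    rfl
  show (1 / 2 : ℝ) * fderiv ℝ (fderiv ℝ (fun y : E => Φ.L (tvec v.proj y))) (vec v) u w = _
  rw [h1, h7, ← h3, ← he]
  rfl

theorem isLocalMetric (p : M) : IsLocalMetric (Φ.loc p) (Φ.dom p) where
  isOpen := Φ.isOpen_dom p
  smooth := Φ.contDiffOn_loc p
  smul_mem z hz c hc := by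
    refine ⟨mem_tchart_target.2 (mem_tchart_target.1 hz.1), ?_⟩
    rw [mem_preimage, tchart_symm_smul hz.1]
    exact Φ.smul_mem _ hz.2 c hc
  homogeneous z hz c hc := by
    rw [loc, tchart_symm_smul hz.1]
    exact Φ.homogeneous _ hz.2 c hc
  nondegenerate z hz u hu := by
    have hp : ((tchart p).symm z).proj ∈ (chartAt E p).source :=
      mem_tchart_source.1 ((tchart p).map_target hz.1)
    obtain ⟨e, he⟩ := exists_equiv_fderiv_transition (mem_chart_source E _) hp
    rw [fderiv_transition] at he
    have h : e.symm u = 0 := Φ.nondegenerate _ hz.2 _ fun w => by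
      have h1 := Φ.g_eq hz.2 hp (e.symm u) w
      rw [(tchart p).right_inv hz.1, ← he] at h1
      simp only [ContinuousLinearEquiv.coe_coe, ContinuousLinearEquiv.apply_symm_apply, hu] at h1
      exact h1
    simpa using h

/-- Taking the arguments as points of the bundle makes their components in any chart available
through `tchart`, the form in which covariant derivatives are computed below. -/
theorem g_eq_of_proj {p : M} {v a b : TangentBundle 𝓘(ℝ, E) M} (hv : v ∈ Φ.A)
    (hp : v.proj ∈ (chartAt E p).source) (ha : a.proj = v.proj) (hb : b.proj = v.proj) :
    Φ.g v (vec a) (vec b)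
      = gLoc (Φ.loc p) (tchart p v).1 (tchart p v).2 (tchart p a).2 (tchart p b).2 := by
  obtain ⟨q, a⟩ := a
  obtain ⟨q', b⟩ := b
  simp only at ha hb
  subst ha hb
  exact Φ.g_eq hv hp a b

theorem transition_mem_dom {q p : M} {z : E × E} (hz : z ∈ Φ.dom q)
    (hO : z.1 ∈ transitionDomain q p) :
    (transition q p z.1, fderiv ℝ (transition q p) z.1 z.2) = tchart p ((tchart q).symm z)
      ∧ ((tchart q).symm z).proj ∈ (chartAt E p).source := by
  have h := mem_tchart_source.1 ((tchart q).map_target hz.1)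
  have hp : ((tchart q).symm z).proj ∈ (chartAt E p).source := hO.2
  refine ⟨?_, hp⟩
  rw [tchart_transition h hp, (tchart q).right_inv hz.1]

variable [FiniteDimensional ℝ E]

/-- The Christoffel symbols in the preferred chart at the base point of `v` and in the chart
at `p`. -/
theorem chern_transform {p : M} {v : TangentBundle 𝓘(ℝ, E) M} (hv : v ∈ Φ.A)
    (hp : v.proj ∈ (chartAt E p).source) (X Y : E) :
    tangentCoordChange 𝓘(ℝ, E) v.proj p v.proj (Φ.chern v X Y)
      = chernCLM (Φ.loc p) (tchart p v) (tangentCoordChange 𝓘(ℝ, E) v.proj p v.proj X)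
          (tangentCoordChange 𝓘(ℝ, E) v.proj p v.proj Y)
        + fderiv ℝ (fderiv ℝ (transition v.proj p)) (extChartAt 𝓘(ℝ, E) v.proj v.proj) X Y := by
  have hq := mem_chart_source E v.proj
  obtain ⟨e, he⟩ := exists_equiv_fderiv_transition hq hp
  have h := (Φ.isLocalMetric v.proj).chernCLM_transform (Φ.isLocalMetric p)
    (isOpen_transitionDomain v.proj p) (contDiffOn_transition v.proj p)
    (fun z hz hO => by
      obtain ⟨h1, h2⟩ := Φ.transition_mem_dom hz hO
      rw [h1]
      exact Φ.tchart_mem_dom hz.2 h2)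
    (fun z hz hO => by
      obtain ⟨h1, h2⟩ := Φ.transition_mem_dom hz hO
      rw [h1, loc, loc, (tchart p).left_inv (mem_tchart_source.2 h2)])
    (Φ.tchart_mem_dom hv hq) (mem_transitionDomain hq hp) e he X Y
  have h1 := tchart_transition hq hp
  rw [← h1] at h
  have h2 : fderiv ℝ (transition v.proj p) (tchart v.proj v).1
      = tangentCoordChange 𝓘(ℝ, E) v.proj p v.proj := fderiv_transition _ _ _
  rw [h2] at h
  exact h

end PseudoFinslerMetric

/-! ### Velocities and covariant derivatives of curves in an arbitrary chart. -/

section Curves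

variable {E : Type*} [NormedAddCommGroup E] [NormedSpace ℝ E]
  {M : Type*} [TopologicalSpace M] [ChartedSpace E M] [IsManifold 𝓘(ℝ, E) ∞ M]

/-- The velocity of a curve in the chart at `p`. -/
theorem tchart_velocity {p : M} {S : Set ℝ} {c : ℝ → M} {t : ℝ}
    (hc : MDifferentiableWithinAt 𝓘(ℝ, ℝ) 𝓘(ℝ, E) c S t) (hu : UniqueDiffWithinAt ℝ S t)
    (hp : c t ∈ (chartAt E p).source) :
    tchart p (velocity S c t)
      = (extChartAt 𝓘(ℝ, E) p (c t), derivWithin (extChartAt 𝓘(ℝ, E) p ∘ c) S t) := by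
  have h1 := (hasMFDerivAt_extChartAt (I := 𝓘(ℝ, E)) hp).comp_hasMFDerivWithinAt t
    hc.hasMFDerivWithinAt
  rw [mfderiv_chartAt_eq_tangentCoordChange hp] at h1
  let m : ℝ →L[ℝ] E := mfderivWithin 𝓘(ℝ, ℝ) 𝓘(ℝ, E) c S t
  have h2 : HasFDerivWithinAt (extChartAt 𝓘(ℝ, E) p ∘ c)
      (tangentCoordChange 𝓘(ℝ, E) (c t) p (c t) ∘L m) S t :=
    hasMFDerivWithinAt_iff_hasFDerivWithinAt.1 h1
  rw [tchart_apply, h2.hasDerivWithinAt.derivWithin hu]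
  rfl

/-- Change of chart for the derivative of a curve in the tangent bundle. -/
theorem hasDerivWithinAt_tchart_change {q p : M} {S : Set ℝ} {t : ℝ}
    {X : ℝ → TangentBundle 𝓘(ℝ, E) M} (hX : ContinuousWithinAt (fun r => (X r).proj) S t)
    (hq : (X t).proj ∈ (chartAt E q).source) (hp : (X t).proj ∈ (chartAt E p).source)
    {h : E × E} (hd : HasDerivWithinAt (fun r => tchart q (X r)) h S t) :
    HasDerivWithinAt (fun r => tchart p (X r))
      (tangentCoordChange 𝓘(ℝ, E) q p (X t).proj h.1,
        fderiv ℝ (fderiv ℝ (transition q p)) (extChartAt 𝓘(ℝ, E) q (X t).proj) h.1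
          (tchart q (X t)).2 + tangentCoordChange 𝓘(ℝ, E) q p (X t).proj h.2) S t := by
  have hO := mem_transitionDomain (E := E) hq hp
  have hφ := (contDiffOn_transition (E := E) q p).contDiffAt
    ((isOpen_transitionDomain q p).mem_nhds hO)
  have h1 : HasDerivWithinAt (fun r => (tchart q (X r)).1) h.1 S t := hd.fst
  have h2 : HasDerivWithinAt (fun r => (tchart q (X r)).2) h.2 S t := hd.snd
  have hφ1 : HasFDerivAt (transition q p) (tangentCoordChange 𝓘(ℝ, E) q p (X t).proj)
      (tchart q (X t)).1 := by
    rw [← fderiv_transition]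
    exact (hφ.differentiableAt (by simp)).hasFDerivAt
  have hφ2 : HasFDerivAt (fderiv ℝ (transition q p))
      (fderiv ℝ (fderiv ℝ (transition q p)) (extChartAt 𝓘(ℝ, E) q (X t).proj))
      (tchart q (X t)).1 :=
    ((hφ.fderiv_right (m := ∞) (by simp)).differentiableAt (by simp)).hasFDerivAt
  have h3 := HasFDerivAt.comp_hasDerivWithinAt (f := fun r => (tchart q (X r)).1) t hφ1 h1
  have h4 := HasFDerivAt.comp_hasDerivWithinAt (f := fun r => (tchart q (X r)).1) t hφ2 h1
  have h5 := h3.prodMk (h4.clm_apply h2)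
  simp only [Function.comp_apply] at h5
  have h6 : fderiv ℝ (transition q p) (tchart q (X t)).1
      = tangentCoordChange 𝓘(ℝ, E) q p (X t).proj := fderiv_transition _ _ _
  rw [h6] at h5
  have hev : ∀ᶠ r in 𝓝[S] t, tchart p (X r) = (transition q p (tchart q (X r)).1,
      fderiv ℝ (transition q p) (tchart q (X r)).1 (tchart q (X r)).2) := by
    filter_upwards [hX.eventually ((chartAt E q).open_source.mem_nhds hq),
      hX.eventually ((chartAt E p).open_source.mem_nhds hp)] with r h1 h2
    exact tchart_transition h1 h2
  exact h5.congr_of_eventuallyEq hev (tchart_transition hq hp)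

namespace PseudoFinslerMetric

variable [FiniteDimensional ℝ E] (Φ : PseudoFinslerMetric E M)

/-- The covariant derivative along a curve in the chart at `p`. -/
theorem tchart_D {p : M} {S : Set ℝ} {t : ℝ} {V X : ℝ → TangentBundle 𝓘(ℝ, E) M}
    (hu : UniqueDiffWithinAt ℝ S t) (hX : ContinuousWithinAt (fun r => (X r).proj) S t)
    (hV : V t ∈ Φ.A) (hVX : (V t).proj = (X t).proj) (hp : (X t).proj ∈ (chartAt E p).source)
    {h : E × E} (hd : HasDerivWithinAt (fun r => tchart p (X r)) h S t) :
    tchart p (Φ.D S V X t) = ((tchart p (X t)).1,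
      h.2 + chernCLM (Φ.loc p) (tchart p (V t)) h.1 (tchart p (X t)).2) := by
  have hq := mem_chart_source E (X t).proj
  have hd1 := hasDerivWithinAt_tchart_change hX hp hq hd
  set h' : E × E := _ with hh'
  change HasDerivWithinAt _ h' S t at hd1
  -- Passing to the preferred chart and back must return `h`. This expresses `h` through `h'` with
  -- the second derivative of a single transition map, the one that also occurs in
  -- `chern_transform`.
  have hd2 := hu.eq_deriv S hd (hasDerivWithinAt_tchart_change hX hq hp hd1)
  have hD : Φ.D S V X t = tvec (X t).proj (h'.2 + Φ.chern (V t) h'.1 (vec (X t))) := by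
    have h1 : (mfderivWithin 𝓘(ℝ, ℝ) 𝓘(ℝ, E × E)
        (fun k' => extChartAt 𝓘(ℝ, E).tangent (X t) (X k')) S t (1 : ℝ) : E × E) = h' := by
      rw [mfderivWithin_eq_fderivWithin]
      exact hd1.derivWithin hu
    show tvec (X t).proj ((mfderivWithin 𝓘(ℝ, ℝ) 𝓘(ℝ, E × E)
        (fun k' => extChartAt 𝓘(ℝ, E).tangent (X t) (X k')) S t (1 : ℝ) : E × E).2
      + Φ.chern (V t) (mfderivWithin 𝓘(ℝ, ℝ) 𝓘(ℝ, E × E)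
        (fun k' => extChartAt 𝓘(ℝ, E).tangent (X t) (X k')) S t (1 : ℝ) : E × E).1 (vec (X t))) = _
    rw [h1]
  rw [hD, tchart_apply, tchart_apply]
  refine Prod.ext rfl ?_
  show tangentCoordChange 𝓘(ℝ, E) (X t).proj p (X t).proj (h'.2 + Φ.chern (V t) h'.1 (vec (X t)))
    = h.2 + chernCLM (Φ.loc p) (tchart p (V t)) h.1
      (tangentCoordChange 𝓘(ℝ, E) (X t).proj p (X t).proj (vec (X t)))
  -- The second-derivative term of the Christoffel law is exactly what completes the transformed
  -- `h'.2` to `h.2`.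
  have hc := Φ.chern_transform hV (hVX ▸ hp) h'.1 (vec (X t))
  rw [hVX] at hc
  rw [map_add, hc, congrArg Prod.fst hd2, congrArg Prod.snd hd2]
  have h2 : (tchart (X t).proj (X t)).2 = vec (X t) := by rw [tchart_proj_self]
  rw [h2]
  have h3 : ∀ a b c : E, a + (b + c) = c + a + b := fun a b c => by abel
  exact h3 _ _ _

end PseudoFinslerMetric
end Curves

/-! ### The parameter stripe and its slices. -/

section Stripe

/-- The parameter domain `[a, b] × (-ε, ε)` of a variation. -/
def stripe (a b ε : ℝ) : Set (ℝ × ℝ) := Icc a b ×ˢ Ioo (-ε) ε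

variable {a b ε : ℝ}

theorem uniqueDiffOn_stripe (hab : a < b) : UniqueDiffOn ℝ (stripe a b ε) :=
  (uniqueDiffOn_Icc hab).prod isOpen_Ioo.uniqueDiffOn

theorem stripe_subset_closure_interior (hab : a < b) :
    stripe a b ε ⊆ closure (interior (stripe a b ε)) := by
  rw [stripe, interior_prod_eq, interior_Icc, interior_Ioo, closure_prod_eq,
    closure_Ioo hab.ne]
  exact prod_mono_right subset_closure

variable {V : Type*} [NormedAddCommGroup V] [NormedSpace ℝ V]

/-- Only differentiability in a relative neighbourhood `T` is required, so the part of the stripe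
seen by one chart suffices; at $t=a,b$ the derivative is one-sided. -/
theorem hasDerivWithinAt_slice_fst {T : Set (ℝ × ℝ)} {t s : ℝ} {f : ℝ × ℝ → V}
    (hT : T ∈ 𝓝[stripe a b ε] (t, s)) (hs : s ∈ Ioo (-ε) ε)
    (hf : DifferentiableWithinAt ℝ f T (t, s)) :
    HasDerivWithinAt (fun t' => f (t', s)) (pd T (1, 0) f (t, s)) (Icc a b) t := by
  have h1 := hf.hasFDerivWithinAt.mono_of_mem_nhdsWithin hT
  have h2 : HasDerivWithinAt (fun t' : ℝ => (t', s)) ((1 : ℝ), (0 : ℝ)) (Icc a b) t :=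
    (hasDerivWithinAt_id t _).prodMk (hasDerivWithinAt_const t _ s)
  exact h1.comp_hasDerivWithinAt t h2 (t := stripe a b ε) fun t' ht' => ⟨ht', hs⟩

theorem hasDerivWithinAt_slice_snd {T : Set (ℝ × ℝ)} {t s : ℝ} {f : ℝ × ℝ → V}
    (hT : T ∈ 𝓝[stripe a b ε] (t, s)) (ht : t ∈ Icc a b)
    (hf : DifferentiableWithinAt ℝ f T (t, s)) :
    HasDerivWithinAt (fun s' => f (t, s')) (pd T (0, 1) f (t, s)) (Ioo (-ε) ε) s := by
  have h1 := hf.hasFDerivWithinAt.mono_of_mem_nhdsWithin hT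
  have h2 : HasDerivWithinAt (fun s' : ℝ => (t, s')) ((0 : ℝ), (1 : ℝ)) (Ioo (-ε) ε) s :=
    (hasDerivWithinAt_const s _ t).prodMk (hasDerivWithinAt_id s _)
  exact h1.comp_hasDerivWithinAt s h2 (t := stripe a b ε) fun s' hs' => ⟨ht, hs'⟩

theorem eventually_slice_fst {T : Set (ℝ × ℝ)} {t s : ℝ}
    (hT : T ∈ 𝓝[stripe a b ε] (t, s)) (hs : s ∈ Ioo (-ε) ε) :
    ∀ᶠ t' in 𝓝[Icc a b] t, (t', s) ∈ T := by
  have h : Tendsto (fun t' : ℝ => (t', s)) (𝓝[Icc a b] t) (𝓝[stripe a b ε] (t, s)) :=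
    (Continuous.prodMk_left s).continuousWithinAt.tendsto_nhdsWithin fun t' ht' => ⟨ht', hs⟩
  exact h hT

theorem eventually_slice_snd {T : Set (ℝ × ℝ)} {t s : ℝ}
    (hT : T ∈ 𝓝[stripe a b ε] (t, s)) (ht : t ∈ Icc a b) :
    ∀ᶠ s' in 𝓝[Ioo (-ε) ε] s, (t, s') ∈ T := by
  have h : Tendsto (fun s' : ℝ => (t, s')) (𝓝[Ioo (-ε) ε] s) (𝓝[stripe a b ε] (t, s)) :=
    (Continuous.prodMk_right t).continuousWithinAt.tendsto_nhdsWithin fun s' hs' => ⟨ht, hs'⟩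
  exact h hT

end Stripe

/-! ### Variations and curvature in a chart. -/

section Variations

variable {E : Type*} [NormedAddCommGroup E] [NormedSpace ℝ E]
  {M : Type*} [TopologicalSpace M] [ChartedSpace E M] [IsManifold 𝓘(ℝ, E) ∞ M]

theorem vec_eq_of_tchart {p : M} {v : TangentBundle 𝓘(ℝ, E) M} {x y : E}
    (h : tchart p v = (x, y)) (hv : v.proj = p) : vec v = y := by
  subst hv
  rw [tchart_proj_self] at h
  exact congrArg Prod.snd h

/-- The part of the parameter domain of a variation mapped into the chart at `p`. -/
def chartDom (a b ε : ℝ) (Λ : ℝ → ℝ → M) (p : M) : Set (ℝ × ℝ) :=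
  stripe a b ε ∩ Function.uncurry Λ ⁻¹' (chartAt E p).source

/-- A variation in the chart at `p`. -/
def chartMap (Λ : ℝ → ℝ → M) (p : M) (z : ℝ × ℝ) : E := extChartAt 𝓘(ℝ, E) p (Λ z.1 z.2)

namespace PseudoFinslerMetric.IsVariation

variable {Φ : PseudoFinslerMetric E M} {a b ε : ℝ} {γ : ℝ → M} {Λ : ℝ → ℝ → M}
  (hΛ : Φ.IsVariation a b γ ε Λ) (hab : a < b) (p : M)
include hΛ

theorem zero_mem : (0 : ℝ) ∈ Ioo (-ε) ε := ⟨neg_lt_zero.2 hΛ.pos, hΛ.pos⟩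

/-- Relative openness in the stripe is what passes unique differentiability and density of the
interior on to the chart domain. -/
theorem exists_chartDom_eq :
    ∃ V : Set (ℝ × ℝ), IsOpen V ∧ chartDom (E := E) a b ε Λ p = stripe a b ε ∩ V := by
  obtain ⟨V, hV, h⟩ := (continuousOn_iff'.1 hΛ.smooth.continuousOn) _ (chartAt E p).open_source
  exact ⟨V, hV, by
    rw [chartDom, inter_comm, inter_comm (stripe a b ε) V]
    exact h⟩

theorem chartDom_mem_nhdsWithin {z : ℝ × ℝ} (hz : z ∈ chartDom (E := E) a b ε Λ p) :
    chartDom (E := E) a b ε Λ p ∈ 𝓝[stripe a b ε] z := by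
  obtain ⟨V, hV, h⟩ := hΛ.exists_chartDom_eq p
  rw [h] at hz ⊢
  exact inter_mem_nhdsWithin _ (hV.mem_nhds hz.2)

theorem contDiffOn_chartMap :
    ContDiffOn ℝ ∞ (chartMap (E := E) Λ p) (chartDom (E := E) a b ε Λ p) := by
  rw [← contMDiffOn_iff_contDiffOn]
  exact (contMDiffOn_extChartAt (I := 𝓘(ℝ, E)) (x := p)).comp (hΛ.smooth.mono inter_subset_left)
    fun z hz => hz.2

theorem contMDiffOn_slice_fst {s : ℝ} (hs : s ∈ Ioo (-ε) ε) :
    ContMDiffOn 𝓘(ℝ, ℝ) 𝓘(ℝ, E) ∞ (fun t => Λ t s) (Icc a b) := by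
  have h : ContMDiff 𝓘(ℝ, ℝ) 𝓘(ℝ, ℝ × ℝ) ∞ (fun t : ℝ => (t, s)) :=
    contMDiff_iff_contDiff.2 (by fun_prop)
  exact hΛ.smooth.comp h.contMDiffOn fun t ht => ⟨ht, hs⟩

theorem contMDiffOn_slice_snd {t : ℝ} (ht : t ∈ Icc a b) :
    ContMDiffOn 𝓘(ℝ, ℝ) 𝓘(ℝ, E) ∞ (fun s => Λ t s) (Ioo (-ε) ε) := by
  have h : ContMDiff 𝓘(ℝ, ℝ) 𝓘(ℝ, ℝ × ℝ) ∞ (fun s : ℝ => (t, s)) :=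
    contMDiff_iff_contDiff.2 (by fun_prop)
  exact hΛ.smooth.comp h.contMDiffOn fun s hs => ⟨ht, hs⟩

theorem tchart_ds {z : ℝ × ℝ} (hz : z ∈ chartDom (E := E) a b ε Λ p) :
    tchart p (ds ε Λ z.1 z.2)
      = (chartMap Λ p z, pd (chartDom (E := E) a b ε Λ p) (0, 1) (chartMap (E := E) Λ p) z) := by
  have hu : UniqueDiffWithinAt ℝ (Ioo (-ε) ε) z.2 := isOpen_Ioo.uniqueDiffOn z.2 hz.1.2
  rw [ds, tchart_velocity ((hΛ.contMDiffOn_slice_snd hz.1.1 z.2 hz.1.2).mdifferentiableWithinAt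
    (by simp)) hu hz.2]
  refine Prod.ext rfl ?_
  exact (hasDerivWithinAt_slice_snd (hΛ.chartDom_mem_nhdsWithin p hz) hz.1.1
    ((hΛ.contDiffOn_chartMap p).differentiableOn (by simp) z hz)).derivWithin hu

include hab

theorem uniqueDiffOn_chartDom : UniqueDiffOn ℝ (chartDom (E := E) a b ε Λ p) := by
  obtain ⟨V, hV, h⟩ := hΛ.exists_chartDom_eq p
  rw [h]
  exact (uniqueDiffOn_stripe hab).inter hV

theorem chartDom_subset_closure_interior :
    chartDom (E := E) a b ε Λ p ⊆ closure (interior (chartDom (E := E) a b ε Λ p)) := by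
  obtain ⟨V, hV, h⟩ := hΛ.exists_chartDom_eq p
  rw [h, interior_inter, hV.interior_eq, inter_comm, inter_comm _ V]
  exact fun z hz => hV.inter_closure ⟨hz.1, stripe_subset_closure_interior hab hz.2⟩

theorem tchart_dt {z : ℝ × ℝ} (hz : z ∈ chartDom (E := E) a b ε Λ p) :
    tchart p (dt a b Λ z.1 z.2)
      = (chartMap Λ p z, pd (chartDom (E := E) a b ε Λ p) (1, 0) (chartMap (E := E) Λ p) z) := by
  have hu : UniqueDiffWithinAt ℝ (Icc a b) z.1 := uniqueDiffOn_Icc hab z.1 hz.1.1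
  rw [dt, tchart_velocity ((hΛ.contMDiffOn_slice_fst hz.1.2 z.1 hz.1.1).mdifferentiableWithinAt
    (by simp)) hu hz.2]
  refine Prod.ext rfl ?_
  exact (hasDerivWithinAt_slice_fst (hΛ.chartDom_mem_nhdsWithin p hz) hz.1.2
    ((hΛ.contDiffOn_chartMap p).differentiableOn (by simp) z hz)).derivWithin hu

theorem mem_dom {z : ℝ × ℝ} (hz : z ∈ chartDom (E := E) a b ε Λ p) :
    (chartMap Λ p z, pd (chartDom (E := E) a b ε Λ p) (1, 0) (chartMap (E := E) Λ p) z)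
      ∈ Φ.dom p := by
  rw [← hΛ.tchart_dt hab p hz]
  exact Φ.tchart_mem_dom (hΛ.admissible z.1 hz.1.1 z.2 hz.1.2) hz.2

variable [FiniteDimensional ℝ E] {Z : ℝ → ℝ → TangentBundle 𝓘(ℝ, E) M} {ζ : ℝ × ℝ → E}
  (hZ : ∀ t ∈ Icc a b, ∀ s ∈ Ioo (-ε) ε, (Z t s).proj = Λ t s)
  (hζ : ∀ z ∈ chartDom (E := E) a b ε Λ p, tchart p (Z z.1 z.2) = (chartMap Λ p z, ζ z))
  (hζs : ContDiffOn ℝ ∞ ζ (chartDom (E := E) a b ε Λ p))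
include hZ hζ hζs

/-- The result again has the form demanded of $Z$ by the hypotheses, so covariant derivatives can be
iterated within one chart. -/
theorem tchart_D_fst {z : ℝ × ℝ} (hz : z ∈ chartDom (E := E) a b ε Λ p) :
    tchart p (Φ.D (Icc a b) (fun t' => dt a b Λ t' z.2) (fun t' => Z t' z.2) z.1)
      = (chartMap Λ p z, covL (Φ.loc p) (chartDom (E := E) a b ε Λ p) (chartMap Λ p) (1, 0) ζ z) :=
    by
  obtain ⟨t, s⟩ := z
  have ht := hz.1.1
  have hs := hz.1.2
  have hT := hΛ.chartDom_mem_nhdsWithin p hz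
  have hproj := hZ t ht s hs
  have hX : ContinuousWithinAt (fun t' => (Z t' s).proj) (Icc a b) t :=
    ((hΛ.contMDiffOn_slice_fst hs).continuousOn t ht).congr (fun t' ht' => hZ t' ht' s hs) hproj
  have hd : HasDerivWithinAt (fun t' => tchart p (Z t' s))
      (pd (chartDom (E := E) a b ε Λ p) (1, 0) (chartMap Λ p) (t, s),
        pd (chartDom (E := E) a b ε Λ p) (1, 0) ζ (t, s)) (Icc a b) t := by
    refine ((hasDerivWithinAt_slice_fst hT hs ((hΛ.contDiffOn_chartMap p).differentiableOn
      (by simp) _ hz)).prodMk (hasDerivWithinAt_slice_fst hT hs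
      (hζs.differentiableOn (by simp) _ hz))).congr_of_eventuallyEq ?_ (hζ _ hz)
    exact (eventually_slice_fst hT hs).mono fun t' ht' => hζ _ ht'
  refine (Φ.tchart_D (V := fun t' => dt a b Λ t' s) (X :=
    fun t' => Z t' s) (uniqueDiffOn_Icc hab t ht) hX
    (hΛ.admissible t ht s hs) hproj.symm (by rw [hproj]; exact hz.2) hd).trans ?_
  simp only
  rw [hζ _ hz, hΛ.tchart_dt hab p hz]
  rfl

theorem tchart_D_snd {z : ℝ × ℝ} (hz : z ∈ chartDom (E := E) a b ε Λ p) :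
    tchart p (Φ.D (Ioo (-ε) ε) (fun s' => dt a b Λ z.1 s') (fun s' => Z z.1 s') z.2)
      = (chartMap Λ p z, covL (Φ.loc p) (chartDom (E := E) a b ε Λ p) (chartMap Λ p) (0, 1) ζ z) :=
    by
  obtain ⟨t, s⟩ := z
  have ht := hz.1.1
  have hs := hz.1.2
  have hT := hΛ.chartDom_mem_nhdsWithin p hz
  have hproj := hZ t ht s hs
  have hX : ContinuousWithinAt (fun s' => (Z t s').proj) (Ioo (-ε) ε) s :=
    ((hΛ.contMDiffOn_slice_snd ht).continuousOn s hs).congr (fun s' hs' => hZ t ht s' hs') hproj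
  have hd : HasDerivWithinAt (fun s' => tchart p (Z t s'))
      (pd (chartDom (E := E) a b ε Λ p) (0, 1) (chartMap Λ p) (t, s),
        pd (chartDom (E := E) a b ε Λ p) (0, 1) ζ (t, s)) (Ioo (-ε) ε) s := by
    refine ((hasDerivWithinAt_slice_snd hT ht ((hΛ.contDiffOn_chartMap p).differentiableOn
      (by simp) _ hz)).prodMk (hasDerivWithinAt_slice_snd hT ht
      (hζs.differentiableOn (by simp) _ hz))).congr_of_eventuallyEq ?_ (hζ _ hz)
    exact (eventually_slice_snd hT ht).mono fun s' hs' => hζ _ hs'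
  refine (Φ.tchart_D (V := fun s' => dt a b Λ t s') (X :=
    fun s' => Z t s') (isOpen_Ioo.uniqueDiffOn s hs) hX
    (hΛ.admissible t ht s hs) hproj.symm (by rw [hproj]; exact hz.2) hd).trans ?_
  simp only
  rw [hζ _ hz, hΛ.tchart_dt hab p hz]
  rfl

theorem curvatureAlong_eq_curvLoc {z : ℝ × ℝ} (hz : z ∈ chartDom (E := E) a b ε Λ p)
    (hzp : Λ z.1 z.2 = p) :
    Φ.curvatureAlong a b ε Λ Z z.1 z.2
      = curvLoc (Φ.loc p) (chartMap Λ p z, pd (chartDom (E := E) a b ε Λ p) (1, 0) (chartMap Λ p) z)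
          (pd (chartDom (E := E) a b ε Λ p) (1, 0) (chartMap Λ p) z)
          (pd (chartDom (E := E) a b ε Λ p) (0, 1) (chartMap Λ p) z)
          (pd (chartDom (E := E) a b ε Λ p) (1, 0)
            (pd (chartDom (E := E) a b ε Λ p) (1, 0) (chartMap Λ p)) z)
          (pd (chartDom (E := E) a b ε Λ p) (1, 0)
            (pd (chartDom (E := E) a b ε Λ p) (0, 1) (chartMap Λ p)) z) (ζ z) := by
  have hT := hΛ.uniqueDiffOn_chartDom hab p
  have hTc := hΛ.chartDom_subset_closure_interior hab p
  have hx := hΛ.contDiffOn_chartMap p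
  have hF := Φ.isLocalMetric p
  have hU : ∀ z ∈ chartDom (E := E) a b ε Λ p, _ := fun z hz => hΛ.mem_dom hab p hz
  have h1 := hΛ.tchart_D_fst hab p
    (Z := fun t s => Φ.D (Ioo (-ε) ε) (fun s' => dt a b Λ t s') (fun s' => Z t s') s)
    (fun t ht s hs => hZ t ht s hs)
    (fun z hz => hΛ.tchart_D_snd hab p hZ hζ hζs hz) (hF.contDiffOn_covL hT hx hU hζs (0, 1)) hz
  have h2 := hΛ.tchart_D_snd hab p
    (Z := fun t s => Φ.D (Icc a b) (fun t' => dt a b Λ t' s) (fun t' => Z t' s) t)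
    (fun t ht s hs => hZ t ht s hs)
    (fun z hz => hΛ.tchart_D_fst hab p hZ hζ hζs hz) (hF.contDiffOn_covL hT hx hU hζs (1, 0)) hz
  have hproj := hZ z.1 hz.1.1 z.2 hz.1.2
  refine (congrArg₂ (· - ·) (vec_eq_of_tchart h1 (hproj.trans hzp))
    (vec_eq_of_tchart h2 (hproj.trans hzp))).trans ?_
  -- The $s$-derivative of the reference field becomes the $t$-derivative of $x_s$, so at $s=0$ only
  -- data along $\gamma$ remain.
  rw [pd_comm hT hTc hx (1, 0) (0, 1) hz]
  exact hF.covL_covL_sub hT hx hU hTc hζs (1, 0) (0, 1) hz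

end PseudoFinslerMetric.IsVariation
end Variations

/-! ### The Jacobi operator and the pointwise second variation. -/

section SecondVariation

attribute [local irreducible] tchart

variable {E : Type*} [NormedAddCommGroup E] [NormedSpace ℝ E]
  {M : Type*} [TopologicalSpace M] [ChartedSpace E M]

theorem velocity_congr {S : Set ℝ} {c c' : ℝ → M} (h : EqOn c c' S) {t : ℝ} (ht : t ∈ S) :
    velocity (E := E) S c t = velocity S c' t := by
  have h1 : c t = c' t := h ht
  have h2 : (mfderivWithin 𝓘(ℝ, ℝ) 𝓘(ℝ, E) c S t : ℝ →L[ℝ] E)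
      = mfderivWithin 𝓘(ℝ, ℝ) 𝓘(ℝ, E) c' S t := mfderivWithin_congr h h1
  have h3 : (mfderivWithin 𝓘(ℝ, ℝ) 𝓘(ℝ, E) c S t : ℝ →L[ℝ] E) 1
      = (mfderivWithin 𝓘(ℝ, ℝ) 𝓘(ℝ, E) c' S t : ℝ →L[ℝ] E) 1 :=
    DFunLike.congr_fun h2 1
  exact congrArg₂ tvec h1 h3

variable [IsManifold 𝓘(ℝ, E) ∞ M] {Φ : PseudoFinslerMetric E M}

/-- The reference field is not differentiated, so its value at $t$ is enough, whereas $X$ is needed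
on all of $S$. It allows $\gamma$ to replace $\Lambda(\cdot,0)$, with which it agrees only on
$[a,b]$. -/
theorem PseudoFinslerMetric.D_congr {S : Set ℝ} {V V' X X' : ℝ → TangentBundle 𝓘(ℝ, E) M} {t : ℝ}
    (hV : V t = V' t) (h : EqOn X X' S) (ht : t ∈ S) : Φ.D S V X t = Φ.D S V' X' t := by
  have h1 : X t = X' t := h ht
  have h2 : (mfderivWithin 𝓘(ℝ, ℝ) 𝓘(ℝ, E × E)
        (fun k => extChartAt 𝓘(ℝ, E).tangent (X t) (X k)) S t : ℝ →L[ℝ] E × E)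
      = mfderivWithin 𝓘(ℝ, ℝ) 𝓘(ℝ, E × E)
        (fun k => extChartAt 𝓘(ℝ, E).tangent (X' t) (X' k)) S t :=
    mfderivWithin_congr (fun k hk => by rw [h1, h hk]) (by rw [h1])
  unfold PseudoFinslerMetric.D PseudoFinslerMetric.covDeriv
  simp only [hV, h1]
  exact congrArg (fun L : ℝ →L[ℝ] E × E => (tvec (X' t).proj
    ((L 1).2 + Φ.chern (V' t) (L 1).1 (vec (X' t))) : TangentBundle 𝓘(ℝ, E) M)) h2

namespace PseudoFinslerMetric.IsVariation

variable {a b ε : ℝ} {γ : ℝ → M} {Λ : ℝ → ℝ → M} (hΛ : Φ.IsVariation a b γ ε Λ)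
include hΛ

theorem dt_zero {t : ℝ} (ht : t ∈ Icc a b) : dt a b Λ t 0 = velocity (E := E) (Icc a b) γ t :=
  velocity_congr (fun t ht => hΛ.base t ht) ht

omit [NormedSpace ℝ E] [IsManifold 𝓘(ℝ, E) ∞ M] hΛ in
theorem mem_chartDom {z : ℝ × ℝ} (hz : z ∈ stripe a b ε) :
    z ∈ chartDom (E := E) a b ε Λ (Λ z.1 z.2) := ⟨hz, mem_chart_source E _⟩

theorem mem_chartDom_zero {t : ℝ} (ht : t ∈ Icc a b) :
    (t, (0 : ℝ)) ∈ chartDom (E := E) a b ε Λ (γ t) := by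
  have h : (t, (0 : ℝ)) ∈ chartDom (E := E) a b ε Λ (Λ t 0) := mem_chartDom ⟨ht, hΛ.zero_mem⟩
  rwa [hΛ.base t ht] at h

omit hΛ in
theorem contMDiffOn_chartDom_of_tchart {Z : ℝ × ℝ → TangentBundle 𝓘(ℝ, E) M}
    (hZ : ∀ z ∈ stripe a b ε, (Z z).proj = Λ z.1 z.2) (p : M)
    (hζ : ContDiffOn ℝ ∞ (fun z => tchart p (Z z)) (chartDom (E := E) a b ε Λ p)) :
    ContMDiffOn 𝓘(ℝ, ℝ × ℝ) 𝓘(ℝ, E).tangent ∞ Z (chartDom (E := E) a b ε Λ p) := by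
  have hsrc : ∀ z ∈ chartDom (E := E) a b ε Λ p, Z z ∈ (tchart (E := E) p).source :=
    fun z hz => by
      rw [mem_tchart_source, hZ z hz.1]
      exact hz.2
  have hmaps : MapsTo (fun z => tchart p (Z z)) (chartDom (E := E) a b ε Λ p)
      (tchart (E := E) p).target := fun z hz => (tchart p).map_source (hsrc z hz)
  have hζ' : ContMDiffOn 𝓘(ℝ, ℝ × ℝ) 𝓘(ℝ, E × E) ∞ (fun z => tchart p (Z z))
      (chartDom (E := E) a b ε Λ p) := contMDiffOn_iff_contDiffOn.2 hζ
  have h0 := contMDiffOn_tchart_symm (E := E) p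
  generalize tchart (E := E) p = e at *
  have h1 : ContMDiffOn 𝓘(ℝ, ℝ × ℝ) 𝓘(ℝ, E).tangent ∞
      (e.symm ∘ fun z => e (Z z)) (chartDom (E := E) a b ε Λ p) :=
    h0.comp hζ' hmaps
  exact h1.congr fun z hz => (e.left_inv (hsrc z hz)).symm

theorem contMDiffOn_of_tchart {Z : ℝ × ℝ → TangentBundle 𝓘(ℝ, E) M}
    (hZ : ∀ z ∈ stripe a b ε, (Z z).proj = Λ z.1 z.2)
    (hζ : ∀ p, ContDiffOn ℝ ∞ (fun z => tchart p (Z z)) (chartDom (E := E) a b ε Λ p)) :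
    ContMDiffOn 𝓘(ℝ, ℝ × ℝ) 𝓘(ℝ, E).tangent ∞ Z (stripe a b ε) := fun z hz =>
  (contMDiffOn_chartDom_of_tchart hZ _ (hζ _) z (mem_chartDom hz)).mono_of_mem_nhdsWithin
    (hΛ.chartDom_mem_nhdsWithin _ (mem_chartDom hz))

variable (hab : a < b)
include hab

theorem contMDiffOn_dt : ContMDiffOn 𝓘(ℝ, ℝ × ℝ) 𝓘(ℝ, E).tangent ∞
    (Function.uncurry (dt (E := E) a b Λ)) (stripe a b ε) :=
  hΛ.contMDiffOn_of_tchart (fun _ _ => rfl) fun p =>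
    ((hΛ.contDiffOn_chartMap p).prodMk (contDiffOn_pd (hΛ.uniqueDiffOn_chartDom hab p)
      (hΛ.contDiffOn_chartMap p) (1, 0))).congr fun _ hz => hΛ.tchart_dt hab p hz

theorem contMDiffOn_ds : ContMDiffOn 𝓘(ℝ, ℝ × ℝ) 𝓘(ℝ, E).tangent ∞
    (Function.uncurry (ds (E := E) ε Λ)) (stripe a b ε) :=
  hΛ.contMDiffOn_of_tchart (fun _ _ => rfl) fun p =>
    ((hΛ.contDiffOn_chartMap p).prodMk (contDiffOn_pd (hΛ.uniqueDiffOn_chartDom hab p)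
      (hΛ.contDiffOn_chartMap p) (0, 1))).congr fun _ hz => hΛ.tchart_ds p hz

/-- The given variation with its own transverse velocity is one of the choices allowed in the
definition of the Jacobi operator for $Z=W$, so its curvature computes that operator. -/
theorem isJacobiExtension_ds {W : ℝ → TangentBundle 𝓘(ℝ, E) M}
    (hW : ∀ t ∈ Icc a b, W t = ds ε Λ t 0) :
    Φ.IsJacobiExtension a b γ W W ε Λ (ds ε Λ) where
  variation := hΛ
  field t ht := (hW t ht).symm
  smooth := hΛ.contMDiffOn_ds hab
  along _ _ _ _ := rfl
  extends_field t ht := (hW t ht).symm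

/-- The Lagrangian along a variation. -/
theorem contDiffOn_lagrangian :
    ContDiffOn ℝ ∞ (fun z : ℝ × ℝ => Φ.L (dt a b Λ z.1 z.2)) (stripe a b ε) := by
  rw [← contMDiffOn_iff_contDiffOn]
  exact Φ.smooth.comp (hΛ.contMDiffOn_dt hab) fun z hz => hΛ.admissible z.1 hz.1 z.2 hz.2

theorem lagrangian_eq (p : M) {z : ℝ × ℝ} (hz : z ∈ chartDom (E := E) a b ε Λ p) :
    Φ.L (dt a b Λ z.1 z.2) = Φ.loc p (chartMap Λ p z,
      pd (chartDom (E := E) a b ε Λ p) (1, 0) (chartMap (E := E) Λ p) z) := by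
  rw [← hΛ.tchart_dt hab p hz, loc, (tchart p).left_inv (mem_tchart_source.2 hz.2)]

theorem pd_stripe_eq {V : Type*} [NormedAddCommGroup V] [NormedSpace ℝ V] (p : M)
    {f : ℝ × ℝ → V} (hf : ContDiffOn ℝ ∞ f (stripe a b ε)) (v : ℝ × ℝ) {z : ℝ × ℝ}
    (hz : z ∈ chartDom (E := E) a b ε Λ p) :
    pd (stripe a b ε) v f z = pd (chartDom (E := E) a b ε Λ p) v f z := by
  rw [pd, pd, fderivWithin_of_mem_nhdsWithin (hΛ.chartDom_mem_nhdsWithin p hz)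
    (uniqueDiffOn_stripe hab z hz.1)
    ((hf.differentiableOn (by simp) z hz.1).mono inter_subset_left)]

theorem pd_pd_lagrangian_eq (p : M) (v w : ℝ × ℝ) {z : ℝ × ℝ}
    (hz : z ∈ chartDom (E := E) a b ε Λ p) :
    pd (stripe a b ε) v (pd (stripe a b ε) w fun z => Φ.L (dt a b Λ z.1 z.2)) z
      = pd (chartDom (E := E) a b ε Λ p) v (pd (chartDom (E := E) a b ε Λ p) w fun z =>
          Φ.loc p (chartMap Λ p z,
            pd (chartDom (E := E) a b ε Λ p) (1, 0) (chartMap (E := E) Λ p) z)) z := by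
  have hf := hΛ.contDiffOn_lagrangian hab
  rw [hΛ.pd_stripe_eq hab p (contDiffOn_pd (uniqueDiffOn_stripe hab) hf w) v hz]
  refine pd_congr (fun z' hz' => ?_) hz v
  rw [hΛ.pd_stripe_eq hab p hf w hz']
  exact pd_congr (fun z'' hz'' => hΛ.lagrangian_eq hab p hz'') hz' w

variable [FiniteDimensional ℝ E]

theorem covL_velocity_eq_zero (hγ : Φ.IsGeodesic a b γ) {t : ℝ} (ht : t ∈ Icc a b) :
    covL (Φ.loc (γ t)) (chartDom (E := E) a b ε Λ (γ t)) (chartMap Λ (γ t)) (1, 0)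
      (pd (chartDom (E := E) a b ε Λ (γ t)) (1, 0) (chartMap Λ (γ t))) (t, 0) = 0 := by
  have hz := hΛ.mem_chartDom_zero ht
  have h1 := hΛ.tchart_D_fst hab (γ t) (Z := dt a b Λ) (fun _ _ _ _ => rfl)
    (fun z hz => hΛ.tchart_dt hab (γ t) hz) (contDiffOn_pd (hΛ.uniqueDiffOn_chartDom hab (γ t))
      (hΛ.contDiffOn_chartMap (γ t)) (1, 0)) hz
  rw [← vec_eq_of_tchart h1 (hΛ.base t ht), ← hγ.parallel t ht]
  exact congrArg vec (D_congr (hΛ.dt_zero ht) (fun t ht => hΛ.dt_zero ht) ht)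

theorem vec_D_variationField {W : ℝ → TangentBundle 𝓘(ℝ, E) M}
    (hW : ∀ t ∈ Icc a b, W t = ds ε Λ t 0) {t : ℝ} (ht : t ∈ Icc a b) :
    vec (Φ.D (Icc a b) (velocity (Icc a b) γ) W t)
      = covL (Φ.loc (γ t)) (chartDom (E := E) a b ε Λ (γ t)) (chartMap Λ (γ t)) (1, 0)
          (pd (chartDom (E := E) a b ε Λ (γ t)) (0, 1) (chartMap Λ (γ t))) (t, 0) := by
  have hz := hΛ.mem_chartDom_zero ht
  have h1 := hΛ.tchart_D_fst hab (γ t) (Z := ds ε Λ) (fun _ _ _ _ => rfl)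
    (fun z hz => hΛ.tchart_ds (γ t) hz) (contDiffOn_pd (hΛ.uniqueDiffOn_chartDom hab (γ t))
      (hΛ.contDiffOn_chartMap (γ t)) (0, 1)) hz
  rw [← vec_eq_of_tchart h1 (hΛ.base t ht)]
  exact congrArg vec (D_congr (hΛ.dt_zero ht).symm (fun t ht => hW t ht) ht)

/-- The transverse acceleration of a variation, paired with the velocity of the base curve. -/
def _root_.PseudoFinsler.PseudoFinslerMetric.transverse (Φ : PseudoFinslerMetric E M)
    (a b ε : ℝ) (Λ : ℝ → ℝ → M) (t : ℝ) : ℝ :=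
  Φ.g (dt a b Λ t 0)
    (vec (Φ.D (Ioo (-ε) ε) (fun s => dt a b Λ t s) (fun s => ds ε Λ t s) 0))
    (vec (dt (E := E) a b Λ t 0))

/-- `transverse` in the chart at `p`. -/
def _root_.PseudoFinsler.PseudoFinslerMetric.transverseLoc (Φ : PseudoFinslerMetric E M)
    (a b ε : ℝ) (Λ : ℝ → ℝ → M) (p : M) (z : ℝ × ℝ) : ℝ :=
  gLoc (Φ.loc p) (chartMap Λ p z) (pd (chartDom (E := E) a b ε Λ p) (1, 0) (chartMap Λ p) z)
    (covL (Φ.loc p) (chartDom (E := E) a b ε Λ p) (chartMap Λ p) (0, 1)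
      (pd (chartDom (E := E) a b ε Λ p) (0, 1) (chartMap Λ p)) z)
    (pd (chartDom (E := E) a b ε Λ p) (1, 0) (chartMap Λ p) z)

theorem transverse_eq (p : M) {t : ℝ} (ht : (t, (0 : ℝ)) ∈ chartDom (E := E) a b ε Λ p) :
    Φ.transverse a b ε Λ t = Φ.transverseLoc a b ε Λ p (t, 0) := by
  have h1 := hΛ.tchart_D_snd hab p (Z := ds ε Λ) (fun _ _ _ _ => rfl)
    (fun z hz => hΛ.tchart_ds p hz) (contDiffOn_pd (hΛ.uniqueDiffOn_chartDom hab p)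
      (hΛ.contDiffOn_chartMap p) (0, 1)) ht
  have h2 := hΛ.tchart_dt hab p ht
  simp only at h1 h2
  refine (Φ.g_eq_of_proj (p := p)
    (a := Φ.D (Ioo (-ε) ε) (fun s => dt a b Λ t s) (fun s => ds ε Λ t s) 0)
    (b := dt a b Λ t 0) (hΛ.admissible t ht.1.1 0 ht.1.2) ht.2 rfl rfl).trans ?_
  rw [h1, h2]
  rfl

theorem contDiffOn_transverseLoc (p : M) :
    ContDiffOn ℝ ∞ (Φ.transverseLoc a b ε Λ p) (chartDom (E := E) a b ε Λ p) := by
  have hT := hΛ.uniqueDiffOn_chartDom hab p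
  have hx := hΛ.contDiffOn_chartMap p
  have hF := Φ.isLocalMetric p
  have hU : ∀ z ∈ chartDom (E := E) a b ε Λ p, _ := fun z hz => hΛ.mem_dom hab p hz
  exact ((hF.contDiffOn_gLoc.comp (hx.prodMk (contDiffOn_pd hT hx (1, 0))) hU).clm_apply
    (hF.contDiffOn_covL hT hx hU (contDiffOn_pd hT hx (0, 1)) (0, 1))).clm_apply
    (contDiffOn_pd hT hx (1, 0))

/-- The definition uses a different preferred chart at each $t$, but near a given $t$ it coincides
with the smooth expression in the one chart at $\gamma(t)$. -/
theorem contDiffOn_transverse : ContDiffOn ℝ ∞ (Φ.transverse a b ε Λ) (Icc a b) := by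
  intro t ht
  have hz := hΛ.mem_chartDom_zero ht
  have hT := hΛ.chartDom_mem_nhdsWithin (γ t) hz
  have hev := eventually_slice_fst hT hΛ.zero_mem
  have h1 : ContDiffWithinAt ℝ ∞ (fun t' : ℝ => Φ.transverseLoc a b ε Λ (γ t) (t', 0))
      (Icc a b ∩ {t' | (t', (0 : ℝ)) ∈ chartDom (E := E) a b ε Λ (γ t)}) t :=
    ContDiffWithinAt.comp (g := Φ.transverseLoc a b ε Λ (γ t)) (f := fun t' : ℝ => (t', (0 : ℝ)))
      (t := chartDom (E := E) a b ε Λ (γ t)) t (hΛ.contDiffOn_transverseLoc hab (γ t) (t, 0) hz)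
      (by fun_prop) fun t' ht' => ht'.2
  have h2 := h1.mono_of_mem_nhdsWithin (inter_mem self_mem_nhdsWithin hev)
  exact h2.congr_of_eventuallyEq (hev.mono fun t' ht' => hΛ.transverse_eq hab (γ t) ht')
    (hΛ.transverse_eq hab (γ t) hz)

theorem derivWithin_transverse {t : ℝ} (ht : t ∈ Icc a b) :
    derivWithin (Φ.transverse a b ε Λ) (Icc a b) t
      = pd (chartDom (E := E) a b ε Λ (γ t)) (1, 0) (Φ.transverseLoc a b ε Λ (γ t)) (t, 0) := by
  have hz := hΛ.mem_chartDom_zero ht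
  have hT := hΛ.chartDom_mem_nhdsWithin (γ t) hz
  have hev := eventually_slice_fst hT hΛ.zero_mem
  exact ((hasDerivWithinAt_slice_fst hT hΛ.zero_mem ((hΛ.contDiffOn_transverseLoc hab
    (γ t)).differentiableOn (by simp) _ hz)).congr_of_eventuallyEq
    (hev.mono fun t' ht' => hΛ.transverse_eq hab (γ t) ht')
    (hΛ.transverse_eq hab (γ t) hz)).derivWithin (uniqueDiffOn_Icc hab t ht)

end PseudoFinslerMetric.IsVariation

namespace PseudoFinslerMetric.IsJacobiExtension

variable [FiniteDimensional ℝ E] {a b ε : ℝ} {γ : ℝ → M} {Λ : ℝ → ℝ → M}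
  {W Z : ℝ → TangentBundle 𝓘(ℝ, E) M} {Zt : ℝ → ℝ → TangentBundle 𝓘(ℝ, E) M}
  (h : Φ.IsJacobiExtension a b γ W Z ε Λ Zt) (hab : a < b)
include h

omit [FiniteDimensional ℝ E] in
theorem contDiffOn_tchart (p : M) :
    ContDiffOn ℝ ∞ (fun z : ℝ × ℝ => tchart p (Zt z.1 z.2)) (chartDom (E := E) a b ε Λ p) := by
  rw [← contMDiffOn_iff_contDiffOn]
  refine ContMDiffOn.comp (g := tchart (E := E) p) (f := Function.uncurry Zt)
    (t := (tchart (E := E) p).source) (contMDiffOn_tchart p)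
    (h.smooth.mono inter_subset_left) fun z hz => ?_
  show Zt z.1 z.2 ∈ (tchart p).source
  rw [mem_tchart_source, h.along z.1 hz.1.1 z.2 hz.1.2]
  exact hz.2

include hab in
/-- The Jacobi operator in the chart at `γ t`, in terms of `γ`, `W` and `Z` only. -/
theorem curvatureAlong_eq {t : ℝ} (ht : t ∈ Icc a b) :
    Φ.curvatureAlong a b ε Λ Zt t 0
      = curvLoc (Φ.loc (γ t)) (tchart (γ t) (velocity (Icc a b) γ t))
          (tchart (γ t) (velocity (Icc a b) γ t)).2 (tchart (γ t) (W t)).2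
          (derivWithin (fun t' => (tchart (γ t) (velocity (Icc a b) γ t')).2) (Icc a b) t)
          (derivWithin (fun t' => (tchart (γ t) (W t')).2) (Icc a b) t)
          (tchart (γ t) (Z t)).2 := by
  have hΛ := h.variation
  have hz := hΛ.mem_chartDom_zero ht
  have hT := hΛ.uniqueDiffOn_chartDom hab (γ t)
  have hx := hΛ.contDiffOn_chartMap (γ t)
  have hn := hΛ.chartDom_mem_nhdsWithin (γ t) hz
  have hev := eventually_slice_fst hn hΛ.zero_mem
  have hu := uniqueDiffOn_Icc hab t ht
  have hdt : ∀ t', (t', (0 : ℝ)) ∈ chartDom (E := E) a b ε Λ (γ t) →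
      tchart (γ t) (velocity (Icc a b) γ t') = (chartMap Λ (γ t) (t', 0),
        pd (chartDom (E := E) a b ε Λ (γ t)) (1, 0) (chartMap Λ (γ t)) (t', 0)) := fun t' ht' => by
    rw [← hΛ.dt_zero ht'.1.1]
    exact hΛ.tchart_dt hab (γ t) ht'
  have hds : ∀ t', (t', (0 : ℝ)) ∈ chartDom (E := E) a b ε Λ (γ t) →
      tchart (γ t) (W t') = (chartMap Λ (γ t) (t', 0),
        pd (chartDom (E := E) a b ε Λ (γ t)) (0, 1) (chartMap Λ (γ t)) (t', 0)) := fun t' ht' => by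
    rw [← h.field t' ht'.1.1]
    exact hΛ.tchart_ds (γ t) ht'
  have hd : ∀ {f : ℝ × ℝ → E}, ContDiffOn ℝ ∞ f (chartDom (E := E) a b ε Λ (γ t)) →
      DifferentiableWithinAt ℝ f (chartDom (E := E) a b ε Λ (γ t)) (t, 0) := fun hf =>
    hf.differentiableOn (by simp) _ hz
  have h1 : derivWithin (fun t' => (tchart (γ t) (velocity (Icc a b) γ t')).2) (Icc a b) t
      = pd (chartDom (E := E) a b ε Λ (γ t)) (1, 0)
        (pd (chartDom (E := E) a b ε Λ (γ t)) (1, 0) (chartMap Λ (γ t))) (t, 0) :=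
    ((hasDerivWithinAt_slice_fst hn hΛ.zero_mem
      (hd (contDiffOn_pd hT hx (1, 0)))).congr_of_eventuallyEq
      (hev.mono fun t' ht' => congrArg Prod.snd (hdt t' ht'))
      (congrArg Prod.snd (hdt t hz))).derivWithin hu
  have h2 : derivWithin (fun t' => (tchart (γ t) (W t')).2) (Icc a b) t
      = pd (chartDom (E := E) a b ε Λ (γ t)) (1, 0)
        (pd (chartDom (E := E) a b ε Λ (γ t)) (0, 1) (chartMap Λ (γ t))) (t, 0) :=
    ((hasDerivWithinAt_slice_fst hn hΛ.zero_mem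
      (hd (contDiffOn_pd hT hx (0, 1)))).congr_of_eventuallyEq
      (hev.mono fun t' ht' => congrArg Prod.snd (hds t' ht'))
      (congrArg Prod.snd (hds t hz))).derivWithin hu
  have hζs : ContDiffOn ℝ ∞ (fun z : ℝ × ℝ => (tchart (γ t) (Zt z.1 z.2)).2)
      (chartDom (E := E) a b ε Λ (γ t)) := by
    exact contDiff_snd.comp_contDiffOn (h.contDiffOn_tchart (γ t))
  have hζ : ∀ z ∈ chartDom (E := E) a b ε Λ (γ t), tchart (γ t) (Zt z.1 z.2)
      = (chartMap Λ (γ t) z, (tchart (γ t) (Zt z.1 z.2)).2) := fun z hz => by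
    refine Prod.ext ?_ rfl
    rw [tchart_apply]
    simp only
    rw [h.along z.1 hz.1.1 z.2 hz.1.2]
    rfl
  rw [h1, h2, hdt t hz, hds t hz, ← h.extends_field t ht]
  exact hΛ.curvatureAlong_eq_curvLoc (z := (t, 0)) hab (γ t) h.along hζ hζs hz (hΛ.base t ht)

include hab in
/-- The Jacobi operator may be computed with any extension. -/
theorem jacobiOp_eq {t : ℝ} (ht : t ∈ Icc a b) :
    Φ.jacobiOp a b γ W Z t = Φ.curvatureAlong a b ε Λ Zt t 0 := by
  have hex : ∃ q : ℝ × (ℝ → ℝ → M) × (ℝ → ℝ → TangentBundle 𝓘(ℝ, E) M),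
      Φ.IsJacobiExtension a b γ W Z q.1 q.2.1 q.2.2 := ⟨(ε, Λ, Zt), h⟩
  -- The extension picked by choice and the given one yield the same chart expression in $\gamma$,
  -- $W$ and $Z$.
  rw [jacobiOp, dif_pos hex, hex.choose_spec.curvatureAlong_eq hab ht, h.curvatureAlong_eq hab ht]

end PseudoFinslerMetric.IsJacobiExtension

/-- For each $t$ the coordinate identity is used in the chart at $\gamma(t)$. There tangent vectors
at $\gamma(t)$ are their own coordinates, so every term is read off without a transition map. -/
theorem PseudoFinslerMetric.IsVariation.second_variation_pointwise [FiniteDimensional ℝ E]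
    {a b ε : ℝ} {γ : ℝ → M} {Λ : ℝ → ℝ → M} (hΛ : Φ.IsVariation a b γ ε Λ) (hab : a < b)
    (hγ : Φ.IsGeodesic a b γ) {W : ℝ → TangentBundle 𝓘(ℝ, E) M}
    (hW : ∀ t ∈ Icc a b, W t = ds ε Λ t 0) {t : ℝ} (ht : t ∈ Icc a b) :
    (1 / 2 : ℝ) * pd (stripe a b ε) (0, 1) (pd (stripe a b ε) (0, 1)
        fun z => Φ.L (dt a b Λ z.1 z.2)) (t, 0)
      = Φ.secondVariationIntegrand a b γ W t
        + derivWithin (Φ.transverse a b ε Λ) (Icc a b) t := by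
  have hz := hΛ.mem_chartDom_zero ht
  have hT := hΛ.uniqueDiffOn_chartDom hab (γ t)
  have hTc := hΛ.chartDom_subset_closure_interior hab (γ t)
  have hx := hΛ.contDiffOn_chartMap (γ t)
  have hF := Φ.isLocalMetric (γ t)
  have hU : ∀ z ∈ chartDom (E := E) a b ε Λ (γ t), _ := fun z hz => hΛ.mem_dom hab (γ t) hz
  have hext := hΛ.isJacobiExtension_ds hab hW
  have hdt : tchart (γ t) (velocity (E := E) (Icc a b) γ t) = (chartMap Λ (γ t) (t, 0),
      pd (chartDom (E := E) a b ε Λ (γ t)) (1, 0) (chartMap Λ (γ t)) (t, 0)) := by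
    rw [← hΛ.dt_zero ht]
    exact hΛ.tchart_dt hab (γ t) hz
  have hvel := vec_eq_of_tchart hdt rfl
  have hg : ∀ u w : E, Φ.g (velocity (Icc a b) γ t) u w
      = gLoc (Φ.loc (γ t)) (chartMap Λ (γ t) (t, 0))
        (pd (chartDom (E := E) a b ε Λ (γ t)) (1, 0) (chartMap Λ (γ t)) (t, 0)) u w := fun u w => by
    have h := Φ.g_eq_of_proj (p := γ t) (v := velocity (Icc a b) γ t) (a := tvec (γ t) u)
      (b := tvec (γ t) w) (hγ.admissible t ht) (mem_chart_source E (γ t)) rfl rfl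
    rw [hdt, tchart_self, tchart_self] at h
    exact h
  rw [hΛ.pd_pd_lagrangian_eq hab (γ t) _ _ hz, hΛ.derivWithin_transverse hab ht,
    hF.second_variation_lagrangian hT hx hU hTc hz (hΛ.covL_velocity_eq_zero hab hγ ht),
    secondVariationIntegrand, hΛ.vec_D_variationField hab hW ht, hext.jacobiOp_eq hab ht,
    hΛ.curvatureAlong_eq_curvLoc (z :=
    (t, 0)) hab (γ t) hext.along (fun z hz => hΛ.tchart_ds (γ t) hz)
      (contDiffOn_pd hT hx (0, 1)) hz (hΛ.base t ht), hg, hg, hvel]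
  rfl

end SecondVariation

/-! ### Differentiation under the integral sign. -/

section ParametricIntegral

variable {a b ε : ℝ} {f : ℝ × ℝ → ℝ}

theorem continuousOn_slice (hf : ContDiffOn ℝ ∞ f (stripe a b ε)) {s : ℝ} (hs : s ∈ Ioo (-ε) ε) :
    ContinuousOn (fun t => f (t, s)) (Icc a b) :=
  hf.continuousOn.comp (by fun_prop) fun _ ht => ⟨ht, hs⟩

theorem intervalIntegrable_slice (hab : a < b) (hf : ContDiffOn ℝ ∞ f (stripe a b ε)) {s : ℝ}
    (hs : s ∈ Ioo (-ε) ε) : IntervalIntegrable (fun t => f (t, s)) MeasureTheory.volume a b :=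
  (continuousOn_slice hf hs).intervalIntegrable_of_Icc hab.le

/-- Differentiation under the integral sign of a smooth function on a closed stripe. -/
theorem hasDerivAt_integral_slice (hab : a < b) (hf : ContDiffOn ℝ ∞ f (stripe a b ε)) {s : ℝ}
    (hs : s ∈ Ioo (-ε) ε) :
    HasDerivAt (fun s' => ∫ t in a..b, f (t, s'))
      (∫ t in a..b, pd (stripe a b ε) (0, 1) f (t, s)) s := by
  have hf' := contDiffOn_pd (uniqueDiffOn_stripe hab) hf (0, 1)
  -- The stripe is open in $s$; shrinking to a closed ball gives a compact rectangle, on which the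
  -- derivative has a constant bound.
  obtain ⟨δ, hδ, hsub⟩ := Metric.nhds_basis_closedBall.mem_iff.1 (isOpen_Ioo.mem_nhds hs)
  obtain ⟨C, hC⟩ := (isCompact_Icc.prod (isCompact_closedBall s δ)).exists_bound_of_continuousOn
    (hf'.continuousOn.mono (prod_mono_right hsub))
  have hI : ∀ t ∈ uIoc a b, t ∈ Icc a b := fun t ht => by
    rw [uIoc_of_le hab.le] at ht
    exact Ioc_subset_Icc_self ht
  refine (intervalIntegral.hasDerivAt_integral_of_dominated_loc_of_deriv_le
    (F := fun s' t => f (t, s')) (F' := fun s' t => pd (stripe a b ε) (0, 1) f (t, s'))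
    (bound := fun _ => C) (Metric.ball_mem_nhds s hδ) ?_ (intervalIntegrable_slice hab hf hs)
    (intervalIntegrable_iff.1 (intervalIntegrable_slice hab hf' hs)).aestronglyMeasurable ?_
    intervalIntegrable_const
    ?_).2
  · filter_upwards [isOpen_Ioo.mem_nhds hs] with s' hs'
    exact (intervalIntegrable_iff.1 (intervalIntegrable_slice hab hf hs')).aestronglyMeasurable
  · exact Eventually.of_forall fun t ht s' hs' =>
      hC (t, s') ⟨hI t ht, Metric.ball_subset_closedBall hs'⟩
  · refine Eventually.of_forall fun t ht s' hs' => ?_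
    have hs'' := hsub (Metric.ball_subset_closedBall hs')
    exact (hasDerivWithinAt_slice_snd self_mem_nhdsWithin (hI t ht)
      (hf.differentiableOn (by simp) _ ⟨hI t ht, hs''⟩)).hasDerivAt (isOpen_Ioo.mem_nhds hs'')

end ParametricIntegral

/-! ### First and second derivatives of the energy. -/

section Energy

variable {E : Type*} [NormedAddCommGroup E] [NormedSpace ℝ E]
  {M : Type*} [TopologicalSpace M] [ChartedSpace E M] [IsManifold 𝓘(ℝ, E) ∞ M]

namespace PseudoFinslerMetric.IsVariation

variable {Φ : PseudoFinslerMetric E M} {a b ε : ℝ} {γ : ℝ → M} {Λ : ℝ → ℝ → M}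
  (hΛ : Φ.IsVariation a b γ ε Λ) (hab : a < b)
include hΛ hab

theorem intervalIntegrable_lagrangian {s : ℝ} (hs : s ∈ Ioo (-ε) ε) :
    IntervalIntegrable (fun t => Φ.L (dt a b Λ t s)) MeasureTheory.volume a b :=
  intervalIntegrable_slice hab (hΛ.contDiffOn_lagrangian hab) hs

theorem hasDerivAt_energy {s : ℝ} (hs : s ∈ Ioo (-ε) ε) :
    HasDerivAt (fun s' => Φ.energy a b (fun t => Λ t s'))
      (1 / 2 * ∫ t in a..b, pd (stripe a b ε) (0, 1) (fun z => Φ.L (dt a b Λ z.1 z.2)) (t, s)) s :=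
  (hasDerivAt_integral_slice hab (hΛ.contDiffOn_lagrangian hab) hs).const_mul _

theorem hasDerivAt_deriv_energy :
    HasDerivAt (deriv (fun s => Φ.energy a b (fun t => Λ t s)))
      (∫ t in a..b, 1 / 2 * pd (stripe a b ε) (0, 1) (pd (stripe a b ε) (0, 1)
        fun z => Φ.L (dt a b Λ z.1 z.2)) (t, 0)) 0 := by
  have hf := contDiffOn_pd (uniqueDiffOn_stripe hab) (hΛ.contDiffOn_lagrangian hab) (0, 1)
  rw [intervalIntegral.integral_const_mul]
  refine ((hasDerivAt_integral_slice hab hf hΛ.zero_mem).const_mul (1 / 2)).congr_of_eventuallyEq ?_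
  -- Outside $(-\varepsilon,\varepsilon)$ nothing is known about the energy, but the derivative at
  -- $0$ of its derivative depends only on values near $0$.
  filter_upwards [isOpen_Ioo.mem_nhds hΛ.zero_mem] with s hs
  exact (hΛ.hasDerivAt_energy hab hs).deriv

variable [FiniteDimensional ℝ E] (hγ : Φ.IsGeodesic a b γ) {W : ℝ → TangentBundle 𝓘(ℝ, E) M}
  (hW : ∀ t ∈ Icc a b, W t = ds ε Λ t 0)
include hγ hW

/-- The Jacobi operator, being defined by choice at varying base points, is not examined directly:
the integrand is a difference of two functions already known to be continuous. -/
theorem intervalIntegrable_secondVariationIntegrand :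
    IntervalIntegrable (Φ.secondVariationIntegrand a b γ W) MeasureTheory.volume a b := by
  have hf := contDiffOn_pd (uniqueDiffOn_stripe hab) (contDiffOn_pd (uniqueDiffOn_stripe hab)
    (hΛ.contDiffOn_lagrangian hab) (0, 1)) (0, 1)
  have hd := (hΛ.contDiffOn_transverse hab).continuousOn_derivWithin (uniqueDiffOn_Icc hab)
    (by simp)
  refine ContinuousOn.intervalIntegrable_of_Icc hab.le ?_
  refine (((continuousOn_slice hf hΛ.zero_mem).const_mul (1 / 2)).sub hd).congr fun t ht => ?_
  rw [Pi.sub_apply, hΛ.second_variation_pointwise hab hγ hW ht, add_sub_cancel_right]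

/-- The second variation formula, with the boundary term in terms of the variation. -/
theorem hasDerivAt_deriv_energy_transverse :
    HasDerivAt (deriv (fun s => Φ.energy a b (fun t => Λ t s)))
      ((∫ t in a..b, Φ.secondVariationIntegrand a b γ W t)
        + Φ.transverse a b ε Λ b - Φ.transverse a b ε Λ a) 0 := by
  have hc := hΛ.contDiffOn_transverse hab
  have hd := hc.continuousOn_derivWithin (uniqueDiffOn_Icc hab) (by simp)
  -- The boundary terms are turned back into the integral of the derivative of `transverse`, so that
  -- the pointwise identity can be compared under one integral.
  rw [add_sub_assoc, ← intervalIntegral.integral_derivWithin_Icc_of_contDiffOn_Icc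
    (hc.of_le (by simp)) hab.le, ← intervalIntegral.integral_add
    (hΛ.intervalIntegrable_secondVariationIntegrand hab hγ hW)
    (hd.intervalIntegrable_of_Icc hab.le)]
  convert hΛ.hasDerivAt_deriv_energy hab using 1
  refine intervalIntegral.integral_congr fun t ht => ?_
  rw [uIcc_of_le hab.le] at ht
  exact (hΛ.second_variation_pointwise hab hγ hW ht).symm

end PseudoFinslerMetric.IsVariation
end Energy

/-! ### Orthogonal decomposition with respect to an indefinite form. -/

section NormalPart

variable {E : Type*} [NormedAddCommGroup E] [NormedSpace ℝ E] [FiniteDimensional ℝ E]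

/-- Nondegeneracy on $T$ makes $T\to T^*$ injective, hence onto by dimension. The functional
$B(v,\cdot)|_T$ is then represented by some $u\in T$, and $\nu=v-u$. -/
theorem exists_normalPart {B : E →L[ℝ] E →L[ℝ] ℝ} {T : Submodule ℝ E}
    (hB : ∀ u ∈ T, (∀ w ∈ T, B u w = 0) → u = 0) (v : E) :
    ∃ ν : E, (∀ w ∈ T, B ν w = 0) ∧ v - ν ∈ T := by
  let f : E →ₗ[ℝ] Module.Dual ℝ T :=
    { toFun := fun u => (B u).toLinearMap ∘ₗ T.subtype
      map_add' := fun u u' => by ext; simp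
      map_smul' := fun c u => by ext; simp }
  have hinj : Function.Injective (f ∘ₗ T.subtype) := by
    rw [← LinearMap.ker_eq_bot, LinearMap.ker_eq_bot']
    intro u hu
    exact Subtype.ext (hB u u.2 fun w hw => LinearMap.congr_fun hu ⟨w, hw⟩)
  obtain ⟨u, hu⟩ := (LinearMap.injective_iff_surjective_of_finrank_eq_finrank
    Subspace.dual_finrank_eq.symm).1 hinj (f v)
  refine ⟨v - u, fun w hw => ?_, by simp⟩
  have h : B u w = B v w := LinearMap.congr_fun hu ⟨w, hw⟩
  rw [map_sub, sub_apply, h, sub_self]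

theorem sub_normalPart_mem {B : E →L[ℝ] E →L[ℝ] ℝ} {T : Submodule ℝ E}
    (hB : ∀ u ∈ T, (∀ w ∈ T, B u w = 0) → u = 0) (v : E) : v - normalPart B T v ∈ T := by
  have h := exists_normalPart hB v
  rw [normalPart, dif_pos h]
  exact h.choose_spec.2

end NormalPart

/-! ### Submanifolds in charts and the acceleration of curves in them. -/

section Inclusion

variable {E : Type*} [NormedAddCommGroup E] [NormedSpace ℝ E]
  {M : Type*} [TopologicalSpace M] [ChartedSpace E M]
  {EP : Type*} [NormedAddCommGroup EP] [NormedSpace ℝ EP] {P : Set M} [ChartedSpace EP P]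

/-- The inclusion of `P` into `M` in the preferred charts at `p`. -/
def inclLoc (p : P) : EP → E :=
  extChartAt 𝓘(ℝ, E) (p : M) ∘ Subtype.val ∘ (extChartAt 𝓘(ℝ, EP) p).symm

theorem inclLoc_extChartAt (p : P) {q : P} (hq : q ∈ (chartAt EP p).source) :
    inclLoc p (extChartAt 𝓘(ℝ, EP) p q) = extChartAt 𝓘(ℝ, E) (p : M) q := by
  rw [inclLoc, Function.comp_apply, Function.comp_apply, (extChartAt 𝓘(ℝ, EP) p).left_inv]
  rwa [extChartAt_source]

variable [IsManifold 𝓘(ℝ, E) ∞ M] [IsManifold 𝓘(ℝ, EP) ∞ P]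

section

variable (hi : ContMDiff 𝓘(ℝ, EP) 𝓘(ℝ, E) ∞ (Subtype.val : P → M)) (p : P)
include hi

theorem contDiffAt_inclLoc {q : P} (hq : q ∈ (chartAt EP p).source)
    (hq' : (q : M) ∈ (chartAt E (p : M)).source) :
    ContDiffAt ℝ ∞ (inclLoc (E := E) p) (extChartAt 𝓘(ℝ, EP) p q) := by
  rw [← contMDiffAt_iff_contDiffAt]
  have hq1 : q ∈ (extChartAt 𝓘(ℝ, EP) p).source := by rwa [extChartAt_source]
  have h1 : (extChartAt 𝓘(ℝ, EP) p).symm (extChartAt 𝓘(ℝ, EP) p q) = q :=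
    (extChartAt 𝓘(ℝ, EP) p).left_inv hq1
  have h2 : ContMDiffAt 𝓘(ℝ, EP) 𝓘(ℝ, EP) ∞ (extChartAt 𝓘(ℝ, EP) p).symm
      (extChartAt 𝓘(ℝ, EP) p q) :=
    (contMDiffOn_extChartAt_symm p).contMDiffAt
      ((isOpen_extChartAt_target p).mem_nhds ((extChartAt 𝓘(ℝ, EP) p).map_source hq1))
  have h3 : ContMDiffAt 𝓘(ℝ, EP) 𝓘(ℝ, E) ∞ (Subtype.val ∘ (extChartAt 𝓘(ℝ, EP) p).symm)
      (extChartAt 𝓘(ℝ, EP) p q) := hi.contMDiffAt.comp _ h2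
  refine ContMDiffAt.comp _ (contMDiffAt_extChartAt' ?_) h3
  rw [Function.comp_apply, h1]
  exact hq'

/-- The differential of the inclusion in charts. -/
theorem tchart_inclDeriv {q : P} (hq : q ∈ (chartAt EP p).source)
    (hq' : (q : M) ∈ (chartAt E (p : M)).source) (v : EP) :
    tchart (E := E) (p : M) (tvec (q : M) (inclDeriv EP q v))
      = (inclLoc p (extChartAt 𝓘(ℝ, EP) p q),
        fderiv ℝ (inclLoc (E := E) p) (extChartAt 𝓘(ℝ, EP) p q) (tchart p (tvec q v)).2) := by
  have h1 := (hasMFDerivAt_extChartAt (I := 𝓘(ℝ, E)) hq').comp q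
    (hi.mdifferentiableAt (by simp) (x := q)).hasMFDerivAt
  have h2 := ((contDiffAt_inclLoc hi p hq hq').differentiableAt
    (by simp)).hasFDerivAt.hasMFDerivAt.comp q (hasMFDerivAt_extChartAt (I := 𝓘(ℝ, EP)) hq)
  rw [mfderiv_chartAt_eq_tangentCoordChange hq'] at h1
  rw [mfderiv_chartAt_eq_tangentCoordChange hq] at h2
  have h3 : inclLoc p ∘ extChartAt 𝓘(ℝ, EP) p =ᶠ[𝓝 q]
      extChartAt 𝓘(ℝ, E) (p : M) ∘ (Subtype.val : P → M) :=
    eventually_of_mem ((chartAt EP p).open_source.mem_nhds hq) fun q' hq' =>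
      inclLoc_extChartAt p hq'
  have h4 := hasMFDerivAt_unique h1 (h2.congr_of_eventuallyEq h3.symm)
  rw [tchart_apply, tchart_apply]
  refine Prod.ext (inclLoc_extChartAt p hq).symm ?_
  exact DFunLike.congr_fun h4 v

omit [IsManifold 𝓘(ℝ, E) ∞ M] [IsManifold 𝓘(ℝ, EP) ∞ P] in
theorem velocity_val {S : Set ℝ} {c : ℝ → P} {t : ℝ}
    (hc : MDifferentiableWithinAt 𝓘(ℝ, ℝ) 𝓘(ℝ, EP) c S t) (hu : UniqueDiffWithinAt ℝ S t) :
    velocity (E := E) S (fun s => (c s : M)) t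
      = tvec (c t : M) (inclDeriv EP (c t) (vec (velocity (E := EP) S c t) : EP)) := by
  have h := ((hi.mdifferentiableAt (by simp) (x := c t)).hasMFDerivAt.comp_hasMFDerivWithinAt t
    hc.hasMFDerivWithinAt).mfderivWithin hu.uniqueMDiffWithinAt
  rw [velocity]
  exact congrArg (tvec (c t : M)) (DFunLike.congr_fun h (1 : ℝ))

end

omit [IsManifold 𝓘(ℝ, E) ∞ M] in
-- The extension is taken through the trivialisation at $p$, so its components in that chart are
-- constant and contribute no derivative later.
theorem tchart_extend {p q : P} (hq : q ∈ (chartAt EP p).source) (w : TangentSpace 𝓘(ℝ, EP) p) :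
    tchart (E := EP) p (tvec q (FiberBundle.extend EP w q : TangentSpace 𝓘(ℝ, EP) q))
      = (extChartAt 𝓘(ℝ, EP) p q, w) := by
  refine Prod.ext rfl ?_
  have h1 : (trivializationAt EP (TangentSpace 𝓘(ℝ, EP)) p
      ⟨q, FiberBundle.extend EP w q⟩).2
      = (trivializationAt EP (TangentSpace 𝓘(ℝ, EP)) p ⟨p, w⟩).2 := by
    have hq' : q ∈ (trivializationAt EP (TangentSpace 𝓘(ℝ, EP)) p).baseSet := hq
    rw [FiberBundle.extend, Trivialization.apply_mk_symm _ hq']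
  refine h1.trans ?_
  exact congrArg Prod.snd (tchart_self (E := EP) p w)

omit [IsManifold 𝓘(ℝ, E) ∞ M] [IsManifold 𝓘(ℝ, EP) ∞ P] in
-- The embedding gives continuity into the topology of $P$; given continuity, the immersion gives
-- smoothness.
theorem contMDiffAt_of_val {n : WithTop ℕ∞}
    (hP : IsSmoothEmbedding 𝓘(ℝ, EP) 𝓘(ℝ, E) n (Subtype.val : P → M)) {c : ℝ → P} {t : ℝ}
    (hc : ContMDiffAt 𝓘(ℝ, ℝ) 𝓘(ℝ, E) n (fun s => (c s : M)) t) :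
    ContMDiffAt 𝓘(ℝ, ℝ) 𝓘(ℝ, EP) n c t :=
  (ContMDiffAt.iff_comp_isImmersionAt (hP.isImmersion.isImmersionAt (c t))).2
    ⟨hP.isEmbedding.continuousAt_iff.2 hc.continuousAt, hc⟩

omit [IsManifold 𝓘(ℝ, E) ∞ M] [IsManifold 𝓘(ℝ, EP) ∞ P] in
-- In charts adapted to the immersion, discarding the complementary component is a smooth local left
-- inverse of the inclusion, and its differential is a left inverse of `inclDeriv`.
theorem inclDeriv_injective
    (hP : IsSmoothEmbedding 𝓘(ℝ, EP) 𝓘(ℝ, E) ∞ (Subtype.val : P → M)) (p : P) :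
    Function.Injective (inclDeriv (E := E) EP p) := by
  have h := hP.isImmersion.isImmersionAt p
  have h1 := contMDiffAt_of_mem_maximalAtlas h.codChart_mem_maximalAtlas h.mem_codChart_source
  have h2 := contMDiffAt_symm_of_mem_maximalAtlas h.domChart_mem_maximalAtlas
    (h.domChart.map_source h.mem_domChart_source)
  have hw : ∀ q ∈ h.domChart.source, (h.equiv.symm (h.codChart q)).1 = h.domChart q :=
    fun q hq => by
      have h3 : (h.codChart.extend 𝓘(ℝ, E) ∘ Subtype.val ∘ (h.domChart.extend 𝓘(ℝ, EP)).symm)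
          (h.domChart q) = (h.equiv ∘ (·, 0)) (h.domChart q) :=
        h.writtenInCharts (by simpa using h.domChart.map_source hq)
      simp only [OpenPartialHomeomorph.extend_coe, OpenPartialHomeomorph.extend_coe_symm,
        modelWithCornersSelf_coe, modelWithCornersSelf_coe_symm, Function.comp_apply, id,
        h.domChart.left_inv hq] at h3
      rw [h3, ContinuousLinearEquiv.symm_apply_apply]
  let r : E → EP := fun y => (h.equiv.symm y).1
  have hr : ContMDiff 𝓘(ℝ, E) 𝓘(ℝ, EP) ∞ r :=
    contMDiff_iff_contDiff.2 (contDiff_fst.comp h.equiv.symm.contDiff)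
  have hg : ContMDiffAt 𝓘(ℝ, E) 𝓘(ℝ, EP) ∞ (h.domChart.symm ∘ r ∘ h.codChart) (p : M) := by
    refine ContMDiffAt.comp _ ?_ (hr.contMDiffAt.comp _ h1)
    rw [Function.comp_apply, show r (h.codChart p) = h.domChart p from hw p h.mem_domChart_source]
    exact h2
  have h3 := (hg.mdifferentiableAt (by simp)).hasMFDerivAt.comp p
    (h.contMDiffAt.mdifferentiableAt (by simp)).hasMFDerivAt
  have h4 : id =ᶠ[𝓝 p] (h.domChart.symm ∘ r ∘ h.codChart) ∘ (Subtype.val : P → M) :=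
    eventually_of_mem (h.domChart.open_source.mem_nhds h.mem_domChart_source) fun q hq => by
      simp only [Function.comp_apply, id]
      rw [show r (h.codChart q) = h.domChart q from hw q hq, h.domChart.left_inv hq]
  have h5 := hasMFDerivAt_unique (hasMFDerivAt_id p) (h3.congr_of_eventuallyEq h4)
  exact Function.LeftInverse.injective fun v => (DFunLike.congr_fun h5 v).symm

attribute [local irreducible] tchart

theorem PseudoFinslerMetric.chern_eq_of_proj (Φ : PseudoFinslerMetric E M)
    {v : TangentBundle 𝓘(ℝ, E) M} {p : M} (hv : v.proj = p) (X Y : E) :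
    Φ.chern v X Y = chernCLM (Φ.loc p) (tchart p v) X Y := by
  subst hv
  exact Φ.chern_eq v X Y

/-- The extension of a tangent vector of `P` to a local vector field on `P`, as a vector field
of `M` along `P`. -/
def extendField (p : P) (w : EP) (q : P) : TangentBundle 𝓘(ℝ, E) M :=
  tvec (q : M) (inclDeriv EP q
    (FiberBundle.extend (E := (TangentSpace 𝓘(ℝ, EP) : P → Type _)) (x := p) EP w q))

omit [IsManifold 𝓘(ℝ, E) ∞ M] in
theorem extendField_self (p : P) (w : EP) :
    extendField (E := E) p w p = tvec (p : M) (inclDeriv EP p w) :=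
  congrArg (fun v : EP => (tvec (p : M) (inclDeriv EP p v) : TangentBundle 𝓘(ℝ, E) M))
    (FiberBundle.extend_apply_self (E := (TangentSpace 𝓘(ℝ, EP) : P → Type _)) (x := p) EP w)

variable (hi : ContMDiff 𝓘(ℝ, EP) 𝓘(ℝ, E) ∞ (Subtype.val : P → M))
include hi

theorem inclDeriv_eq (p : P) (v : EP) :
    inclDeriv (E := E) EP p v = fderiv ℝ (inclLoc p) (extChartAt 𝓘(ℝ, EP) p p) v := by
  have h := tchart_inclDeriv hi p (mem_chart_source EP p) (mem_chart_source E (p : M)) v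
  rw [tchart_self, tchart_self] at h
  exact congrArg Prod.snd h

variable (Φ : PseudoFinslerMetric E M)

/-- The covariant derivative on `P` of a coordinate field of `P`, in charts. -/
theorem covDeriv_extend {N : TangentBundle 𝓘(ℝ, E) M} {p : P} (hN : N.proj = p) (u w : EP) :
    Φ.covDeriv N (extendField p w) univ p u
      = fderiv ℝ (fderiv ℝ (inclLoc (E := E) p)) (extChartAt 𝓘(ℝ, EP) p p) u w
        + chernCLM (Φ.loc (p : M)) (tchart (p : M) N)
          (fderiv ℝ (inclLoc p) (extChartAt 𝓘(ℝ, EP) p p) u)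
          (fderiv ℝ (inclLoc p) (extChartAt 𝓘(ℝ, EP) p p) w) := by
  set y := extChartAt 𝓘(ℝ, EP) p p with hy
  have hι := contDiffAt_inclLoc hi p (mem_chart_source EP p) (mem_chart_source E (p : M))
  have hι1 : HasFDerivAt (inclLoc (E := E) p) (fderiv ℝ (inclLoc p) y) y :=
    (hι.differentiableAt (by simp)).hasFDerivAt
  have hι2 : HasFDerivAt (fderiv ℝ (inclLoc (E := E) p)) (fderiv ℝ (fderiv ℝ (inclLoc p)) y) y :=
    ((hι.fderiv_right (m := ∞) (by simp)).differentiableAt (by simp)).hasFDerivAt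
  have hev : ∀ᶠ q in 𝓝 p, tchart (p : M) (extendField (E := E) p w q)
      = (inclLoc p (extChartAt 𝓘(ℝ, EP) p q),
        fderiv ℝ (inclLoc (E := E) p) (extChartAt 𝓘(ℝ, EP) p q) w) := by
    have h1 := (chartAt EP p).open_source.mem_nhds (mem_chart_source EP p)
    have h2 := (continuous_subtype_val (p := (· ∈ P))).continuousAt
      ((chartAt E (p : M)).open_source.mem_nhds (mem_chart_source E (p : M)))
    filter_upwards [h1, h2] with q h1 h2
    exact (tchart_inclDeriv hi p h1 h2 _).trans (Prod.ext rfl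
      (congrArg (fderiv ℝ (inclLoc (E := E) p) (extChartAt 𝓘(ℝ, EP) p q))
        (congrArg Prod.snd (tchart_extend h1 w))))
  have h1 := (hι1.prodMk (hι2.clm_apply (hasFDerivAt_const w y))).hasMFDerivAt.comp p
    (hasMFDerivAt_extChartAt (I := 𝓘(ℝ, EP)) (mem_chart_source EP p))
  rw [mfderiv_chartAt_eq_tangentCoordChange (mem_chart_source EP p)] at h1
  have h2 : (mfderivWithin 𝓘(ℝ, EP) 𝓘(ℝ, E × E) (fun q =>
      extChartAt 𝓘(ℝ, E).tangent (extendField (E := E) p w p) (extendField p w q)) univ p u : E × E)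
      = (fderiv ℝ (inclLoc p) y u, fderiv ℝ (fderiv ℝ (inclLoc p)) y u w) := by
    rw [mfderivWithin_univ, extChartAt_tangent_eq, extendField_self]
    change (mfderiv 𝓘(ℝ, EP) 𝓘(ℝ, E × E) (fun q => tchart (p : M) (extendField (E :=
    E) p w q)) p u : E × E) = _
    rw [(h1.congr_of_eventuallyEq hev).mfderiv]
    have h3 : tangentCoordChange 𝓘(ℝ, EP) p p p u = u :=
      tangentCoordChange_self (mem_extChartAt_source p)
    refine (congrArg ((fderiv ℝ (inclLoc (E := E) p) y).prod (fderiv ℝ (inclLoc (E := E) p) y ∘L 0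
      + (fderiv ℝ (fderiv ℝ (inclLoc p)) y).flip w)) h3).trans ?_
    simp
  have h3 : (vec (extendField (E := E) p w p)) = fderiv ℝ (inclLoc p) y w := by
    rw [extendField_self]
    exact inclDeriv_eq hi p w
  refine (congrArg (fun h : E × E => h.2 + Φ.chern N h.1 (vec (extendField (E := E) p w p)))
    h2).trans ?_
  rw [h3, Φ.chern_eq_of_proj hN]

/-- The acceleration of a curve in `P` differs from the covariant derivative on `P` of an
extension of its velocity by a vector tangent to `P`. -/
theorem exists_vec_D_velocity_eq [FiniteDimensional ℝ E] {c : ℝ → P} {S : Set ℝ} {t : ℝ} {p : P}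
    (hp : c t = p) (hS : IsOpen S) (ht : t ∈ S)
    (hc : ContMDiffOn 𝓘(ℝ, ℝ) 𝓘(ℝ, EP) ∞ c S) {V : ℝ → TangentBundle 𝓘(ℝ, E) M}
    (hV : V t ∈ Φ.A) (hVc : (V t).proj = p) :
    ∃ τ ∈ tangentSub (E := E) EP p,
      vec (Φ.D S V (fun s => velocity S (fun s' => (c s' : M)) s) t)
        = Φ.covDeriv (V t) (extendField p (vec (velocity (E := EP) S c t))) univ p
            (vec (velocity (E := EP) S c t) : EP) + τ := by
  subst hp
  set p := c t with hp
  set x : ℝ → EP := extChartAt 𝓘(ℝ, EP) p ∘ c with hx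
  have hct : ContMDiffAt 𝓘(ℝ, ℝ) 𝓘(ℝ, EP) ∞ c t := hc.contMDiffAt (hS.mem_nhds ht)
  have hxt : ContDiffAt ℝ ∞ x t := by
    rw [← contMDiffAt_iff_contDiffAt]
    exact (contMDiffAt_extChartAt' (mem_chart_source EP p)).comp t hct
  have hx1 : DifferentiableAt ℝ x t := hxt.differentiableAt (by simp)
  have hx2 : DifferentiableAt ℝ (deriv x) t :=
    (hxt.derivWithin (m := ∞) (by simp)).differentiableAt (by simp)
  have hι := contDiffAt_inclLoc hi p (mem_chart_source EP p) (mem_chart_source E (p : M))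
  have hι1 : HasFDerivAt (inclLoc (E := E) p) _ (x t) :=
    (hι.differentiableAt (by simp)).hasFDerivAt
  have hι2 : HasFDerivAt (fderiv ℝ (inclLoc (E := E) p)) _ (x t) :=
    ((hι.fderiv_right (m := ∞) (by simp)).differentiableAt (by simp)).hasFDerivAt
  have hev : ∀ᶠ s in 𝓝 t, tchart (p : M) (velocity S (fun s' => (c s' : M)) s)
      = (inclLoc p (x s), fderiv ℝ (inclLoc (E := E) p) (x s) (deriv x s)) := by
    have h1 := hct.continuousAt ((chartAt EP p).open_source.mem_nhds (mem_chart_source EP p))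
    have h2 := (continuous_subtype_val.continuousAt.comp hct.continuousAt)
      ((chartAt E (p : M)).open_source.mem_nhds (mem_chart_source E (p : M)))
    filter_upwards [hS.mem_nhds ht, h1, h2] with s hs h1 h2
    have hcs := (hc s hs).mdifferentiableWithinAt (by simp)
    have hu := hS.uniqueDiffWithinAt (𝕜 := ℝ) hs
    rw [velocity_val hi hcs hu, tchart_inclDeriv hi p h1 h2]
    have h3 := tchart_velocity hcs hu h1
    rw [derivWithin_of_isOpen hS hs] at h3
    exact Prod.ext rfl (congrArg (fderiv ℝ (inclLoc (E := E) p) (x s)) (congrArg Prod.snd h3))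
  have hw : vec (velocity (E := EP) S c t) = deriv x t := by
    have h3 := tchart_velocity ((hc t ht).mdifferentiableWithinAt (by simp))
      (hS.uniqueDiffWithinAt (𝕜 := ℝ) ht) (mem_chart_source EP p)
    rw [derivWithin_of_isOpen hS ht] at h3
    exact vec_eq_of_tchart h3 rfl
  -- With $\iota$ the inclusion in charts, $(\iota\circ x)''=D^2\iota(x',x')+D\iota(x'')$. The first
  -- summand with the Christoffel term is the covariant derivative of the constant-coefficient
  -- extension; the second is the tangent vector $\tau$.
  have hd : HasDerivWithinAt (fun s => tchart (p : M) (velocity S (fun s' => (c s' : M)) s))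
      (fderiv ℝ (inclLoc (E := E) p) (x t) (deriv x t),
        fderiv ℝ (fderiv ℝ (inclLoc (E := E) p)) (x t) (deriv x t) (deriv x t)
          + fderiv ℝ (inclLoc (E := E) p) (x t) (deriv (deriv x) t)) S t := by
    refine HasDerivAt.hasDerivWithinAt (HasDerivAt.congr_of_eventuallyEq ?_ hev)
    exact (hι1.comp_hasDerivAt t hx1.hasDerivAt).prodMk
      ((hι2.comp_hasDerivAt t hx1.hasDerivAt).clm_apply hx2.hasDerivAt)
  have hD := Φ.tchart_D (V := V) (hS.uniqueDiffWithinAt ht)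
    (continuous_subtype_val.continuousAt.comp hct.continuousAt).continuousWithinAt hV hVc
    (mem_chart_source E (p : M)) hd
  refine ⟨inclDeriv EP p (deriv (deriv x) t : EP), LinearMap.mem_range_self _ _, ?_⟩
  rw [vec_eq_of_tchart hD rfl, hev.self_of_nhds, hw, covDeriv_extend hi Φ hVc, inclDeriv_eq hi]
  simp only
  rw [hx, Function.comp_apply, ← hp]
  abel

end Inclusion

/-! ### Boundary terms and the second fundamental form. -/

section Endpoint

variable {E : Type*} [NormedAddCommGroup E] [NormedSpace ℝ E]
  {M : Type*} [TopologicalSpace M] [ChartedSpace E M] [IsManifold 𝓘(ℝ, E) ∞ M]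
  {Φ : PseudoFinslerMetric E M}
  {EP : Type*} [NormedAddCommGroup EP] [NormedSpace ℝ EP] {P : Set M} [ChartedSpace EP P]
  [IsManifold 𝓘(ℝ, EP) ∞ P]

namespace PseudoFinslerMetric

theorem g_symm {v : TangentBundle 𝓘(ℝ, E) M} (hv : v ∈ Φ.A) (u w : E) :
    Φ.g v u w = Φ.g v w u := by
  have hp := mem_chart_source E v.proj
  rw [Φ.g_eq hv hp, Φ.g_eq hv hp]
  exact (Φ.isLocalMetric v.proj).gLoc_symm (Φ.tchart_mem_dom hv hp) _ _

/-- Injectivity of the differential makes the `Function.invFun` in the definition return the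
intrinsic vectors $u,w$. -/
theorem secondFundAt_inclDeriv
    (hP : IsSmoothEmbedding 𝓘(ℝ, EP) 𝓘(ℝ, E) ∞ (Subtype.val : P → M))
    (N : TangentBundle 𝓘(ℝ, E) M) (p : P) (u w : EP) :
    Φ.secondFundAt EP N p (inclDeriv EP p u) (inclDeriv EP p w)
      = normalPart (Φ.g N) (tangentSub EP p) (Φ.covDeriv N (extendField p w) univ p u) := by
  have h := Function.leftInverse_invFun (inclDeriv_injective (E := E) hP p)
  have h1 := (FiberBundle.extend_apply_self (E := (TangentSpace 𝓘(ℝ, EP) : P → Type _)) (x := p) EP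
    (Function.invFun (inclDeriv (E := E) EP p) (inclDeriv EP p u))).trans (h u)
  refine congrArg (normalPart (Φ.g N) (tangentSub EP p)) ?_
  exact congrArg₂ (fun a b : EP => Φ.covDeriv N (extendField p b) univ p a) h1 (h w)

omit [IsManifold 𝓘(ℝ, EP) ∞ P] in
-- Since $N$ is orthogonal to $T_pP$, pairing with $N$ sees vectors only modulo $T_pP$, and $v'$,
-- $v$ and the normal part of $v$ share a class.
theorem g_normalPart {N : TangentBundle 𝓘(ℝ, E) M} [FiniteDimensional ℝ E] {p : P} (hN : N ∈ Φ.A)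
    (ho : Φ.IsOrthogonalTo EP N p) (hnd : Φ.NondegenerateOn EP N p) {v v' : E}
    (hv : v' - v ∈ tangentSub (E := E) EP p) :
    Φ.g N (normalPart (Φ.g N) (tangentSub EP p) v) (vec N) = Φ.g N v' (vec N) := by
  have h1 := ho _ ((tangentSub (E := E) EP p).add_mem hv (sub_normalPart_mem hnd v))
  rw [sub_add_sub_cancel, Φ.g_symm hN, map_sub, sub_apply, sub_eq_zero] at h1
  exact h1.symm

theorem IsVariation.endpoint [FiniteDimensional ℝ E] {a b ε : ℝ} {γ : ℝ → M} {Λ : ℝ → ℝ → M}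
    (hΛ : Φ.IsVariation a b γ ε Λ)
    (hP : IsSmoothEmbedding 𝓘(ℝ, EP) 𝓘(ℝ, E) ∞ (Subtype.val : P → M)) {t : ℝ} (ht : t ∈ Icc a b)
    (hmem : ∀ s ∈ Ioo (-ε) ε, Λ t s ∈ P) (hp : γ t ∈ P)
    (ho : Φ.IsOrthogonalTo EP (velocity (Icc a b) γ t) (⟨γ t, hp⟩ : P))
    (hnd : Φ.NondegenerateOn EP (velocity (Icc a b) γ t) (⟨γ t, hp⟩ : P)) {w : E}
    (hw : w = vec (ds (E := E) ε Λ t 0)) :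
    w ∈ tangentSub (E := E) EP (⟨γ t, hp⟩ : P) ∧
      Φ.g (velocity (Icc a b) γ t)
          (Φ.secondFundAt EP (velocity (Icc a b) γ t) (⟨γ t, hp⟩ : P) w w)
          (vec (velocity (E := E) (Icc a b) γ t)) = Φ.transverse a b ε Λ t := by
  classical
  have h0 := hΛ.zero_mem
  have hi : ContMDiff 𝓘(ℝ, EP) 𝓘(ℝ, E) ∞ (Subtype.val : P → M) := hP.isImmersion.contMDiff
  -- The transverse curve lifted to $P$. The value outside the interval is arbitrary, as everything
  -- is differentiated within $(-\varepsilon,\varepsilon)$.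
  let c : ℝ → P := fun s => if h : s ∈ Ioo (-ε) ε then ⟨Λ t s, hmem s h⟩ else ⟨γ t, hp⟩
  have hcv : EqOn (fun s => Λ t s) (fun s => (c s : M)) (Ioo (-ε) ε) := fun s hs => by
    simp only [c, dif_pos hs]
  have hc0 : c 0 = ⟨γ t, hp⟩ := Subtype.ext ((hcv h0).symm.trans (hΛ.base t ht))
  have hcs : ContMDiffOn 𝓘(ℝ, ℝ) 𝓘(ℝ, EP) ∞ c (Ioo (-ε) ε) := fun s hs =>
    (contMDiffAt_of_val hP (((hΛ.contMDiffOn_slice_snd ht).congr fun s hs =>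
      (hcv hs).symm).contMDiffAt (isOpen_Ioo.mem_nhds hs))).contMDiffWithinAt
  have hds : EqOn (fun s => ds (E := E) ε Λ t s)
      (fun s => velocity (Ioo (-ε) ε) (fun s' => (c s' : M)) s) (Ioo (-ε) ε) := fun s hs =>
    velocity_congr hcv hs
  have hw' : w = inclDeriv EP (⟨γ t, hp⟩ : P) (vec (velocity (E := EP) (Ioo (-ε) ε) c 0) : EP) := by
    have h1 := velocity_val hi ((hcs 0 h0).mdifferentiableWithinAt (by simp))
      (isOpen_Ioo.uniqueDiffWithinAt (𝕜 := ℝ) h0)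
    rw [hw, ← hc0]
    exact congrArg vec ((hds h0).trans h1)
  have hN := hΛ.dt_zero ht
  have hA : velocity (Icc a b) γ t ∈ Φ.A := hN ▸ hΛ.admissible t ht 0 h0
  obtain ⟨τ, hτ, h⟩ := exists_vec_D_velocity_eq hi Φ hc0 isOpen_Ioo h0 hcs
    (V := fun s => dt a b Λ t s) (hΛ.admissible t ht 0 h0) (hΛ.base t ht)
  refine ⟨hw' ▸ LinearMap.mem_range_self _ _, ?_⟩
  rw [hw', secondFundAt_inclDeriv hP, transverse, D_congr (Φ := Φ) rfl hds h0, h, hN]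
  exact Φ.g_normalPart hA ho hnd (by rwa [add_sub_cancel_left])

end PseudoFinslerMetric
end Endpoint

end PseudoFinsler

end

/-! ### The second variation formula. -/

theorem corollary3p8
    {E : Type*} [NormedAddCommGroup E] [NormedSpace ℝ E] [FiniteDimensional ℝ E]
    {M : Type*} [TopologicalSpace M] [ChartedSpace E M] [IsManifold 𝓘(ℝ, E) ∞ M]
    (Φ : PseudoFinsler.PseudoFinslerMetric E M)
    {EP : Type*} [NormedAddCommGroup EP] [NormedSpace ℝ EP] [FiniteDimensional ℝ EP]
    (P : Set M) [ChartedSpace EP P] [IsManifold 𝓘(ℝ, EP) ∞ P]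
    (hP : IsSmoothEmbedding 𝓘(ℝ, EP) 𝓘(ℝ, E) ∞ (Subtype.val : P → M))
    {EQ : Type*} [NormedAddCommGroup EQ] [NormedSpace ℝ EQ] [FiniteDimensional ℝ EQ]
    (Q : Set M) [ChartedSpace EQ Q] [IsManifold 𝓘(ℝ, EQ) ∞ Q]
    (hQ : IsSmoothEmbedding 𝓘(ℝ, EQ) 𝓘(ℝ, E) ∞ (Subtype.val : Q → M))
    (a b : ℝ) (hab : a < b) (γ : ℝ → M) (hγ : Φ.IsGeodesic a b γ)
    (hγP : γ a ∈ P) (hγQ : γ b ∈ Q)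
    (hPorth : Φ.IsOrthogonalTo EP (PseudoFinsler.velocity (Icc a b) γ a) (⟨γ a, hγP⟩ : P))
    (hQorth : Φ.IsOrthogonalTo EQ (PseudoFinsler.velocity (Icc a b) γ b) (⟨γ b, hγQ⟩ : Q))
    (hPnd : Φ.NondegenerateOn EP (PseudoFinsler.velocity (Icc a b) γ a) (⟨γ a, hγP⟩ : P))
    (hQnd : Φ.NondegenerateOn EQ (PseudoFinsler.velocity (Icc a b) γ b) (⟨γ b, hγQ⟩ : Q)) :
    -- the second variation formula
    (∀ (ε : ℝ) (Λ : ℝ → ℝ → M) (W : ℝ → TangentBundle 𝓘(ℝ, E) M),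
      Φ.IsPQVariation P Q a b γ ε Λ →
      (∀ t ∈ Icc a b, W t = PseudoFinsler.ds ε Λ t 0) →
      -- the variational field is tangent to `P` and `Q` at the endpoints
      PseudoFinsler.vec (W a) ∈ PseudoFinsler.tangentSub (E := E) EP (⟨γ a, hγP⟩ : P) ∧
      PseudoFinsler.vec (W b) ∈ PseudoFinsler.tangentSub (E := E) EQ (⟨γ b, hγQ⟩ : Q) ∧
      -- all the integrals exist
      (∀ s ∈ Ioo (-ε) ε, IntervalIntegrable
        (fun t => Φ.L (PseudoFinsler.dt a b Λ t s)) MeasureTheory.volume a b) ∧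
      IntervalIntegrable (Φ.secondVariationIntegrand a b γ W) MeasureTheory.volume a b ∧
      -- the energy is differentiable in `s`, and its derivative is differentiable at `s = 0`
      (∀ s ∈ Ioo (-ε) ε,
        DifferentiableAt ℝ (fun s' => Φ.energy a b (fun t => Λ t s')) s) ∧
      HasDerivAt (deriv (fun s => Φ.energy a b (fun t => Λ t s)))
        ((∫ t in a..b, Φ.secondVariationIntegrand a b γ W t)
          + Φ.g (PseudoFinsler.velocity (Icc a b) γ b)
              (Φ.secondFundAt EQ (PseudoFinsler.velocity (Icc a b) γ b) (⟨γ b, hγQ⟩ : Q)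
                (PseudoFinsler.vec (W b)) (PseudoFinsler.vec (W b)))
              (PseudoFinsler.vec (PseudoFinsler.velocity (E := E) (Icc a b) γ b))
          - Φ.g (PseudoFinsler.velocity (Icc a b) γ a)
              (Φ.secondFundAt EP (PseudoFinsler.velocity (Icc a b) γ a) (⟨γ a, hγP⟩ : P)
                (PseudoFinsler.vec (W a)) (PseudoFinsler.vec (W a)))
              (PseudoFinsler.vec (PseudoFinsler.velocity (E := E) (Icc a b) γ a)))
        0) ∧
    -- the second variation depends only on the variational field
    (∀ (ε₁ ε₂ : ℝ) (Λ₁ Λ₂ : ℝ → ℝ → M),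
      Φ.IsPQVariation P Q a b γ ε₁ Λ₁ → Φ.IsPQVariation P Q a b γ ε₂ Λ₂ →
      (∀ t ∈ Icc a b, PseudoFinsler.ds (E := E) ε₁ Λ₁ t 0 = PseudoFinsler.ds ε₂ Λ₂ t 0) →
      deriv (deriv (fun s => Φ.energy a b (fun t => Λ₁ t s))) 0
        = deriv (deriv (fun s => Φ.energy a b (fun t => Λ₂ t s))) 0) := by
  have ha := left_mem_Icc.2 hab.le
  have hb := right_mem_Icc.2 hab.le
  -- The last assertion follows from the formula: its right-hand side involves the variation only
  -- through $W$, so the field of $\Lambda_1$ is used for both variations.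
  refine and_iff_left_of_imp (fun key ε₁ ε₂ Λ₁ Λ₂ h₁ h₂ h => ?_) |>.2 fun ε Λ W h hW => ?_
  · rw [(key ε₁ Λ₁ (fun t => PseudoFinsler.ds ε₁ Λ₁ t 0) h₁ fun _ _ => rfl).2.2.2.2.2.deriv,
      (key ε₂ Λ₂ (fun t => PseudoFinsler.ds ε₁ Λ₁ t 0) h₂ h).2.2.2.2.2.deriv]
  · have hΛ := h.toIsVariation
    obtain ⟨ha₁, ha₂⟩ := hΛ.endpoint hP ha h.left_mem hγP hPorth hPnd
      (congrArg PseudoFinsler.vec (hW a ha))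
    obtain ⟨hb₁, hb₂⟩ := hΛ.endpoint hQ hb h.right_mem hγQ hQorth hQnd
      (congrArg PseudoFinsler.vec (hW b hb))
    refine ⟨ha₁, hb₁, fun s hs => hΛ.intervalIntegrable_lagrangian hab hs,
      hΛ.intervalIntegrable_secondVariationIntegrand hab hγ hW,
      fun s hs => (hΛ.hasDerivAt_energy hab hs).differentiableAt, ?_⟩
    rw [ha₂, hb₂]
    exact hΛ.hasDerivAt_deriv_energy_transverse hab hγ hW
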